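/- Let $\phi_n:\mathbb R\to\mathbb C$ $(n\ge 1)$ be uniformly bounded and locally uniformly bi-Lipschitz: $\sup_n\|\phi_n\|_\infty<\infty$, and there are constants $L\ge 1$ and $\delta>0$ such that $$L^{-1}|x-y|\le|\phi_n(x)-\phi_n(y)|\le L|x-y|\qquad\text{whenever } |x-y|\le\delta \text{ and } n\ge 1.$$ Let $a_n\in\mathbb C\setminus\{0\}$ with $\sum_{n\ge 1}|a_n|<\infty$, and let $(\lambda_n)_{n\ge1}$ be a nondecreasing sequence of real numbers with $\lambda_1=1$ and $1<q:=\sup_n\lambda_{n+1}/\lambda_n<\infty$ (the inequality $q>1$ is automatic if $(\lambda_n)$ is strictly increasing). Put $$s_k=\Bigl(\sum_{q^k\le\lambda_n<q^{k+1}}|a_n|^2\Bigr)^{1/2},\qquad \sigma=\liminf_{k\to\infty}\frac{-\log s_k}{k\log q},\qquad \tau=\limsup_{k\to\infty}\frac{-\log s_k}{k\log q},$$ with the convention $-\log 0=+\infty$, so that $\sigma\le\tau$ are elements of $[0,\infty]$. Let $\theta_n$ $(n\ge 1)$ be independent random variables uniformly distributed on $[0,1]$, let $X_n=e^{2\pi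 i\theta_n}$, and let $$S(x)=\sum_{n=1}^\infty a_nX_n\phi_n(\lambda_nx),\qquad x\in\mathbb R.$$ Then for every Borel set $A\subset\mathbb R$ the following hold, where $\dim_H$ is the Hausdorff dimension. (i) If $0<\sigma\le\tau<\infty$, then almost surely $$\min\Bigl\{2,\frac{\dim_H A}{\tau}\Bigr\}\le\dim_H S(A)\le\min\Bigl\{2,\frac{\dim_H A}{\min\{\sigma,1\}}\Bigr\}.$$ (ii) If $0<\tau<\frac12\dim_H A$, then almost surely $S(A)$ has positive two-dimensional Lebesgue measure. (iii) If $0<\tau<\frac14\dim_H A$, then almost surely $S(A)$ has nonempty interior. (iv) If $\tau=0$ and $\dim_H A>0$, then almost surely $S(A)$ has nonempty interior. -/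

import Mathlib

noncomputable section

namespace SteinhausSeries

/-- The functions `φ n : ℝ → ℂ` are uniformly bounded and locally uniformly bi-Lipschitz:
one bound `M`, one constant `L ≥ 1` and one scale `δ > 0` serve all `n`. -/
def BoundedLocallyBiLipschitz (φ : ℕ → ℝ → ℂ) : Prop :=
  (∃ M : ℝ, ∀ n x, ‖φ n x‖ ≤ M) ∧
    ∃ L δ : ℝ, 1 ≤ L ∧ 0 < δ ∧ ∀ n x y, |x - y| ≤ δ →
      L⁻¹ * |x - y| ≤ ‖φ n x - φ n y‖ ∧ ‖φ n x - φ n y‖ ≤ L * |x - y|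

/-- The block `ℓ²`-size `s_k = (∑_{q^k ≤ λ_n < q^{k+1}} |a_n|²)^{1/2}`. -/
def blockSize (a : ℕ → ℂ) (lam : ℕ → ℝ) (q : ℝ) (k : ℕ) : ℝ :=
  Real.sqrt (∑' n : {n : ℕ // q ^ k ≤ lam n ∧ lam n < q ^ (k + 1)}, ‖a n‖ ^ 2)

/-- The quotient `-log s_k / (k log q)` as an extended real number. The logarithm is the extended
one, with `log 0 = -∞`, so that an empty block contributes `+∞`. -/
def blockExponent (a : ℕ → ℂ) (lam : ℕ → ℝ) (q : ℝ) (k : ℕ) : EReal :=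
  -ENNReal.log (ENNReal.ofReal (blockSize a lam q k)) / ((k * Real.log q : ℝ) : EReal)

/-- `σ = liminf_k -log s_k / (k log q)`. -/
def sigma (a : ℕ → ℂ) (lam : ℕ → ℝ) (q : ℝ) : EReal :=
  Filter.liminf (blockExponent a lam q) Filter.atTop

/-- `τ = limsup_k -log s_k / (k log q)`. -/
def tau (a : ℕ → ℂ) (lam : ℕ → ℝ) (q : ℝ) : EReal :=
  Filter.limsup (blockExponent a lam q) Filter.atTop

/-- The series `S(x) = ∑ a_n X_n φ_n(λ_n x)` with `X_n = exp(2πi θ_n)`, for one realization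
`θ : ℕ → ℝ` of the phases. The sequences are indexed from `0` instead of `1`. -/
def series (a : ℕ → ℂ) (φ : ℕ → ℝ → ℂ) (lam : ℕ → ℝ) (θ : ℕ → ℝ) (x : ℝ) : ℂ :=
  ∑' n, a n * Complex.exp (2 * Real.pi * Complex.I * θ n) * φ n (lam n * x)

end SteinhausSeries

end

open MeasureTheory ProbabilityTheory Set Filter Topology
open scoped ENNReal NNReal

namespace SteinhausSeries

/-! An increment S(x) − S(y) is a sum of independent uniform points on circles of radii |b_n|, where
b_n = a_n (φ_n(λ_n x) − φ_n(λ_n y)). Every assertion comes from an estimate for the law of this sum,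
which is spread out when the radii are large and concentrated when they are small.

Lower bounds. The characteristic function of the increment is a product of Bessel factors
J₀(|ξ||b_n|), and |J₀(t)|⁴ ≤ (1 + t²/2592)⁻¹ (`circleMean_pow_four_mul_le`). Fix τ' > τ. In the
blocks with λ_n a little below 1/|x − y| the differences of φ_n are bounded below by the
bi-Lipschitz condition, and the block ℓ²-size is at least of order |x − y|^τ'. Twelve such blocks
give the decay (1 + |ξ||x − y|^τ')⁻⁶ (`exists_norm_integral_increment_le`). Testing against a
Gaussian turns this into P(|S(x) − S(y)| ≤ ρ) ≤ C ρ^s |x − y|^(−sτ') for 0 < s ≤ 2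
(`exists_measure_increment_le`).

Let ν be a probability measure of finite energy on a compact subset of A; it exists below the
dimension by Frostman's lemma, proved here for Borel sets through capacitability of the dyadic net
content (`exists_measure_energy_lt_top`). The expected ν × ν mass of the pairs whose images are
ρ-close is at most C ρ^s times the sτ'-energy of ν. Summation over dyadic ρ, with a small loss in s,
bounds the dimension of S(A) from below. With s = 2, Fatou's lemma shows that the image measure has
finite lower area density almost everywhere, so S(A) has positive area. For the interior, the mean
square of the characteristic function of the image measure is O((1 + |ξ|)^(−s)) with some s > 4 when
4τ' < dim A, so this function is almost surely integrable; a closed set of full measure then has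
interior points (`interior_nonempty_of_integrable_charFun`). The case τ = 0 is the same argument
with a small τ' > 0.

Upper bound. If g < min(σ, 1), then ∑ |b_n|² ≤ C |x − y|^(2g). Hoeffding's inequality and
Borel–Cantelli over dyadic increments make S almost surely locally α-Hölder for every α < g, and an
α-Hölder map multiplies the dimension by at most 1/α. -/

/-! ### Dyadic net contents on the line -/

/-- The index of the dyadic interval of side `2⁻ⁿ` that contains `x`. -/
noncomputable def dyadicIndex (n : ℕ) (x : ℝ) : ℤ := ⌊x * 2 ^ n⌋

/-- The half-open dyadic interval of level `Q.1` and index `Q.2`. -/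
def dyadicInterval (Q : ℕ × ℤ) : Set ℝ := {x | dyadicIndex Q.1 x = Q.2}

/-- The union of a family of dyadic intervals. -/
def dyadicUnion (F : Set (ℕ × ℤ)) : Set ℝ := ⋃ Q ∈ F, dyadicInterval Q

/-- The total weight of a family of dyadic intervals. -/
noncomputable def netCost (w : ℕ → ℝ≥0∞) (F : Set (ℕ × ℤ)) : ℝ≥0∞ := ∑' Q, F.indicator (fun Q => w Q.1) Q

/-- The dyadic net content of a set. -/
noncomputable def netContent (w : ℕ → ℝ≥0∞) (E : Set ℝ) : ℝ≥0∞ :=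
  ⨅ (F : Set (ℕ × ℤ)) (_ : E ⊆ dyadicUnion F), netCost w F

lemma dyadicIndex_eq_div {m n : ℕ} (h : m ≤ n) (x : ℝ) :
    dyadicIndex m x = dyadicIndex n x / 2 ^ (n - m) := by
  unfold dyadicIndex
  have := Int.floor_div_natCast (x * 2 ^ n) (2 ^ (n - m))
  push_cast at this
  rw [← this]
  congr 1
  rw [eq_div_iff (by positivity), mul_assoc, ← pow_add]
  congr 2
  omega

lemma dyadicIndex_congr {m n : ℕ} (h : m ≤ n) {x y : ℝ}
    (hxy : dyadicIndex n x = dyadicIndex n y) : dyadicIndex m x = dyadicIndex m y := by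
  rw [dyadicIndex_eq_div h, dyadicIndex_eq_div h, hxy]

lemma mem_dyadicUnion {F : Set (ℕ × ℤ)} {x : ℝ} :
    x ∈ dyadicUnion F ↔ ∃ n, (n, dyadicIndex n x) ∈ F := by
  simp only [dyadicUnion, dyadicInterval, mem_iUnion, mem_ofPred_eq, exists_prop, Prod.exists]
  constructor
  · rintro ⟨n, j, h, rfl⟩; exact ⟨n, h⟩
  · rintro ⟨n, h⟩; exact ⟨n, _, h, rfl⟩

lemma dyadicUnion_union (F G : Set (ℕ × ℤ)) :
    dyadicUnion (F ∪ G) = dyadicUnion F ∪ dyadicUnion G := biUnion_union ..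

lemma netContent_le {w : ℕ → ℝ≥0∞} {E : Set ℝ} {F : Set (ℕ × ℤ)} (h : E ⊆ dyadicUnion F) :
    netContent w E ≤ netCost w F := iInf₂_le F h

lemma exists_cover_lt {w : ℕ → ℝ≥0∞} {E : Set ℝ} {c : ℝ≥0∞} (h : netContent w E < c) :
    ∃ F, E ⊆ dyadicUnion F ∧ netCost w F < c := by
  simpa [netContent, iInf_lt_iff] using h

lemma netContent_mono (w : ℕ → ℝ≥0∞) {E E' : Set ℝ} (h : E ⊆ E') :
    netContent w E ≤ netContent w E' :=
  le_iInf₂ fun _ hF => netContent_le (h.trans hF)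

lemma netCost_union_le (w : ℕ → ℝ≥0∞) (F G : Set (ℕ × ℤ)) :
    netCost w (F ∪ G) ≤ netCost w F + netCost w G := by
  unfold netCost
  rw [← ENNReal.tsum_add]
  refine ENNReal.tsum_le_tsum fun Q => ?_
  by_cases hF : Q ∈ F <;> by_cases hG : Q ∈ G <;> simp [hF, hG]

lemma netContent_union_le (w : ℕ → ℝ≥0∞) (E E' : Set ℝ) :
    netContent w (E ∪ E') ≤ netContent w E + netContent w E' := by
  refine ENNReal.le_of_forall_pos_le_add fun ε hε hlt => ?_
  have hE := (ENNReal.add_lt_top.1 hlt).1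
  have hE' := (ENNReal.add_lt_top.1 hlt).2
  have h2 : ((ε / 2 : NNReal) : ℝ≥0∞) ≠ 0 := by simpa using hε.ne'
  obtain ⟨F, hF, hFc⟩ := exists_cover_lt (ENNReal.lt_add_right hE.ne h2)
  obtain ⟨G, hG, hGc⟩ := exists_cover_lt (ENNReal.lt_add_right hE'.ne h2)
  calc netContent w (E ∪ E') ≤ netCost w (F ∪ G) :=
        netContent_le (by rw [dyadicUnion_union]; exact union_subset_union hF hG)
    _ ≤ netCost w F + netCost w G := netCost_union_le ..
    _ ≤ (netContent w E + (ε / 2 : NNReal)) + (netContent w E' + (ε / 2 : NNReal)) := by gcongr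
    _ = netContent w E + netContent w E' + ε := by
        rw [add_add_add_comm, ← ENNReal.coe_add, add_halves]

/-- The members of a family of dyadic intervals that meet no member of lower level. -/
def maximalMembers (F : Set (ℕ × ℤ)) : Set (ℕ × ℤ) :=
  {Q ∈ F | ∀ x ∈ dyadicInterval Q, ∀ n < Q.1, (n, dyadicIndex n x) ∉ F}

/-- Take the least level at which the interval around `x` lies in `F`. All points of that interval
share their ancestors of lower level, so testing maximality at `x` alone is enough. -/
lemma exists_mem_maximalMembers {F : Set (ℕ × ℤ)} {x : ℝ} {n : ℕ} (h : (n, dyadicIndex n x) ∈ F) :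
    ∃ m ≤ n, (m, dyadicIndex m x) ∈ maximalMembers F := by
  classical
  have hex : ∃ m, (m, dyadicIndex m x) ∈ F := ⟨n, h⟩
  refine ⟨Nat.find hex, Nat.find_min' hex h, Nat.find_spec hex, fun y hy k hk hkF => ?_⟩
  have : dyadicIndex k y = dyadicIndex k x := dyadicIndex_congr hk.le hy
  exact Nat.find_min hex hk (this ▸ hkF)

lemma dyadicUnion_maximalMembers (F : Set (ℕ × ℤ)) :
    dyadicUnion (maximalMembers F) = dyadicUnion F := by
  ext x
  simp only [mem_dyadicUnion]
  constructor
  · rintro ⟨n, h⟩; exact ⟨n, h.1⟩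
  · rintro ⟨n, h⟩
    obtain ⟨m, -, hm⟩ := exists_mem_maximalMembers h
    exact ⟨m, hm⟩

/-- Strong subadditivity of the cost. -/
lemma netCost_maximalMembers_add_le (w : ℕ → ℝ≥0∞) (F G : Set (ℕ × ℤ)) :
    netCost w (maximalMembers (F ∪ G)) + netContent w (dyadicUnion F ∩ dyadicUnion G) ≤
      netCost w F + netCost w G := by
  -- The intervals left over: those swallowed by a larger one and those occurring in both families.
  -- A point in both unions lies in two distinct nested members, the smaller of which is not
  -- maximal, or in a common member. Each interval is counted on the left at most as often as on the
  -- right.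
  set low : Set (ℕ × ℤ) := ((F ∪ G) \ maximalMembers (F ∪ G)) ∪ (F ∩ G) with hlow
  have hcov : dyadicUnion F ∩ dyadicUnion G ⊆ dyadicUnion low := by
    rintro x ⟨hF, hG⟩
    obtain ⟨m, hm⟩ := mem_dyadicUnion.1 hF
    obtain ⟨n, hn⟩ := mem_dyadicUnion.1 hG
    refine mem_dyadicUnion.2 ?_
    rcases lt_trichotomy m n with h | h | h
    · exact ⟨n, Or.inl ⟨Or.inr hn, fun hmax => hmax.2 x rfl m h (Or.inl hm)⟩⟩
    · subst h; exact ⟨m, Or.inr ⟨hm, hn⟩⟩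
    · exact ⟨m, Or.inl ⟨Or.inl hm, fun hmax => hmax.2 x rfl n h (Or.inr hn)⟩⟩
  refine (add_le_add_right (netContent_le hcov) _).trans ?_
  unfold netCost
  rw [← ENNReal.tsum_add, ← ENNReal.tsum_add]
  refine ENNReal.tsum_le_tsum fun Q => ?_
  have hsub : Q ∈ maximalMembers (F ∪ G) → Q ∈ F ∪ G := fun h => h.1
  by_cases hF : Q ∈ F <;> by_cases hG : Q ∈ G <;> by_cases hM : Q ∈ maximalMembers (F ∪ G) <;>
    simp_all

/-- The net content is continuous along increasing sequences of arbitrary sets. -/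
lemma netContent_iUnion_le {w : ℕ → ℝ≥0∞} {E : ℕ → Set ℝ} (hE : Monotone E) {c : ℝ≥0∞}
    (hc : ∀ i, netContent w (E i) ≤ c) : netContent w (⋃ i, E i) ≤ c := by
  rcases eq_or_ne c ⊤ with rfl | hctop
  · exact le_top
  refine ENNReal.le_of_forall_pos_le_add fun ε hε _ => ?_
  obtain ⟨e, he, hesum⟩ := ENNReal.exists_pos_sum_of_countable' (ENNReal.coe_pos.2 hε).ne' ℕ
  have hfin : ∀ i, netContent w (E i) ≠ ⊤ := fun i => ((hc i).trans_lt hctop.lt_top).ne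
  choose C hC hCc using fun i => exists_cover_lt (ENNReal.lt_add_right (hfin i) (he i).ne')
  -- A running cover, pruned to its maximal members at each step. Since `E n` lies in both unions,
  -- strong subadditivity lets the cost exceed the content of `E n` only by the accumulated errors
  -- `e i`, instead of adding up the contents.
  let D : ℕ → Set (ℕ × ℤ) := fun n => n.rec (C 0) fun n d => maximalMembers (d ∪ C (n + 1))
  have hD : ∀ n, D (n + 1) = maximalMembers (D n ∪ C (n + 1)) := fun n => rfl
  have hDcov : ∀ n, E n ⊆ dyadicUnion (D n) := by
    intro n
    cases n with
    | zero => exact hC 0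
    | succ n =>
      rw [hD, dyadicUnion_maximalMembers, dyadicUnion_union]
      exact (hC _).trans subset_union_right
  have hDcost : ∀ n, netCost w (D n) ≤ netContent w (E n) + ∑ i ∈ Finset.range (n + 1), e i := by
    intro n
    induction n with
    | zero =>
      change netCost w (C 0) ≤ _
      simpa using (hCc 0).le
    | succ n ih =>
      have h1 := netCost_maximalMembers_add_le w (D n) (C (n + 1))
      rw [← hD] at h1
      have h2 : netContent w (E n) ≤ netContent w (dyadicUnion (D n) ∩ dyadicUnion (C (n + 1))) :=
        netContent_mono w (subset_inter (hDcov n) ((hE n.le_succ).trans (hC _)))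
      have h3 : netCost w (D (n + 1)) + netContent w (E n) ≤
          (netContent w (E (n + 1)) + ∑ i ∈ Finset.range (n + 1 + 1), e i) +
            netContent w (E n) := by
        calc _ ≤ netCost w (D n) + netCost w (C (n + 1)) := (add_le_add_right h2 _).trans h1
          _ ≤ (netContent w (E n) + ∑ i ∈ Finset.range (n + 1), e i) +
              (netContent w (E (n + 1)) + e (n + 1)) := add_le_add ih (hCc _).le
          _ = _ := by rw [Finset.sum_range_succ e (n + 1)]; ring
      exact (ENNReal.add_le_add_iff_right (hfin n)).1 h3
  -- The limit cover consists of the intervals that stay from some stage on. Around a point, the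
  -- interval of least level that ever appears is never swallowed later, so it stays. A finite part
  -- of `L` lies in a single `D n`, which bounds the cost.
  set L : Set (ℕ × ℤ) := {Q | ∃ N, ∀ n ≥ N, Q ∈ D n}
  have hL : ∀ Q, Q ∈ L ↔ ∃ N, ∀ n ≥ N, Q ∈ D n := fun Q => Iff.rfl
  have hLcov : (⋃ i, E i) ⊆ dyadicUnion L := by
    intro x hx
    obtain ⟨i, hi⟩ := mem_iUnion.1 hx
    have hex : ∃ m n, (m, dyadicIndex m x) ∈ D n := by
      obtain ⟨m, hm⟩ := mem_dyadicUnion.1 (hDcov i hi)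
      exact ⟨m, i, hm⟩
    obtain ⟨m₀, ⟨N, hN⟩, hmin⟩ : ∃ m, (∃ n, (m, dyadicIndex m x) ∈ D n) ∧
        ∀ k, (∃ n, (k, dyadicIndex k x) ∈ D n) → m ≤ k := by
      classical
      exact ⟨Nat.find hex, Nat.find_spec hex, fun k hk => Nat.find_min' hex hk⟩
    refine mem_dyadicUnion.2 ⟨m₀, (hL _).2 ⟨N, fun n hn => ?_⟩⟩
    induction n, hn using Nat.le_induction with
    | base => exact hN
    | succ n _ ih =>
      obtain ⟨m, hm, hmD⟩ := exists_mem_maximalMembers (mem_union_left (C (n + 1)) ih)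
      have h2 : m₀ ≤ m := hmin m ⟨n + 1, hmD⟩
      rw [le_antisymm h2 hm]
      exact hmD
  refine (netContent_le hLcov).trans ?_
  rw [netCost, ENNReal.tsum_eq_iSup_sum]
  refine iSup_le fun S => ?_
  have hev : ∀ᶠ n in atTop, ∀ Q ∈ S, Q ∈ L → Q ∈ D n := by
    rw [Filter.eventually_all_finset]
    intro Q _
    rcases em (Q ∈ L) with hQ | hQ
    · obtain ⟨N, hN⟩ := (hL Q).1 hQ
      exact eventually_atTop.2 ⟨N, fun n hn _ => hN n hn⟩
    · exact Eventually.of_forall fun n h => absurd h hQ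
  obtain ⟨n, hn⟩ := hev.exists
  calc ∑ Q ∈ S, L.indicator (fun Q => w Q.1) Q ≤ ∑ Q ∈ S, (D n).indicator (fun Q => w Q.1) Q := by
        refine Finset.sum_le_sum fun Q hQ => ?_
        by_cases hQL : Q ∈ L
        · simp [hQL, hn Q hQ hQL]
        · simp [hQL]
    _ ≤ netCost w (D n) := ENNReal.sum_le_tsum _
    _ ≤ netContent w (E n) + ∑ i ∈ Finset.range (n + 1), e i := hDcost n
    _ ≤ c + ε := add_le_add (hc n) ((ENNReal.sum_le_tsum _).trans hesum.le)

/-- A set of finite cost is contained in an open set of comparable content. -/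
lemma exists_isOpen_netContent_le (w : ℕ → ℝ≥0∞) (F : Set (ℕ × ℤ)) :
    ∃ U, IsOpen U ∧ dyadicUnion F ⊆ U ∧ netContent w U ≤ 3 * netCost w F := by
  -- Fattening each interval to an open one makes it spill only into its two neighbours of the same
  -- level; the three shifts 0, 1, −1 of the family give the factor 3.
  set sh : ℤ → ℕ × ℤ ≃ ℕ × ℤ := fun d => (Equiv.refl ℕ).prodCongr (Equiv.addRight d) with hsh
  have hcost : ∀ d, netCost w (sh d ⁻¹' F) = netCost w F := by
    intro d
    unfold netCost
    rw [← (sh d).tsum_eq (F.indicator fun Q => w Q.1)]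
    rfl
  set U : Set ℝ := ⋃ Q ∈ F, Ioo (((Q.2 : ℝ) - 1) / 2 ^ Q.1) (((Q.2 : ℝ) + 1 + 1) / 2 ^ Q.1) with hU
  refine ⟨U, isOpen_biUnion fun _ _ => isOpen_Ioo, ?_, ?_⟩
  · intro x hx
    obtain ⟨n, hn⟩ := mem_dyadicUnion.1 hx
    refine mem_biUnion hn ⟨?_, ?_⟩
    · rw [div_lt_iff₀ (by positivity)]
      have := Int.floor_le (x * 2 ^ n)
      simp only [dyadicIndex]; linarith
    · rw [lt_div_iff₀ (by positivity)]
      have := Int.lt_floor_add_one (x * 2 ^ n)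
      simp only [dyadicIndex]; linarith
  · have hsub : U ⊆ dyadicUnion (sh 0 ⁻¹' F ∪ (sh 1 ⁻¹' F ∪ sh (-1) ⁻¹' F)) := by
      intro x hx
      obtain ⟨⟨n, j⟩, hQ, h1, h2⟩ := by simpa only [hU, mem_iUnion, exists_prop] using hx
      rw [div_lt_iff₀ (by positivity)] at h1
      rw [lt_div_iff₀ (by positivity)] at h2
      simp only at h1 h2
      refine mem_dyadicUnion.2 ⟨n, ?_⟩
      have h3 : j - 1 ≤ dyadicIndex n x := Int.le_floor.2 (by push_cast; exact h1.le)
      have h4 : dyadicIndex n x < j + 1 + 1 := Int.floor_lt.2 (by push_cast; exact h2)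
      have h5 : dyadicIndex n x = j ∨ dyadicIndex n x + 1 = j ∨ dyadicIndex n x + -1 = j := by omega
      simp only [mem_union, mem_preimage, hsh, Equiv.prodCongr_apply, Prod.map, Equiv.refl_apply,
        Equiv.coe_addRight, add_zero]
      rcases h5 with h | h | h <;> simp [h, hQ]
    refine (netContent_le hsub).trans ((netCost_union_le ..).trans
      ((add_le_add_right (netCost_union_le ..) _).trans ?_))
    rw [hcost, hcost, hcost]
    apply le_of_eq; ring

/-- Capacitability: an analytic set of positive net content contains a compact set of positive
net content. -/
lemma exists_isCompact_netContent_pos {w : ℕ → ℝ≥0∞} {A : Set ℝ} (hA : AnalyticSet A)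
    (h : 0 < netContent w A) : ∃ K ⊆ A, IsCompact K ∧ 0 < netContent w K := by
  obtain ⟨c, hc0, hcA⟩ := exists_between h
  rw [AnalyticSet] at hA
  rcases hA with rfl | ⟨f, hf, rfl⟩
  · exact ⟨∅, Subset.rfl, isCompact_empty, h⟩
  -- Continuity along increasing unions allows a bound on one more coordinate of Baire space while
  -- the content of the image stays above `c`. The bounds for all coordinates together cut out a
  -- compact box.
  have step : ∀ B : Set (ℕ → ℕ), c < netContent w (f '' B) → ∀ k : ℕ,
      ∃ N, c < netContent w (f '' (B ∩ {x | x k ≤ N})) := by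
    intro B hB k
    by_contra! hcon
    have hmono : Monotone fun N => f '' (B ∩ {x : ℕ → ℕ | x k ≤ N}) := fun N N' hN =>
      image_mono (inter_subset_inter_right _ fun x (hx : x k ≤ N) => hx.trans hN)
    have := netContent_iUnion_le hmono hcon
    rw [← image_iUnion, ← inter_iUnion] at this
    have huniv : (⋃ N, {x : ℕ → ℕ | x k ≤ N}) = univ := by
      ext x; simpa using ⟨x k, le_rfl⟩
    rw [huniv, inter_univ] at this
    exact absurd hB (not_lt.2 this)
  choose! N hN using step
  let B : ℕ → Set (ℕ → ℕ) := fun n => n.rec univ fun k b => b ∩ {x | x k ≤ N b k}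
  have hBsucc : ∀ n, B (n + 1) = B n ∩ {x | x n ≤ N (B n) n} := fun n => rfl
  have hBc : ∀ n, c < netContent w (f '' B n) := by
    intro n
    induction n with
    | zero => simpa [B] using hcA
    | succ n ih => rw [hBsucc]; exact hN _ ih n
  set M : ℕ → ℕ := fun n => N (B n) n with hM
  have hBmem : ∀ n x, x ∈ B n ↔ ∀ i < n, x i ≤ M i := by
    intro n x
    induction n with
    | zero => simp [B]
    | succ n ih =>
      rw [hBsucc, mem_inter_iff, ih, mem_ofPred_eq]
      constructor
      · rintro ⟨h1, h2⟩ i hi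
        rcases Nat.lt_succ_iff_lt_or_eq.1 hi with h | rfl
        · exact h1 i h
        · exact h2
      · exact fun h => ⟨fun i hi => h i (hi.trans n.lt_succ_self), h n n.lt_succ_self⟩
  have hcomp : IsCompact (Set.pi univ fun i => Iic (M i)) :=
    isCompact_univ_pi fun i => (finite_Iic (M i)).isCompact
  refine ⟨f '' Set.pi univ fun i => Iic (M i), image_subset_range _ _, hcomp.image hf, ?_⟩
  by_contra! hle
  -- Dividing by 3 compensates the loss in passing from a cover to an open set, so that the open set
  -- still has content below `c`.
  have hc3 : 0 < c / 3 := ENNReal.div_pos hc0.ne' (by simp)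
  obtain ⟨F, hF, hFc⟩ := exists_cover_lt (hle.trans_lt hc3)
  obtain ⟨U, hUo, hFU, hU⟩ := exists_isOpen_netContent_le w F
  have hUc : netContent w U < c := by
    refine hU.trans_lt ?_
    calc 3 * netCost w F < 3 * (c / 3) := by
          refine (ENNReal.mul_lt_mul_iff_right (by simp) (by simp)).2 hFc
      _ = c := ENNReal.mul_div_cancel (by simp) (by simp)
  have hsub : (Set.pi univ fun i => Iic (M i)) ⊆ f ⁻¹' U := image_subset_iff.1 (hF.trans hFU)
  -- Finitely many coordinate bounds already force the image into `U`. Otherwise bad points `x n`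
  -- could be truncated into the compact box; a subsequence of the truncations converges, and so
  -- does that of the `x n`, because truncation leaves the first `n` coordinates alone.
  have hBU : ∃ n, B n ⊆ f ⁻¹' U := by
    by_contra! hcon
    choose x hxB hxU using fun n => not_subset.1 (hcon n)
    let y : ℕ → ℕ → ℕ := fun n i => min (x n i) (M i)
    have hy : ∀ n, y n ∈ Set.pi univ fun i => Iic (M i) := fun n i _ => mem_Iic.2 (min_le_right _ _)
    obtain ⟨z, hz, g, hg, hyz⟩ := hcomp.tendsto_subseq hy
    have hxz : Tendsto (x ∘ g) atTop (𝓝 z) := by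
      rw [tendsto_pi_nhds] at hyz ⊢
      intro i
      refine (hyz i).congr' ?_
      filter_upwards [eventually_gt_atTop i] with n hn
      exact min_eq_left ((hBmem _ _).1 (hxB (g n)) i (hn.trans_le (hg.id_le n)))
    obtain ⟨n, hn⟩ := (hxz.eventually ((hUo.preimage hf).mem_nhds (hsub hz))).exists
    exact hxU (g n) hn
  obtain ⟨n, hn⟩ := hBU
  exact absurd (hBc n) (not_lt.2 ((netContent_mono w (image_subset_iff.2 hn)).trans hUc.le))

/-! ### Frostman measures -/

/-- The weight `2 ^ (-t n)` of a dyadic interval of level `n`. -/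
noncomputable def powerWeight (t : ℝ) (n : ℕ) : ℝ≥0∞ := ((2⁻¹ : ℝ≥0∞) ^ n) ^ t

lemma ofReal_two_pow_inv (n : ℕ) : ENNReal.ofReal (((2 : ℝ) ^ n)⁻¹) = (2⁻¹ : ℝ≥0∞) ^ n := by
  rw [ENNReal.ofReal_inv_of_pos (by positivity), ENNReal.ofReal_pow (by norm_num), ENNReal.inv_pow]
  norm_num

lemma powerWeight_ne_top {t : ℝ} (ht : 0 ≤ t) (n : ℕ) : powerWeight t n ≠ ⊤ :=
  ENNReal.rpow_ne_top_of_nonneg ht (ENNReal.pow_ne_top (by simp))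

lemma abs_sub_lt_of_dyadicIndex_eq {n : ℕ} {x y : ℝ} (h : dyadicIndex n x = dyadicIndex n y) :
    |x - y| < ((2 : ℝ) ^ n)⁻¹ := by
  have h1 := Int.abs_sub_lt_one_of_floor_eq_floor h
  rw [← sub_mul, abs_mul, abs_of_pos (by positivity : (0 : ℝ) < 2 ^ n)] at h1
  rwa [inv_eq_one_div, lt_div_iff₀ (by positivity)]

lemma edist_le_of_dyadicIndex_eq {n : ℕ} {x y : ℝ} (h : dyadicIndex n x = dyadicIndex n y) :
    edist x y ≤ (2⁻¹ : ℝ≥0∞) ^ n := by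
  rw [edist_dist, Real.dist_eq, ← ofReal_two_pow_inv]
  exact ENNReal.ofReal_le_ofReal (abs_sub_lt_of_dyadicIndex_eq h).le

lemma ediam_dyadicInterval_le (Q : ℕ × ℤ) :
    Metric.ediam (dyadicInterval Q) ≤ (2⁻¹ : ℝ≥0∞) ^ Q.1 :=
  Metric.ediam_le fun x hx y hy => edist_le_of_dyadicIndex_eq
    ((show dyadicIndex Q.1 x = Q.2 from hx).trans (show dyadicIndex Q.1 y = Q.2 from hy).symm)

/-- A set of positive Hausdorff measure has positive net content. -/
lemma netContent_pos_of_hausdorffMeasure_ne_zero {t : ℝ} (ht : 0 < t) {A : Set ℝ}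
    (hA : Measure.hausdorffMeasure t A ≠ 0) : 0 < netContent (powerWeight t) A := by
  rw [pos_iff_ne_zero]
  contrapose! hA
  have hpos : ∀ k : ℕ, netContent (powerWeight t) A < (2⁻¹ : ℝ≥0∞) ^ k := fun k => by
    rw [hA]; exact ENNReal.pow_pos (by simp) k
  choose F hF hFc using fun k => exists_cover_lt (hpos k)
  have htend : Tendsto (fun k : ℕ => (2⁻¹ : ℝ≥0∞) ^ k) atTop (𝓝 0) :=
    ENNReal.tendsto_pow_atTop_nhds_zero_of_lt_one (by simp)
  have hsum : ∀ k, ∑' Q : F k, Metric.ediam (dyadicInterval Q.1) ^ t ≤ (2⁻¹ : ℝ≥0∞) ^ k := by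
    intro k
    calc ∑' Q : F k, Metric.ediam (dyadicInterval Q.1) ^ t
        ≤ ∑' Q : F k, powerWeight t Q.1.1 := ENNReal.tsum_le_tsum fun Q =>
          ENNReal.rpow_le_rpow (ediam_dyadicInterval_le _) ht.le
      _ = netCost (powerWeight t) (F k) := tsum_subtype (F k) fun Q => powerWeight t Q.1
      _ ≤ _ := (hFc k).le
  -- A single interval costs no more than the whole cover, below 2⁻ᵏ, so its diameter is at most
  -- (2⁻ᵏ)^(1/t): the mesh of the covers tends to 0.
  have := Measure.hausdorffMeasure_le_liminf_tsum (ι := fun k : ℕ => F k) t A (l := atTop)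
    (fun k => ((2⁻¹ : ℝ≥0∞) ^ k) ^ t⁻¹) ?_ (fun k Q => dyadicInterval Q.1) ?_ ?_
  · refine le_antisymm (this.trans ?_) zero_le
    calc liminf (fun k => ∑' Q : F k, Metric.ediam (dyadicInterval Q.1) ^ t) atTop
        ≤ liminf (fun k : ℕ => (2⁻¹ : ℝ≥0∞) ^ k) atTop :=
          liminf_le_liminf (Eventually.of_forall hsum)
      _ = 0 := htend.liminf_eq
  · have h0 : (0 : ℝ≥0∞) = 0 ^ t⁻¹ := (ENNReal.zero_rpow_of_pos (inv_pos.2 ht)).symm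
    rw [h0]
    exact (ENNReal.continuous_rpow_const.tendsto 0).comp htend
  · refine Eventually.of_forall fun k Q => ?_
    have h1 : powerWeight t Q.1.1 ≤ (2⁻¹ : ℝ≥0∞) ^ k := by
      refine le_trans ?_ (hFc k).le
      refine le_trans (le_of_eq ?_) (ENNReal.le_tsum Q.1)
      simp
    calc Metric.ediam (dyadicInterval Q.1) ≤ (2⁻¹ : ℝ≥0∞) ^ Q.1.1 := ediam_dyadicInterval_le _
      _ = powerWeight t Q.1.1 ^ t⁻¹ := by
        rw [powerWeight, ← ENNReal.rpow_mul, mul_inv_cancel₀ ht.ne', ENNReal.rpow_one]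
      _ ≤ _ := ENNReal.rpow_le_rpow h1 (inv_pos.2 ht).le
  · refine Eventually.of_forall fun k => (hF k).trans ?_
    rw [dyadicUnion, biUnion_eq_iUnion]

lemma tsum_int_eq_tsum_pairs (f : ℤ → ℝ≥0∞) : ∑' i, f i = ∑' i, (f (2 * i) + f (2 * i + 1)) := by
  rw [← (Int.divModEquiv 2).symm.tsum_eq f, ENNReal.tsum_prod']
  refine tsum_congr fun i => ?_
  rw [tsum_fintype, Fin.sum_univ_two]
  simp [Int.divModEquiv, mul_comm]

/-- A mass distribution on the dyadic tree: the mass of an interval is split between its halves in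
proportion to `m`. -/
noncomputable def treeMass (m : ℕ → ℤ → ℝ≥0∞) : ℕ → ℤ → ℝ≥0∞
  | 0, j => m 0 j
  | n + 1, j => treeMass m n (j / 2) *
      (m (n + 1) j / (m (n + 1) (2 * (j / 2)) + m (n + 1) (2 * (j / 2) + 1)))

lemma treeMass_le {m : ℕ → ℤ → ℝ≥0∞}
    (hsub : ∀ n j, m n j ≤ m (n + 1) (2 * j) + m (n + 1) (2 * j + 1)) (n : ℕ) (j : ℤ) :
    treeMass m n j ≤ m n j := by
  induction n generalizing j with
  | zero => exact le_rfl
  | succ n ih =>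
    rw [treeMass]
    set s := m (n + 1) (2 * (j / 2)) + m (n + 1) (2 * (j / 2) + 1) with hs
    calc treeMass m n (j / 2) * (m (n + 1) j / s) ≤ s * (m (n + 1) j / s) := by
          gcongr; exact (ih _).trans (hsub _ _)
      _ ≤ m (n + 1) j := ENNReal.mul_div_le

lemma treeMass_succ_add {m : ℕ → ℤ → ℝ≥0∞} (hfin : ∀ n j, m n j ≠ ⊤)
    (hsub : ∀ n j, m n j ≤ m (n + 1) (2 * j) + m (n + 1) (2 * j + 1)) (n : ℕ) (j : ℤ) :
    treeMass m (n + 1) (2 * j) + treeMass m (n + 1) (2 * j + 1) = treeMass m n j := by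
  have h1 : (2 * j) / 2 = j := by omega
  have h2 : (2 * j + 1) / 2 = j := by omega
  simp only [treeMass]
  rw [h1, h2, ← mul_add, ← ENNReal.add_div]
  -- If both halves have weight 0 the proportions are 0/0, but then the parent has mass 0 as well
  -- and nothing is lost.
  rcases eq_or_ne (m (n + 1) (2 * j) + m (n + 1) (2 * j + 1)) 0 with h | h
  · have : treeMass m n j = 0 :=
      le_antisymm ((treeMass_le hsub n j).trans ((hsub n j).trans h.le)) zero_le
    rw [this, zero_mul]
  · rw [ENNReal.div_self h (ENNReal.add_ne_top.2 ⟨hfin _ _, hfin _ _⟩), mul_one]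

/-- Splitting conserves mass, so the mass of a family of level-`n` intervals can be computed at any
finer level. The predicate `p` covers both the total mass and the mass of one interval. -/
lemma tsum_treeMass_descendants {m : ℕ → ℤ → ℝ≥0∞} (hfin : ∀ n j, m n j ≠ ⊤)
    (hsub : ∀ n j, m n j ≤ m (n + 1) (2 * j) + m (n + 1) (2 * j + 1))
    {n N : ℕ} (h : n ≤ N) (p : ℤ → Prop) [DecidablePred p] :
    ∑' i, (if p (i / 2 ^ (N - n)) then treeMass m N i else 0) =
      ∑' i, (if p i then treeMass m n i else 0) := by
  induction N, h using Nat.le_induction with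
  | base => simp
  | succ N hN ih =>
    rw [← ih, tsum_int_eq_tsum_pairs]
    refine tsum_congr fun i => ?_
    have hpow : (2 : ℤ) ^ (N + 1 - n) = 2 * 2 ^ (N - n) := by
      rw [Nat.sub_add_comm hN, pow_succ, mul_comm]
    have h1 : (2 * i) / 2 ^ (N + 1 - n) = i / 2 ^ (N - n) := by
      rw [hpow, ← Int.ediv_ediv_of_nonneg (by norm_num)]; congr 1; omega
    have h2 : (2 * i + 1) / 2 ^ (N + 1 - n) = i / 2 ^ (N - n) := by
      rw [hpow, ← Int.ediv_ediv_of_nonneg (by norm_num)]; congr 1; omega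
    rw [h1, h2, ← treeMass_succ_add hfin hsub N i]
    split_ifs <;> simp

lemma netContent_le_weight (w : ℕ → ℝ≥0∞) {E : Set ℝ} {Q : ℕ × ℤ} (h : E ⊆ dyadicInterval Q) :
    netContent w E ≤ w Q.1 := by
  refine (netContent_le (F := {Q}) (by simpa [dyadicUnion] using h)).trans (le_of_eq ?_)
  rw [netCost, tsum_eq_single Q (fun Q' h' => by simp [h'])]
  simp

lemma netContent_empty (w : ℕ → ℝ≥0∞) : netContent w ∅ = 0 :=
  le_antisymm ((netContent_le (F := ∅) (empty_subset _)).trans (by simp [netCost])) zero_le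

lemma measurable_dyadicIndex (n : ℕ) : Measurable (dyadicIndex n) :=
  (measurable_id.mul_const _).floor

/-- **Frostman's lemma** for compact sets of positive net content. -/
lemma exists_frostman_of_isCompact {t : ℝ} (ht : 0 ≤ t) {K : Set ℝ} (hK : IsCompact K) {j₀ : ℤ}
    (hKj : K ⊆ dyadicInterval (0, j₀)) (hpos : 0 < netContent (powerWeight t) K) :
    ∃ (ν : Measure ℝ) (C : ℝ≥0∞), C ≠ ⊤ ∧ IsProbabilityMeasure ν ∧ ν Kᶜ = 0 ∧
      ∀ x n, ν (Metric.ball x (2 ^ n)⁻¹) ≤ C * powerWeight t n := by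
  set w := powerWeight t with hw
  set m : ℕ → ℤ → ℝ≥0∞ := fun n j => netContent w (K ∩ dyadicInterval (n, j)) with hm
  have hmw : ∀ n j, m n j ≤ w n := fun n j => netContent_le_weight w (Q := (n, j)) inter_subset_right
  have hfin : ∀ n j, m n j ≠ ⊤ := fun n j =>
    ((hmw n j).trans_lt (powerWeight_ne_top ht n).lt_top).ne
  have hsub : ∀ n j, m n j ≤ m (n + 1) (2 * j) + m (n + 1) (2 * j + 1) := by
    intro n j
    refine (netContent_mono w ?_).trans (netContent_union_le w _ _)
    rintro x ⟨hx, hxj⟩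
    have hxj : dyadicIndex n x = j := hxj
    rw [dyadicIndex_eq_div (Nat.le_add_right n 1)] at hxj
    rw [show n + 1 - n = 1 by omega, pow_one] at hxj
    have : dyadicIndex (n + 1) x = 2 * j ∨ dyadicIndex (n + 1) x = 2 * j + 1 := by omega
    exact this.imp (fun h => ⟨hx, h⟩) fun h => ⟨hx, h⟩
  set c := netContent w K with hc
  have hm0 : ∀ j, m 0 j = if j = j₀ then c else 0 := by
    intro j
    split_ifs with h
    · subst h; simp only [hm, inter_eq_left.2 hKj, hc]
    · have : K ∩ dyadicInterval (0, j) = ∅ := by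
        ext x
        simp only [mem_inter_iff, mem_empty_iff_false, iff_false, not_and]
        intro hx hxj
        exact h ((show dyadicIndex 0 x = j from hxj).symm.trans (hKj hx))
      simp only [hm, this, netContent_empty]
  have hctop : c ≠ ⊤ := by
    have := hfin 0 j₀
    rwa [hm0, if_pos rfl] at this
  obtain ⟨k₀, hk₀⟩ : K.Nonempty := by
    by_contra! h
    rw [hc, h, netContent_empty] at hpos
    exact hpos.ne rfl
  -- An interval with positive tree mass has positive content in `K` and therefore meets `K`; the
  -- point masses can be placed inside `K`.
  have hpt : ∀ n j, ∃ x : K, treeMass m n j ≠ 0 → dyadicIndex n x = j := by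
    intro n j
    rcases (K ∩ dyadicInterval (n, j)).eq_empty_or_nonempty with h | ⟨x, hx, hxj⟩
    · refine ⟨⟨k₀, hk₀⟩, fun hne => absurd ?_ hne⟩
      refine le_antisymm ((treeMass_le hsub n j).trans ?_) zero_le
      simp only [hm, h, netContent_empty, le_refl]
    · exact ⟨⟨x, hx⟩, fun _ => hxj⟩
  choose x hx using hpt
  -- `μ N` agrees with the normalized tree mass on all dyadic intervals of level at most `N`. It has
  -- total mass 1 because `K` lies in one interval of level 0, whose mass is `c`.
  let μ : ℕ → Measure K := fun n => c⁻¹ • Measure.sum fun j => treeMass m n j • Measure.dirac (x n j)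
  have hμ : ∀ {n N} (_ : n ≤ N) (p : ℤ → Prop) [DecidablePred p],
      μ N {y | p (dyadicIndex n y)} = c⁻¹ * ∑' j, if p j then treeMass m n j else 0 := by
    intro n N h p _
    have hmeas : MeasurableSet {y : K | p (dyadicIndex n y)} :=
      ((measurable_dyadicIndex n).comp measurable_subtype_coe) (MeasurableSpace.measurableSet_top (s := {j | p j}))
    rw [← tsum_treeMass_descendants hfin hsub h p, Measure.smul_apply, Measure.sum_apply _ hmeas, smul_eq_mul]
    congr 1
    refine tsum_congr fun j => ?_
    rw [Measure.smul_apply, Measure.dirac_apply' _ hmeas, smul_eq_mul]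
    rcases eq_or_ne (treeMass m N j) 0 with h0 | h0
    · simp [h0]
    · have h1 := dyadicIndex_eq_div h (x N j)
      rw [hx N j h0] at h1
      by_cases hp : p (j / 2 ^ (N - n)) <;> simp [indicator, h1, hp]
  have hprob : ∀ N, IsProbabilityMeasure (μ N) := by
    intro N
    constructor
    have := hμ (Nat.zero_le N) (fun _ => True)
    simp only [if_true, treeMass, hm0, tsum_ite_eq] at this
    rw [ENNReal.inv_mul_cancel hpos.ne' hctop] at this
    rw [← this]
    congr 1
  have hcompact : CompactSpace K := isCompact_iff_compactSpace.1 hK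
  let μ' : ℕ → ProbabilityMeasure K := fun N => ⟨μ N, hprob N⟩
  -- The probability measures on the compact `K` form a compact space, so the sequence has a weak
  -- limit along a free ultrafilter.
  let U : Ultrafilter (ProbabilityMeasure K) := (hyperfilter ℕ).map μ'
  have hlim : Tendsto μ' (hyperfilter ℕ) (𝓝 U.lim) := U.le_nhds_lim
  set ν₀ := U.lim
  refine ⟨(ν₀ : Measure K).map Subtype.val, 3 * c⁻¹, ?_, ?_, ?_, ?_⟩
  · exact ENNReal.mul_ne_top (by simp) (ENNReal.inv_ne_top.2 hpos.ne')
  · exact Measure.isProbabilityMeasure_map measurable_subtype_coe.aemeasurable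
  · rw [Measure.map_apply measurable_subtype_coe hK.measurableSet.compl]
    simp
  · intro z n
    rw [Measure.map_apply measurable_subtype_coe measurableSet_ball]
    have hopen : IsOpen ((Subtype.val : K → ℝ) ⁻¹' Metric.ball z (2 ^ n)⁻¹) :=
      Metric.isOpen_ball.preimage continuous_subtype_val
    refine (ProbabilityMeasure.le_liminf_measure_open_of_tendsto hlim hopen).trans ?_
    have hev : ∀ᶠ N in (hyperfilter ℕ : Filter ℕ),
        (μ' N : Measure K) ((Subtype.val : K → ℝ) ⁻¹' Metric.ball z (2 ^ n)⁻¹) ≤ 3 * c⁻¹ * w n := by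
      have hge : ∀ᶠ N in (hyperfilter ℕ : Filter ℕ), n ≤ N :=
        Nat.hyperfilter_le_atTop (eventually_ge_atTop n)
      filter_upwards [hge] with N hN
      set i := dyadicIndex n z with hi
      -- A ball of radius 2⁻ⁿ meets only the interval of its centre and the two neighbours; hence
      -- the constant 3.
      have hsubset : (Subtype.val : K → ℝ) ⁻¹' Metric.ball z (2 ^ n)⁻¹ ⊆
          {y : K | dyadicIndex n y = i} ∪ ({y : K | dyadicIndex n y = i + 1} ∪
            {y : K | dyadicIndex n y = i - 1}) := by
        intro y hy
        have hy : |(y : ℝ) - z| < (2 ^ n)⁻¹ := hy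
        rw [inv_eq_one_div, lt_div_iff₀ (by positivity),
          ← abs_of_pos (by positivity : (0 : ℝ) < 2 ^ n), ← abs_mul, sub_mul, abs_lt] at hy
        have h1 : dyadicIndex n y < i + 1 + 1 := by
          refine Int.floor_lt.2 ?_
          have := Int.lt_floor_add_one (z * 2 ^ n)
          push_cast
          simp only [hi, dyadicIndex]
          linarith [hy.2]
        have h2 : i - 1 ≤ dyadicIndex n y := by
          refine Int.le_floor.2 ?_
          have := Int.floor_le (z * 2 ^ n)
          push_cast
          simp only [hi, dyadicIndex]
          linarith [hy.1]
        have : dyadicIndex n y = i ∨ dyadicIndex n y = i + 1 ∨ dyadicIndex n y = i - 1 := by omega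
        exact this
      have hone : ∀ j, μ N {y : K | dyadicIndex n y = j} ≤ c⁻¹ * w n := by
        intro j
        have := hμ hN (fun k => k = j)
        rw [this, tsum_ite_eq]
        gcongr
        exact (treeMass_le hsub n j).trans (hmw n j)
      calc μ N _ ≤ μ N _ := measure_mono hsubset
        _ ≤ c⁻¹ * w n + (c⁻¹ * w n + c⁻¹ * w n) :=
          (measure_union_le _ _).trans (add_le_add (hone _)
            ((measure_union_le _ _).trans (add_le_add (hone _) (hone _))))
        _ = 3 * c⁻¹ * w n := by ring
    exact liminf_le_of_le (by isBoundedDefault) fun b hb =>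
      (hb.and hev).exists.elim fun N h => h.1.trans h.2

/-- A finite `t`-energy measure on a compact subset of prescribed small diameter. -/
theorem exists_measure_energy_lt_top {A : Set ℝ} (hA : MeasurableSet A) {t : ℝ} (ht : 0 < t)
    (hdim : ENNReal.ofReal t < dimH A) {r : ℝ} (hr : 0 < r) :
    ∃ (K : Set ℝ) (ν : Measure ℝ), K ⊆ A ∧ IsCompact K ∧ (∀ x ∈ K, ∀ y ∈ K, |x - y| ≤ r) ∧
      IsProbabilityMeasure ν ∧ ν Kᶜ = 0 ∧ ∫⁻ x, ∫⁻ y, edist x y ^ (-t) ∂ν ∂ν < ⊤ := by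
  -- Frostman's lemma is applied with `t'` strictly between `t` and the dimension; the gap makes the
  -- energy series geometric with ratio 2^(−(t'−t)).
  obtain ⟨t', htt', ht'dim⟩ := ENNReal.lt_iff_exists_nnreal_btwn.1 hdim
  have htt' : t < t' := by
    rwa [← ENNReal.ofReal_coe_nnreal, ENNReal.ofReal_lt_ofReal_iff_of_nonneg ht.le] at htt'
  have ht'0 : (0 : ℝ) < t' := ht.trans htt'
  obtain ⟨N, hN⟩ := exists_pow_lt_of_lt_one hr (by norm_num : (2⁻¹ : ℝ) < 1)
  rw [inv_pow] at hN
  -- Cutting `A` into intervals shorter than `r` costs no dimension, by countable stability, and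
  -- enforces the small diameter.
  have hAU : A = ⋃ j : ℤ, A ∩ dyadicInterval (N, j) := by
    rw [← inter_iUnion]
    refine (inter_eq_left.2 fun x _ => mem_iUnion.2 ⟨dyadicIndex N x, rfl⟩).symm
  have hmeasI : ∀ Q, MeasurableSet (dyadicInterval Q) := fun Q =>
    (measurable_dyadicIndex Q.1) (MeasurableSpace.measurableSet_top (s := {Q.2}))
  obtain ⟨j, hj⟩ : ∃ j : ℤ, (t' : ℝ≥0∞) < dimH (A ∩ dyadicInterval (N, j)) := by
    rw [hAU, dimH_iUnion] at ht'dim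
    exact lt_iSup_iff.1 ht'dim
  have hH : Measure.hausdorffMeasure t' (A ∩ dyadicInterval (N, j)) ≠ 0 := by
    rw [hausdorffMeasure_of_lt_dimH hj]; simp
  obtain ⟨K, hKA, hK, hKpos⟩ := exists_isCompact_netContent_pos
    (hA.inter (hmeasI _)).analyticSet (netContent_pos_of_hausdorffMeasure_ne_zero ht'0 hH)
  have hKN : ∀ x ∈ K, dyadicIndex N x = j := fun x hx => (hKA hx).2
  have hK0 : K ⊆ dyadicInterval (0, j / 2 ^ N) := by
    intro x hx
    have := dyadicIndex_eq_div (Nat.zero_le N) x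
    rwa [hKN x hx] at this
  obtain ⟨ν, C, hC, hν, hνK, hball⟩ := exists_frostman_of_isCompact ht'0.le hK hK0 hKpos
  refine ⟨K, ν, hKA.trans inter_subset_left, hK, fun x hx y hy => ?_, hν, hνK, ?_⟩
  · exact ((abs_sub_lt_of_dyadicIndex_eq ((hKN x hx).trans (hKN y hy).symm)).trans hN).le
  have hae : ∀ᵐ x ∂ν, x ∈ K := by rwa [ae_iff]
  set B : ℝ≥0∞ := ∑' n : ℕ, ((2⁻¹ : ℝ≥0∞) ^ (n + 1)) ^ (-t) * (C * powerWeight t' n) with hB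
  -- The Riesz kernel is dominated by one ball indicator per dyadic scale. On the diagonal the left
  -- side is `⊤`, and the series also diverges, since all its terms are at least 1.
  have hker : ∀ x ∈ K, ∀ y ∈ K, edist x y ^ (-t) ≤
      ∑' n : ℕ, (Metric.ball x (2 ^ n)⁻¹).indicator
        (fun _ => ((2⁻¹ : ℝ≥0∞) ^ (n + 1)) ^ (-t)) y := by
    intro x hx y hy
    rcases eq_or_ne x y with rfl | hxy
    · refine le_top.trans (le_of_eq ?_)
      rw [eq_comm, eq_top_iff, ← ENNReal.tsum_const_eq_top_of_ne_zero (α := ℕ) one_ne_zero]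
      refine ENNReal.tsum_le_tsum fun n => ?_
      rw [indicator_of_mem (Metric.mem_ball_self (by positivity)), ENNReal.rpow_neg, ENNReal.one_le_inv]
      exact ENNReal.rpow_le_one (pow_le_one₀ zero_le (by simp)) ht.le
    · have hd : 0 < |x - y| := abs_pos.2 (sub_ne_zero.2 hxy)
      have hex : ∃ k : ℕ, ((2 : ℝ) ^ k)⁻¹ ≤ |x - y| := by
        obtain ⟨k, hk⟩ := exists_pow_lt_of_lt_one hd (by norm_num : (2⁻¹ : ℝ) < 1)
        exact ⟨k, by rw [inv_pow] at hk; exact hk.le⟩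
      obtain ⟨n, hn1, hn2⟩ : ∃ n : ℕ, ((2 : ℝ) ^ (n + 1))⁻¹ ≤ |x - y| ∧ |x - y| < ((2 : ℝ) ^ n)⁻¹ := by
        classical
        have h0 : Nat.find hex ≠ 0 := by
          intro h
          have h1 := Nat.find_spec hex
          rw [h] at h1
          have := abs_sub_lt_of_dyadicIndex_eq ((hK0 hx : dyadicIndex 0 x = _).trans (hK0 hy : dyadicIndex 0 y = _).symm)
          linarith
        obtain ⟨n, hn⟩ := Nat.exists_eq_succ_of_ne_zero h0
        have hs := Nat.find_spec hex
        rw [hn] at hs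
        refine ⟨n, hs, not_le.1 (Nat.find_min hex ?_)⟩
        omega
      refine le_trans ?_ (ENNReal.le_tsum n)
      have hmem : y ∈ Metric.ball x ((2 : ℝ) ^ n)⁻¹ := by
        rw [Metric.mem_ball, dist_comm, Real.dist_eq]; exact hn2
      rw [indicator_of_mem hmem, ENNReal.rpow_neg, ENNReal.rpow_neg, ENNReal.inv_le_inv]
      refine ENNReal.rpow_le_rpow ?_ ht.le
      rw [edist_dist, Real.dist_eq, ← ofReal_two_pow_inv]
      exact ENNReal.ofReal_le_ofReal hn1
  have hpot : ∀ x ∈ K, ∫⁻ y, edist x y ^ (-t) ∂ν ≤ B := by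
    intro x hx
    calc ∫⁻ y, edist x y ^ (-t) ∂ν ≤ ∫⁻ y, ∑' n : ℕ, (Metric.ball x (2 ^ n)⁻¹).indicator
          (fun _ => ((2⁻¹ : ℝ≥0∞) ^ (n + 1)) ^ (-t)) y ∂ν :=
          lintegral_mono_ae (hae.mono fun y hy => hker x hx y hy)
      _ = ∑' n : ℕ, ((2⁻¹ : ℝ≥0∞) ^ (n + 1)) ^ (-t) * ν (Metric.ball x (2 ^ n)⁻¹) := by
          rw [lintegral_tsum fun n => (measurable_const.indicator measurableSet_ball).aemeasurable]
          simp_rw [lintegral_indicator_const measurableSet_ball]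
      _ ≤ B := ENNReal.tsum_le_tsum fun n => by gcongr; exact hball x n
  have hBtop : B < ⊤ := by
    set a : ℝ≥0∞ := (2⁻¹ : ℝ≥0∞) ^ ((t' : ℝ) - t) with ha
    have ha1 : a < 1 := ENNReal.rpow_lt_one (by simp) (sub_pos.2 htt')
    have hterm : ∀ n : ℕ, ((2⁻¹ : ℝ≥0∞) ^ (n + 1)) ^ (-t) * (C * powerWeight t' n) =
        (2⁻¹ : ℝ≥0∞) ^ (-t) * C * a ^ n := by
      intro n
      have h2 : (2⁻¹ : ℝ≥0∞) ≠ 0 := by simp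
      have h2' : (2⁻¹ : ℝ≥0∞) ≠ ⊤ := by simp
      rw [powerWeight, ha, ← ENNReal.rpow_natCast, ← ENNReal.rpow_natCast, ← ENNReal.rpow_natCast,
        ← ENNReal.rpow_mul, ← ENNReal.rpow_mul, ← ENNReal.rpow_mul, mul_left_comm, ← ENNReal.rpow_add _ _ h2 h2',
        mul_comm _ C, mul_assoc, ← ENNReal.rpow_add _ _ h2 h2']
      congr 2
      push_cast
      ring
    rw [hB, tsum_congr hterm, ENNReal.tsum_mul_left, ENNReal.tsum_geometric]
    refine ENNReal.mul_lt_top (ENNReal.mul_lt_top ?_ hC.lt_top) ?_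
    · rw [ENNReal.rpow_neg, ENNReal.inv_lt_top]
      exact ENNReal.rpow_pos (by simp) (by simp)
    · rw [ENNReal.inv_lt_top]
      exact tsub_pos_of_lt ha1
  calc ∫⁻ x, ∫⁻ y, edist x y ^ (-t) ∂ν ∂ν ≤ ∫⁻ _, B ∂ν :=
        lintegral_mono_ae (hae.mono hpot)
    _ = B := by simp
    _ < ⊤ := hBtop

/-! ### Decay of the characteristic function of the uniform distribution on a circle -/

/-- The integral `∫₀^{2π} cos (t cos θ) dθ`, that is, `2π J₀(t)`. -/
noncomputable def circleCos (t : ℝ) : ℝ := ∫ θ in (0 : ℝ)..(2 * Real.pi), Real.cos (t * Real.cos θ)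

/-- Integration by parts against the derivative of sin(t cos θ). The weight 1/(t sin θ) is monotone
on [ε, π/2], so its total variation is controlled by its value at ε, and sin ε ≥ 2ε/π gives the
constant. -/
lemma integral_cos_mul_cos_le {t ε : ℝ} (ht : 0 < t) (hε : 0 < ε) (hε' : ε ≤ Real.pi / 2) :
    |∫ θ in ε..(Real.pi / 2), Real.cos (t * Real.cos θ)| ≤ Real.pi / (t * ε) := by
  have hsin : ∀ θ ∈ uIcc ε (Real.pi / 2), 0 < Real.sin θ := fun θ hθ => by
    rw [uIcc_of_le hε'] at hθ
    exact Real.sin_pos_of_pos_of_lt_pi (hε.trans_le hθ.1) (by linarith [hθ.2, Real.pi_pos])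
  have hcos : ∀ θ ∈ uIcc ε (Real.pi / 2), 0 ≤ Real.cos θ := fun θ hθ => by
    rw [uIcc_of_le hε'] at hθ
    exact Real.cos_nonneg_of_mem_Icc ⟨by linarith [hθ.1, Real.pi_pos], hθ.2⟩
  have hu : ∀ θ ∈ uIcc ε (Real.pi / 2), HasDerivAt (fun θ => -(t * Real.sin θ)⁻¹)
      (t * Real.cos θ / (t * Real.sin θ) ^ 2) θ := fun θ hθ => by
    have := (((Real.hasDerivAt_sin θ).const_mul t).inv (mul_pos ht (hsin θ hθ)).ne').neg
    exact this.congr_deriv (by ring)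
  have hv : ∀ θ ∈ uIcc ε (Real.pi / 2), HasDerivAt (fun θ => Real.sin (t * Real.cos θ))
      (Real.cos (t * Real.cos θ) * (t * -Real.sin θ)) θ := fun θ _ =>
    ((Real.hasDerivAt_cos θ).const_mul t).sin
  have hu' : IntervalIntegrable (fun θ => t * Real.cos θ / (t * Real.sin θ) ^ 2) volume ε
      (Real.pi / 2) := by
    refine ContinuousOn.intervalIntegrable (ContinuousOn.div (by fun_prop) (by fun_prop) ?_)
    exact fun θ hθ => (pow_pos (mul_pos ht (hsin θ hθ)) 2).ne'
  have hv' : IntervalIntegrable (fun θ => Real.cos (t * Real.cos θ) * (t * -Real.sin θ)) volume ε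
      (Real.pi / 2) := Continuous.intervalIntegrable (by fun_prop) _ _
  have key := intervalIntegral.integral_mul_deriv_eq_deriv_mul hu hv hu' hv'
  have hleft : ∫ θ in ε..(Real.pi / 2),
      -(t * Real.sin θ)⁻¹ * (Real.cos (t * Real.cos θ) * (t * -Real.sin θ)) =
      ∫ θ in ε..(Real.pi / 2), Real.cos (t * Real.cos θ) := by
    refine intervalIntegral.integral_congr fun θ hθ => ?_
    have := (hsin θ hθ).ne'
    have := ht.ne'
    field_simp
  have hFTC := intervalIntegral.integral_eq_sub_of_hasDerivAt hu hu'
  have hbd : ‖∫ θ in ε..(Real.pi / 2),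
      t * Real.cos θ / (t * Real.sin θ) ^ 2 * Real.sin (t * Real.cos θ)‖ ≤
      ∫ θ in ε..(Real.pi / 2), t * Real.cos θ / (t * Real.sin θ) ^ 2 := by
    refine intervalIntegral.norm_integral_le_of_norm_le hε' (ae_of_all _ fun θ hθ => ?_) hu'
    have hθ' : θ ∈ uIcc ε (Real.pi / 2) := by rw [uIcc_of_le hε']; exact Ioc_subset_Icc_self hθ
    rw [norm_mul, Real.norm_of_nonneg
      (div_nonneg (mul_nonneg ht.le (hcos θ hθ')) (sq_nonneg _))]
    exact mul_le_of_le_one_right (div_nonneg (mul_nonneg ht.le (hcos θ hθ')) (sq_nonneg _))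
      (Real.abs_sin_le_one _)
  rw [hleft] at key
  rw [hFTC, Real.norm_eq_abs] at hbd
  have hsε : 0 < t * Real.sin ε := mul_pos ht (hsin ε left_mem_uIcc)
  have h1 : |-(t * Real.sin ε)⁻¹ * Real.sin (t * Real.cos ε)| ≤ (t * Real.sin ε)⁻¹ := by
    rw [abs_mul, abs_neg, abs_of_pos (inv_pos.2 hsε)]
    exact mul_le_of_le_one_right (inv_pos.2 hsε).le (Real.abs_sin_le_one _)
  simp only [Real.cos_pi_div_two, Real.sin_pi_div_two, mul_zero, Real.sin_zero, mul_one] at key hbd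
  have h2 : 2 * (t * Real.sin ε)⁻¹ ≤ Real.pi / (t * ε) := by
    have := Real.mul_le_sin hε.le hε'
    rw [mul_inv_le_iff₀ hsε, div_mul_eq_mul_div, le_div_iff₀ (by positivity)]
    have h3 : 2 * ε ≤ Real.pi * Real.sin ε := by
      rw [div_mul_eq_mul_div, div_le_iff₀ Real.pi_pos] at this; linarith
    nlinarith
  have h4 : 0 < t⁻¹ := inv_pos.2 ht
  rw [key, zero_sub]
  refine (abs_sub _ _).trans ?_
  rw [abs_neg]
  linarith

lemma circleCos_eq (t : ℝ) :
    circleCos t = 4 * ∫ θ in (0 : ℝ)..(Real.pi / 2), Real.cos (t * Real.cos θ) := by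
  have hi : ∀ a b, IntervalIntegrable (fun θ => Real.cos (t * Real.cos θ)) volume a b :=
    fun a b => Continuous.intervalIntegrable (by fun_prop) _ _
  have h1 : ∫ θ in Real.pi..(2 * Real.pi), Real.cos (t * Real.cos θ) =
      ∫ θ in (0 : ℝ)..Real.pi, Real.cos (t * Real.cos θ) := by
    have := intervalIntegral.integral_comp_add_right (a := 0) (b := Real.pi)
      (fun θ => Real.cos (t * Real.cos θ)) Real.pi
    rw [zero_add, ← two_mul] at this
    rw [← this]
    simp [Real.cos_add_pi]
  have h2 : ∫ θ in (Real.pi / 2)..Real.pi, Real.cos (t * Real.cos θ) =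
      ∫ θ in (0 : ℝ)..(Real.pi / 2), Real.cos (t * Real.cos θ) := by
    have := intervalIntegral.integral_comp_sub_left (a := 0) (b := Real.pi / 2)
      (fun θ => Real.cos (t * Real.cos θ)) Real.pi
    rw [sub_zero, sub_half] at this
    rw [← this]
    simp [Real.cos_pi_sub]
  rw [circleCos, ← intervalIntegral.integral_add_adjacent_intervals (hi 0 Real.pi) (hi _ _), h1,
    ← intervalIntegral.integral_add_adjacent_intervals (hi 0 (Real.pi / 2)) (hi _ Real.pi), h2]
  ring

/-- The value `J₀(t)`. -/
noncomputable def circleMean (t : ℝ) : ℝ := circleCos t / (2 * Real.pi)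

/-- The phase t cos θ is stationary at 0. Cutting at ε = t^(−1/2) balances the trivial bound ε near
0 against π/(tε) on the rest. -/
lemma abs_circleMean_le_div_sqrt {t : ℝ} (ht : 1 ≤ t) : |circleMean t| ≤ 3 / Real.sqrt t := by
  have hs : 1 ≤ Real.sqrt t := Real.one_le_sqrt.2 ht
  have hs0 : 0 < Real.sqrt t := by linarith
  set ε := (Real.sqrt t)⁻¹ with hεdef
  have hε : 0 < ε := inv_pos.2 hs0
  have hε1 : ε ≤ 1 := inv_le_one_of_one_le₀ hs
  have hε' : ε ≤ Real.pi / 2 := by linarith [Real.pi_gt_three]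
  have hi : ∀ a b, IntervalIntegrable (fun θ => Real.cos (t * Real.cos θ)) volume a b :=
    fun a b => Continuous.intervalIntegrable (by fun_prop) _ _
  have h1 : |∫ θ in (0 : ℝ)..ε, Real.cos (t * Real.cos θ)| ≤ ε := by
    have := intervalIntegral.norm_integral_le_of_norm_le_const (a := 0) (b := ε) (C := 1)
      (f := fun θ => Real.cos (t * Real.cos θ)) fun θ _ => Real.abs_cos_le_one _
    rwa [sub_zero, one_mul, abs_of_pos hε] at this
  have h2 := integral_cos_mul_cos_le (by linarith : 0 < t) hε hε'
  have h3 : Real.pi / (t * ε) = Real.pi * ε := by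
    have htt : t * ε = Real.sqrt t := by
      rw [hεdef, ← div_eq_mul_inv, Real.div_sqrt]
    rw [htt, hεdef, div_eq_mul_inv]
  rw [circleMean, circleCos_eq, ← intervalIntegral.integral_add_adjacent_intervals (hi 0 ε) (hi _ _),
    abs_div, abs_mul, abs_of_pos Real.two_pi_pos, div_le_iff₀ Real.two_pi_pos, abs_of_pos (by norm_num : (0:ℝ) < 4),
    show 3 / Real.sqrt t = 3 * ε by rw [hεdef, div_eq_mul_inv]]
  have h4 := abs_add_le (∫ θ in (0 : ℝ)..ε, Real.cos (t * Real.cos θ))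
    (∫ θ in ε..(Real.pi / 2), Real.cos (t * Real.cos θ))
  rw [h3] at h2
  have h5 : ε * 2 ≤ ε * Real.pi := by gcongr; linarith [Real.pi_gt_three]
  nlinarith

/-- The variance of cos(t cos θ) is nonnegative, and the double angle formula expresses the mean of
its square through the value at 2t. -/
lemma sq_circleMean_le (t : ℝ) : circleMean t ^ 2 ≤ (1 + circleMean (2 * t)) / 2 := by
  set m := circleMean t with hm
  have hmm : circleCos t = m * (2 * Real.pi) := by
    rw [hm, circleMean, div_mul_cancel₀ _ Real.two_pi_pos.ne']
  have h0 : 0 ≤ ∫ θ in (0 : ℝ)..(2 * Real.pi), (Real.cos (t * Real.cos θ) - m) ^ 2 :=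
    intervalIntegral.integral_nonneg Real.two_pi_pos.le fun θ _ => sq_nonneg _
  have h1 : ∀ θ, (Real.cos (t * Real.cos θ) - m) ^ 2 =
      (1 / 2 + m ^ 2) + (1 / 2 * Real.cos (2 * t * Real.cos θ) - 2 * m * Real.cos (t * Real.cos θ)) := by
    intro θ
    rw [mul_assoc 2 t, Real.cos_two_mul]; ring
  simp_rw [h1] at h0
  rw [intervalIntegral.integral_add (by simp) (Continuous.intervalIntegrable (by fun_prop) _ _),
    intervalIntegral.integral_sub (Continuous.intervalIntegrable (by fun_prop) _ _)
      (Continuous.intervalIntegrable (by fun_prop) _ _), intervalIntegral.integral_const,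
    intervalIntegral.integral_const_mul, intervalIntegral.integral_const_mul] at h0
  change 0 ≤ (2 * Real.pi - 0) • (1 / 2 + m ^ 2) + (1 / 2 * circleCos (2 * t) - 2 * m * circleCos t) at h0
  rw [hmm, smul_eq_mul, sub_zero] at h0
  have h2 : circleCos (2 * t) = circleMean (2 * t) * (2 * Real.pi) := by
    rw [circleMean, div_mul_cancel₀ _ Real.two_pi_pos.ne']
  rw [h2] at h0
  have h3 : 0 ≤ (2 * Real.pi) * (1 / 2 + m ^ 2 + 1 / 2 * circleMean (2 * t) - 2 * m * m) := by linarith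
  have := nonneg_of_mul_nonneg_right h3 Real.two_pi_pos
  nlinarith

/-- Halving the argument shrinks the gap 1 − |J₀| at most by the factor 4. Iteration carries a gap
at one large argument down to a quadratic lower bound near 0, without any expansion of J₀. -/
lemma one_sub_abs_circleMean_ge {t : ℝ} : (1 - |circleMean (2 * t)|) / 4 ≤ 1 - |circleMean t| := by
  have h := sq_circleMean_le t
  have h1 := le_abs_self (circleMean (2 * t))
  rw [← sq_abs] at h
  nlinarith [sq_nonneg (1 - |circleMean t|)]

lemma one_sub_abs_circleMean_pow_ge (k : ℕ) (t : ℝ) :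
    (1 - |circleMean (2 ^ k * t)|) / 4 ^ k ≤ 1 - |circleMean t| := by
  induction k generalizing t with
  | zero => simp
  | succ k ih =>
    refine le_trans ?_ (one_sub_abs_circleMean_ge (t := t))
    have := ih (2 * t)
    rw [pow_succ, pow_succ, mul_assoc, ← div_div]
    gcongr

/-- `|J₀(t)| ≤ (1 + t² / 2592) ^ (-1/4)`. -/
lemma circleMean_pow_four_mul_le {t : ℝ} (ht : 0 ≤ t) :
    |circleMean t| ^ 4 * (1 + t ^ 2 / 2592) ≤ 1 := by
  -- For t ≥ 36 the decay 3/√t suffices: its fourth power is 81/t², and 81/2592 = 1/32.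
  rcases le_or_gt 36 t with h | h
  · have h1 := abs_circleMean_le_div_sqrt (by linarith : 1 ≤ t)
    have h2 : |circleMean t| ^ 4 ≤ 81 / t ^ 2 := by
      calc |circleMean t| ^ 4 ≤ (3 / Real.sqrt t) ^ 4 := by gcongr
        _ = 81 / t ^ 2 := by
          rw [div_pow, show (Real.sqrt t) ^ 4 = (Real.sqrt t ^ 2) ^ 2 by ring, Real.sq_sqrt ht]
          norm_num
    calc |circleMean t| ^ 4 * (1 + t ^ 2 / 2592) ≤ 81 / t ^ 2 * (1 + t ^ 2 / 2592) := by gcongr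
      _ = 81 / t ^ 2 + 1 / 32 := by
        have : t ≠ 0 := by linarith
        field_simp; ring
      _ ≤ 81 / 36 ^ 2 + 1 / 32 := by gcongr
      _ ≤ 1 := by norm_num
  · rcases ht.eq_or_lt with rfl | h0
    · have hz : circleMean 0 = 1 := by
        simp [circleMean, circleCos, Real.pi_ne_zero]
      simp [hz]
    -- Double t until 2^(k+1) t lies in (36, 72]. There |J₀| ≤ 1/2, and the gap 1/2, carried back,
    -- gives 1 − |J₀(t)| ≥ t²/(2 · 72²) = t²/10368.
    obtain ⟨k, hk1, hk2⟩ := exists_nat_pow_near (x := 36 / t) (y := 2)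
      (by rw [le_div_iff₀ h0]; linarith) (by norm_num)
    rw [le_div_iff₀ h0] at hk1
    rw [div_lt_iff₀ h0] at hk2
    have h1 := abs_circleMean_le_div_sqrt (t := 2 ^ (k + 1) * t) (by linarith)
    have h6 : (6 : ℝ) ≤ Real.sqrt (2 ^ (k + 1) * t) := by
      rw [Real.le_sqrt' (by norm_num)]; linarith
    have h2 : |circleMean (2 ^ (k + 1) * t)| ≤ 1 / 2 := by
      refine h1.trans ?_
      rw [div_le_iff₀ (by linarith)]; linarith
    have h3 := one_sub_abs_circleMean_pow_ge (k + 1) t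
    have h4 : t ^ 2 / 10368 ≤ (1 - |circleMean (2 ^ (k + 1) * t)|) / 4 ^ (k + 1) := by
      have h5 : (4 : ℝ) ^ (k + 1) * t ^ 2 ≤ 72 ^ 2 := by
        calc (4 : ℝ) ^ (k + 1) * t ^ 2 = (2 * (2 ^ k * t)) ^ 2 := by
              rw [show (4 : ℝ) = 2 ^ 2 by norm_num, ← pow_mul]; ring
          _ ≤ (2 * 36) ^ 2 := by gcongr
          _ = 72 ^ 2 := by norm_num
      rw [le_div_iff₀ (by positivity)]
      linarith
    set x := t ^ 2 / 10368 with hx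
    have hx0 : 0 ≤ x := by positivity
    have hj : |circleMean t| ≤ 1 - x := by linarith
    have hj0 := abs_nonneg (circleMean t)
    have hxe : 1 + t ^ 2 / 2592 = 1 + 4 * x := by rw [hx]; ring
    rw [hxe]
    have h7 : |circleMean t| * (1 + x) ≤ 1 := by nlinarith
    calc |circleMean t| ^ 4 * (1 + 4 * x) ≤ |circleMean t| ^ 4 * (1 + x) ^ 4 := by
          gcongr
          nlinarith [sq_nonneg x, pow_nonneg hx0 3, pow_nonneg hx0 4]
      _ = (|circleMean t| * (1 + x)) ^ 4 := by ring
      _ ≤ 1 := pow_le_one₀ (by positivity) h7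

/-- The phase shift disappears by periodicity, and the sine part cancels under θ ↦ θ + π. -/
lemma integral_cexp_mul_cos (t α : ℝ) :
    ∫ θ in (0 : ℝ)..1, Complex.exp ((t * Real.cos (2 * Real.pi * θ - α) : ℝ) * Complex.I) =
      circleMean t := by
  set f : ℝ → ℂ := fun θ => Complex.exp ((t * Real.cos θ : ℝ) * Complex.I) with hf
  have hper : Function.Periodic f (2 * Real.pi) := fun θ => by
    simp only [hf, Real.cos_add_two_pi]
  have hfc : Continuous f := by fun_prop
  have h1 := intervalIntegral.integral_comp_mul_sub (a := 0) (b := 1) f Real.two_pi_pos.ne' α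
  have h2 : ∫ θ in (0 : ℝ)..1, f (2 * Real.pi * θ - α) =
      ((2 * Real.pi)⁻¹ : ℝ) • ∫ θ in (0 : ℝ)..(2 * Real.pi), f θ := by
    rw [h1]
    congr 1
    have := hper.intervalIntegral_add_eq (-α) 0
    rw [zero_add] at this
    rw [← this]
    congr 1 <;> ring
  have h3 : ∫ θ in (0 : ℝ)..(2 * Real.pi), f θ = (circleCos t : ℂ) := by
    have hsin : ∫ θ in (0 : ℝ)..(2 * Real.pi), Real.sin (t * Real.cos θ) = 0 := by
      have hi : ∀ a b, IntervalIntegrable (fun θ => Real.sin (t * Real.cos θ)) volume a b :=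
        fun a b => Continuous.intervalIntegrable (by fun_prop) _ _
      have := intervalIntegral.integral_comp_add_right (a := 0) (b := Real.pi)
        (fun θ => Real.sin (t * Real.cos θ)) Real.pi
      rw [zero_add, ← two_mul] at this
      rw [← intervalIntegral.integral_add_adjacent_intervals (hi 0 Real.pi) (hi _ _), ← this]
      simp [Real.cos_add_pi]
    have hfe : ∀ θ, f θ = (Real.cos (t * Real.cos θ) : ℝ) + (Real.sin (t * Real.cos θ) : ℝ) * Complex.I := by
      intro θ
      simp only [hf]
      rw [Complex.exp_mul_I, Complex.ofReal_cos, Complex.ofReal_sin]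
    simp_rw [hfe]
    rw [intervalIntegral.integral_add (Continuous.intervalIntegrable (by fun_prop) _ _)
      (Continuous.intervalIntegrable (by fun_prop) _ _), intervalIntegral.integral_mul_const,
      intervalIntegral.integral_ofReal, intervalIntegral.integral_ofReal, hsin, circleCos]
    simp
  change ∫ θ in (0 : ℝ)..1, f (2 * Real.pi * θ - α) = _
  rw [h2, h3, circleMean]
  simp [div_eq_inv_mul]

/-- Characteristic function of a random point `b * exp (2 π i θ)` of a circle. -/
lemma norm_integral_circle_pow_four_mul_le (b ξ : ℂ) :
    ‖∫ θ in (0 : ℝ)..1, Complex.exp ((inner ℝ (b * Complex.exp (2 * Real.pi * Complex.I * θ)) ξ : ℝ)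
      * Complex.I)‖ ^ 4 * (1 + (‖ξ‖ * ‖b‖) ^ 2 / 2592) ≤ 1 := by
  set z := (starRingEnd ℂ) b * ξ with hz
  have hin : ∀ θ : ℝ, inner ℝ (b * Complex.exp (2 * Real.pi * Complex.I * θ)) ξ =
      ‖z‖ * Real.cos (2 * Real.pi * θ - Complex.arg z) := by
    intro θ
    have h1 : (2 * Real.pi * Complex.I * θ : ℂ) = ((2 * Real.pi * θ : ℝ) : ℂ) * Complex.I := by
      push_cast; ring
    rw [Complex.inner, map_mul, ← Complex.exp_conj, h1, map_mul, Complex.conj_I, Complex.conj_ofReal,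
      show ξ * ((starRingEnd ℂ) b * Complex.exp (((2 * Real.pi * θ : ℝ) : ℂ) * -Complex.I)) =
        z * Complex.exp (((2 * Real.pi * θ : ℝ) : ℂ) * -Complex.I) by rw [hz]; ring]
    conv_lhs => rw [← Complex.norm_mul_exp_arg_mul_I z]
    rw [mul_assoc, ← Complex.exp_add, mul_neg, ← sub_eq_add_neg, ← sub_mul, ← Complex.ofReal_sub,
      Complex.re_ofReal_mul, Complex.exp_ofReal_mul_I_re, ← Real.cos_neg, neg_sub]
  have hnz : ‖ξ‖ * ‖b‖ = ‖z‖ := by rw [hz, norm_mul, Complex.norm_conj, mul_comm]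
  simp_rw [hin]
  rw [integral_cexp_mul_cos, Complex.norm_real, Real.norm_eq_abs, hnz]
  exact circleMean_pow_four_mul_le (norm_nonneg z)

/-! ### Characteristic functions of increments of the series -/

/-- The point `exp (2πiθ)` of the unit circle. -/
noncomputable def circlePoint (θ : ℝ) : ℂ := Complex.exp (2 * Real.pi * Complex.I * θ)

lemma continuous_circlePoint : Continuous circlePoint := by unfold circlePoint; fun_prop

lemma norm_circlePoint (θ : ℝ) : ‖circlePoint θ‖ = 1 := by
  rw [circlePoint, show (2 * Real.pi * Complex.I * θ : ℂ) = ((2 * Real.pi * θ : ℝ) : ℂ) * Complex.I by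
    push_cast; ring]
  exact Complex.norm_exp_ofReal_mul_I _

lemma one_add_sum_le_prod {ι : Type*} (s : Finset ι) {x : ι → ℝ} (hx : ∀ i, 0 ≤ x i) :
    1 + ∑ i ∈ s, x i ≤ ∏ i ∈ s, (1 + x i) := by
  classical
  induction s using Finset.induction_on with
  | empty => simp
  | insert i s hi ih =>
    rw [Finset.sum_insert hi, Finset.prod_insert hi]
    have := Finset.sum_nonneg fun j (_ : j ∈ s) => hx j
    nlinarith [hx i]

lemma integral_comp_of_isUniform {Ω : Type*} [MeasurableSpace Ω] {P : Measure Ω} {X : Ω → ℝ} (hX : Measurable X)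
    (hu : pdf.IsUniform X (Icc 0 1) P volume) {f : ℝ → ℂ} (hf : Continuous f) :
    ∫ ω, f (X ω) ∂P = ∫ u in (0 : ℝ)..1, f u := by
  rw [← integral_map hX.aemeasurable hf.aestronglyMeasurable, hu, ProbabilityTheory.cond,
    intervalIntegral.integral_of_le zero_le_one, integral_Icc_eq_integral_Ioc.symm]
  simp

section Probability

variable {Ω : Type*} [MeasurableSpace Ω] {P : Measure Ω} [IsProbabilityMeasure P] {θ : ℕ → Ω → ℝ}

/-- Independence factors the characteristic function of a partial sum, and each circle factor
together with its own bracket is at most 1. Enlarging `B` to an initial segment only increases the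
product of brackets; dominated convergence passes to the full series. -/
lemma norm_integral_tsum_pow_four_mul_le (hm : ∀ n, Measurable (θ n)) (hi : iIndepFun θ P)
    (hu : ∀ n, pdf.IsUniform (θ n) (Icc 0 1) P volume) {b : ℕ → ℂ} (hb : Summable fun n => ‖b n‖)
    (ξ : ℂ) (B : Finset ℕ) :
    ‖∫ ω, Complex.exp ((inner ℝ (∑' n, b n * circlePoint (θ n ω)) ξ : ℝ) * Complex.I) ∂P‖ ^ 4 *
      ∏ n ∈ B, (1 + (‖ξ‖ * ‖b n‖) ^ 2 / 2592) ≤ 1 := by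
  have hTm : ∀ n, Measurable fun ω => b n * circlePoint (θ n ω) := fun n =>
    (continuous_circlePoint.measurable.comp (hm n)).const_mul _
  have hTi : iIndepFun (fun n ω => b n * circlePoint (θ n ω)) P :=
    hi.comp (fun n u => b n * circlePoint u) fun n => (continuous_circlePoint.measurable).const_mul _
  set I : ℕ → ℂ := fun N => ∫ ω, Complex.exp
    ((inner ℝ (∑ n ∈ Finset.range N, b n * circlePoint (θ n ω)) ξ : ℝ) * Complex.I) ∂P with hI
  have hIprod : ∀ N, I N = ∏ n ∈ Finset.range N, ∫ u in (0 : ℝ)..1,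
      Complex.exp ((inner ℝ (b n * circlePoint u) ξ : ℝ) * Complex.I) := by
    intro N
    have h1 := congrFun (iIndepFun.charFun_map_fun_finsetSum_eq_prod (s := Finset.range N)
      (fun n _ => (hTm n).aemeasurable) (hTi.restrict _)) ξ
    rw [charFun_apply, integral_map (Finset.measurable_sum _ fun n _ => hTm n).aemeasurable
      (Continuous.aestronglyMeasurable (by fun_prop)), Finset.prod_apply] at h1
    rw [hI]
    refine h1.trans (Finset.prod_congr rfl fun n _ => ?_)
    rw [charFun_apply, integral_map (hTm n).aemeasurable
      (Continuous.aestronglyMeasurable (by fun_prop))]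
    exact integral_comp_of_isUniform (hm n) (hu n)
      (f := fun u => Complex.exp ((inner ℝ (b n * circlePoint u) ξ : ℝ) * Complex.I))
      (by have := continuous_circlePoint; fun_prop)
  have hlim : Tendsto I atTop (𝓝 (∫ ω, Complex.exp
      ((inner ℝ (∑' n, b n * circlePoint (θ n ω)) ξ : ℝ) * Complex.I) ∂P)) := by
    refine tendsto_integral_of_dominated_convergence (fun _ => 1) (fun N => ?_) (integrable_const _)
      (fun N => ae_of_all _ fun ω => (Complex.norm_exp_ofReal_mul_I _).le) (ae_of_all _ fun ω => ?_)
    · refine Measurable.aestronglyMeasurable ?_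
      have := Finset.measurable_sum (Finset.range N) fun n _ => hTm n
      fun_prop
    · have hs : Summable fun n => b n * circlePoint (θ n ω) :=
        Summable.of_norm (by simpa [norm_circlePoint] using hb)
      have hc : Continuous fun z : ℂ => Complex.exp ((inner ℝ z ξ : ℝ) * Complex.I) := by fun_prop
      exact (hc.tendsto _).comp hs.hasSum.tendsto_sum_nat
  have hx : ∀ n, (0 : ℝ) ≤ (‖ξ‖ * ‖b n‖) ^ 2 / 2592 := fun n => by positivity
  have hle : ∀ᶠ N in atTop, ‖I N‖ ^ 4 * ∏ n ∈ B, (1 + (‖ξ‖ * ‖b n‖) ^ 2 / 2592) ≤ 1 := by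
    obtain ⟨N₀, hN₀⟩ := B.exists_nat_subset_range
    filter_upwards [eventually_ge_atTop N₀] with N hN
    have hsub : B ⊆ Finset.range N := hN₀.trans (Finset.range_mono hN)
    calc ‖I N‖ ^ 4 * ∏ n ∈ B, (1 + (‖ξ‖ * ‖b n‖) ^ 2 / 2592)
        ≤ ‖I N‖ ^ 4 * ∏ n ∈ Finset.range N, (1 + (‖ξ‖ * ‖b n‖) ^ 2 / 2592) := by
          gcongr
          exact fun n _ _ => by linarith [hx n]
      _ = ∏ n ∈ Finset.range N, (‖∫ u in (0 : ℝ)..1,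
          Complex.exp ((inner ℝ (b n * circlePoint u) ξ : ℝ) * Complex.I)‖ ^ 4 *
            (1 + (‖ξ‖ * ‖b n‖) ^ 2 / 2592)) := by
          rw [hIprod, norm_prod, ← Finset.prod_pow, Finset.prod_mul_distrib]
      _ ≤ 1 := Finset.prod_le_one (fun n _ => mul_nonneg (by positivity) (by linarith [hx n]))
          fun n _ => norm_integral_circle_pow_four_mul_le (b n) ξ
  exact le_of_tendsto ((hlim.norm.pow 4).mul_const _) hle

end Probability

/-! ### Blocks of the series at the scale of an increment -/

section Blocks

variable {a : ℕ → ℂ} {lam : ℕ → ℝ} {q τ' : ℝ}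

/-- Below the exponent `τ' > τ`, all late blocks are large. -/
lemma eventually_exists_block_ge (hq : 1 < q) (hτ : tau a lam q < τ') :
    ∀ᶠ k : ℕ in atTop, ∃ F : Finset ℕ, (∀ n ∈ F, q ^ k ≤ lam n ∧ lam n < q ^ (k + 1)) ∧
      (q ^ k) ^ (-(2 * τ')) ≤ ∑ n ∈ F, ‖a n‖ ^ 2 := by
  have hq0 : 0 < q := by linarith
  filter_upwards [eventually_lt_of_limsup_lt hτ, eventually_ge_atTop 1] with k hk hk1
  have hlog : 0 < k * Real.log q := mul_pos (by exact_mod_cast hk1) (Real.log_pos hq)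
  rw [blockExponent, EReal.div_lt_iff (by exact_mod_cast hlog) (EReal.coe_ne_top _),
    ← EReal.coe_mul, EReal.neg_lt_comm, ← EReal.coe_neg, ENNReal.log_ofReal] at hk
  split_ifs at hk with h0
  · exact absurd hk (not_lt.2 bot_le)
  rw [EReal.coe_lt_coe_iff, Real.lt_log_iff_exp_lt (not_le.1 h0), blockSize] at hk
  set t : ℝ := ∑' n : {n : ℕ // q ^ k ≤ lam n ∧ lam n < q ^ (k + 1)}, ‖a n‖ ^ 2 with ht
  have ht' : (q ^ k) ^ (-(2 * τ')) < t := by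
    have h1 := (Real.lt_sqrt (Real.exp_pos _).le).1 hk
    refine lt_of_eq_of_lt ?_ h1
    rw [Real.rpow_def_of_pos (pow_pos hq0 k), Real.log_pow, ← Real.exp_nat_mul]
    congr 1
    push_cast; ring
  -- A non-summable block would have `tsum` equal to 0, against the strict lower bound `ht'`.
  have hsum : Summable fun n : {n : ℕ // q ^ k ≤ lam n ∧ lam n < q ^ (k + 1)} => ‖a n‖ ^ 2 := by
    by_contra h
    rw [ht, tsum_eq_zero_of_not_summable h] at ht'
    exact absurd (Real.rpow_nonneg (pow_pos hq0 k).le _) (not_le.2 ht')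
  obtain ⟨s, hs⟩ := (hsum.hasSum.eventually (lt_mem_nhds ht')).exists
  refine ⟨s.map (Function.Embedding.subtype _), fun n hn => ?_, ?_⟩
  · obtain ⟨m, -, rfl⟩ := Finset.mem_map.1 hn
    exact m.2
  · rw [Finset.sum_map]
    exact hs.le

/-- A product over `m` blocks below the scale `|x - y|`. -/
lemma exists_finset_prod_ge {φ : ℕ → ℝ → ℂ} (hφ : BoundedLocallyBiLipschitz φ) (hq : 1 < q)
    (hτ' : 0 < τ') (hτ : tau a lam q < τ') (m : ℕ) :
    ∃ c r : ℝ, 0 < c ∧ 0 < r ∧ ∀ x y : ℝ, x ≠ y → |x - y| ≤ r → ∀ u : ℝ, ∃ B : Finset ℕ,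
      (c * (u * |x - y| ^ τ') ^ 2) ^ m ≤
        ∏ n ∈ B, (1 + (u * ‖a n * (φ n (lam n * x) - φ n (lam n * y))‖) ^ 2 / 2592) := by
  have hq0 : 0 < q := by linarith
  obtain ⟨-, L, δ, hL, hδ, hbi⟩ := hφ
  obtain ⟨k₀, hk₀⟩ := eventually_atTop.1 (eventually_exists_block_ge hq hτ)
  choose! F hFblock hFsum using hk₀
  have hL0 : 0 < L := by linarith
  obtain ⟨c₁, hc₁⟩ : ∃ c₁ : ℝ, c₁ = L⁻¹ * (δ / q ^ (m + 1)) := ⟨_, rfl⟩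
  have hc₁0 : 0 < c₁ := by rw [hc₁]; positivity
  refine ⟨c₁ ^ 2 * δ ^ (-(2 * τ')) / 2592, δ / q ^ (k₀ + m + 1), by positivity, by positivity,
    fun x y hxy hr u => ?_⟩
  set d := |x - y| with hd
  have hd0 : 0 < d := abs_pos.2 (sub_ne_zero.2 hxy)
  have hr' : q ^ (k₀ + m + 1) ≤ δ / d := by
    rw [le_div_iff₀ (by positivity)] at hr ⊢
    linarith
  -- The largest K with q^K d ≤ δ. In the blocks K − 1, …, K − m the distances λ_n d are at most δ,
  -- so the bi-Lipschitz bound applies, and at least δ/q^(m+1), so the differences of φ_n are at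
  -- least `c₁`.
  obtain ⟨K, hK1, hK2⟩ := exists_nat_pow_near (x := δ / d)
    ((one_le_pow₀ hq.le).trans hr') hq
  have hKk : k₀ + m + 1 ≤ K := by
    have := (pow_lt_pow_iff_right₀ hq).1 (hr'.trans_lt hK2)
    omega
  have hblock : ∀ i ∈ Finset.range m, ∀ n ∈ F (K - 1 - i),
      c₁ ≤ ‖φ n (lam n * x) - φ n (lam n * y)‖ := by
    intro i hi n hn
    have him := Finset.mem_range.1 hi
    obtain ⟨h1, h2⟩ := hFblock (K - 1 - i) (by omega) n hn
    have hln : 0 < lam n := (pow_pos hq0 _).trans_le h1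
    have habs : |lam n * x - lam n * y| = lam n * d := by
      rw [← mul_sub, abs_mul, abs_of_pos hln]
    have hle : |lam n * x - lam n * y| ≤ δ := by
      rw [habs]
      have h3 : lam n ≤ q ^ K := h2.le.trans (pow_le_pow_right₀ hq.le (by omega))
      rw [le_div_iff₀ hd0] at hK1
      exact (mul_le_mul_of_nonneg_right h3 hd0.le).trans hK1
    refine le_trans ?_ (hbi n _ _ hle).1
    rw [habs, hc₁]
    gcongr
    rw [div_lt_iff₀ hd0] at hK2
    rw [div_le_iff₀ (by positivity)]
    calc δ ≤ q ^ (K + 1) * d := hK2.le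
      _ ≤ (q ^ (K - 1 - i) * q ^ (m + 1)) * d := by
        rw [← pow_add]
        exact mul_le_mul_of_nonneg_right (pow_le_pow_right₀ hq.le (by omega)) hd0.le
      _ ≤ (lam n * q ^ (m + 1)) * d := by gcongr
      _ = lam n * d * q ^ (m + 1) := by ring
  have hdisj : ((Finset.range m : Finset ℕ) : Set ℕ).PairwiseDisjoint fun i => F (K - 1 - i) := by
    intro i hi j hj hij
    have hi := Finset.mem_range.1 hi
    have hj := Finset.mem_range.1 hj
    refine Finset.disjoint_left.2 fun n hn hn' => hij ?_
    obtain ⟨h1, h2⟩ := hFblock _ (by omega) n hn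
    obtain ⟨h3, h4⟩ := hFblock _ (by omega) n hn'
    have h5 := (pow_lt_pow_iff_right₀ hq).1 (h1.trans_lt h4)
    have h6 := (pow_lt_pow_iff_right₀ hq).1 (h3.trans_lt h2)
    omega
  refine ⟨(Finset.range m).biUnion fun i => F (K - 1 - i), ?_⟩
  rw [Finset.prod_biUnion hdisj]
  refine (le_of_eq (by simp)).trans (Finset.prod_le_prod
    (f := fun _ : ℕ => c₁ ^ 2 * δ ^ (-(2 * τ')) / 2592 * (u * d ^ τ') ^ 2)
    (fun _ _ => by positivity) fun i hi => ?_)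
  refine le_trans ?_ (one_add_sum_le_prod _ fun n => by positivity)
  have him := Finset.mem_range.1 hi
  have hsum : δ ^ (-(2 * τ')) * (d ^ τ') ^ 2 ≤ ∑ n ∈ F (K - 1 - i), ‖a n‖ ^ 2 := by
    refine le_trans ?_ (hFsum (K - 1 - i) (by omega))
    have h1 : (δ / d) ^ (-(2 * τ')) ≤ (q ^ (K - 1 - i)) ^ (-(2 * τ')) :=
      Real.rpow_le_rpow_of_nonpos (by positivity)
        ((pow_le_pow_right₀ hq.le (by omega)).trans hK1) (by linarith)
    refine le_trans (le_of_eq ?_) h1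
    rw [Real.div_rpow hδ.le hd0.le, Real.rpow_neg hd0.le, div_inv_eq_mul, ← Real.rpow_natCast,
      ← Real.rpow_mul hd0.le]
    congr 2
    push_cast; ring
  calc c₁ ^ 2 * δ ^ (-(2 * τ')) / 2592 * (u * d ^ τ') ^ 2
      = u ^ 2 * c₁ ^ 2 / 2592 * (δ ^ (-(2 * τ')) * (d ^ τ') ^ 2) := by ring
    _ ≤ u ^ 2 * c₁ ^ 2 / 2592 * ∑ n ∈ F (K - 1 - i), ‖a n‖ ^ 2 := by gcongr
    _ ≤ ∑ n ∈ F (K - 1 - i), (u * ‖a n * (φ n (lam n * x) - φ n (lam n * y))‖) ^ 2 / 2592 := by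
      rw [Finset.mul_sum]
      refine Finset.sum_le_sum fun n hn => ?_
      have := hblock i hi n hn
      rw [norm_mul]
      calc u ^ 2 * c₁ ^ 2 / 2592 * ‖a n‖ ^ 2 = u ^ 2 * (‖a n‖ ^ 2 * c₁ ^ 2) / 2592 := by ring
        _ ≤ u ^ 2 * (‖a n‖ ^ 2 * ‖φ n (lam n * x) - φ n (lam n * y)‖ ^ 2) / 2592 := by gcongr
        _ = _ := by ring
    _ ≤ _ := by linarith

end Blocks

section Increments

variable {Ω : Type*} [MeasurableSpace Ω] {P : Measure Ω} [IsProbabilityMeasure P] {θ : ℕ → Ω → ℝ}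
  {φ : ℕ → ℝ → ℂ} {a : ℕ → ℂ} {lam : ℕ → ℝ} {q τ' : ℝ}

lemma BoundedLocallyBiLipschitz.continuous (hφ : BoundedLocallyBiLipschitz φ) (n : ℕ) :
    Continuous (φ n) := by
  obtain ⟨-, L, δ, hL, hδ, hbi⟩ := hφ
  refine Metric.continuous_iff.2 fun x ε hε => ?_
  refine ⟨min δ (ε / L), lt_min hδ (by positivity), fun y hy => ?_⟩
  rw [Real.dist_eq] at hy
  rw [dist_eq_norm]
  calc ‖φ n y - φ n x‖ ≤ L * |y - x| := (hbi n y x (hy.le.trans (min_le_left _ _))).2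
    _ < L * (ε / L) := by gcongr; exact hy.trans_le (min_le_right _ _)
    _ = ε := by field_simp

lemma summable_norm_series (hφ : BoundedLocallyBiLipschitz φ) (ha : Summable fun n => ‖a n‖)
    (ϑ : ℕ → ℝ) (x : ℝ) : Summable fun n => ‖a n * circlePoint (ϑ n) * φ n (lam n * x)‖ := by
  obtain ⟨⟨M, hM⟩, -⟩ := hφ
  refine Summable.of_nonneg_of_le (fun _ => norm_nonneg _) (fun n => ?_) (ha.mul_right M)
  rw [norm_mul, norm_mul, norm_circlePoint, mul_one]
  gcongr
  exact hM _ _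

lemma summable_norm_increment (hφ : BoundedLocallyBiLipschitz φ) (ha : Summable fun n => ‖a n‖)
    (x y : ℝ) : Summable fun n => ‖a n * (φ n (lam n * x) - φ n (lam n * y))‖ := by
  obtain ⟨⟨M, hM⟩, -⟩ := hφ
  refine Summable.of_nonneg_of_le (fun _ => norm_nonneg _) (fun n => ?_) (ha.mul_right (M + M))
  rw [norm_mul]
  gcongr
  exact (norm_sub_le _ _).trans (add_le_add (hM _ _) (hM _ _))

lemma series_sub_series (hφ : BoundedLocallyBiLipschitz φ) (ha : Summable fun n => ‖a n‖)
    (ϑ : ℕ → ℝ) (x y : ℝ) : series a φ lam ϑ x - series a φ lam ϑ y =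
      ∑' n, a n * (φ n (lam n * x) - φ n (lam n * y)) * circlePoint (ϑ n) := by
  have h := (summable_norm_series (lam := lam) hφ ha ϑ x).of_norm.tsum_sub
    (summable_norm_series (lam := lam) hφ ha ϑ y).of_norm
  simp only [series]
  refine h.symm.trans (tsum_congr fun n => ?_)
  ring

lemma continuous_series (hφ : BoundedLocallyBiLipschitz φ) (ha : Summable fun n => ‖a n‖)
    (ϑ : ℕ → ℝ) : Continuous (series a φ lam ϑ) := by
  obtain ⟨M, hM⟩ := hφ.1
  refine continuous_tsum (u := fun n => ‖a n‖ * M) (fun n => ?_) (ha.mul_right M) fun n x => ?_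
  · exact continuous_const.mul ((hφ.continuous n).comp (continuous_const.mul continuous_id))
  · change ‖a n * circlePoint (ϑ n) * φ n (lam n * x)‖ ≤ _
    rw [norm_mul, norm_mul, norm_circlePoint, mul_one]
    gcongr
    exact hM _ _

lemma measurable_series {Ω : Type*} [MeasurableSpace Ω] {θ : ℕ → Ω → ℝ} {φ : ℕ → ℝ → ℂ}
    {a : ℕ → ℂ} {lam : ℕ → ℝ} (hφ : BoundedLocallyBiLipschitz φ) (ha : Summable fun n => ‖a n‖)
    (hm : ∀ n, Measurable (θ n)) :
    Measurable fun p : ℝ × Ω => series a φ lam (fun n => θ n p.2) p.1 := by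
  refine measurable_of_tendsto_metrizable (f := fun N (p : ℝ × Ω) => ∑ n ∈ Finset.range N,
    a n * circlePoint (θ n p.2) * φ n (lam n * p.1)) (fun N => ?_) ?_
  · refine Finset.measurable_sum _ fun n _ => ?_
    exact ((continuous_circlePoint.measurable.comp ((hm n).comp measurable_snd)).const_mul _).mul
      ((hφ.continuous n).measurable.comp (measurable_fst.const_mul _))
  · rw [tendsto_pi_nhds]
    intro p
    exact (summable_norm_series hφ ha (fun n => θ n p.2) p.1).of_norm.hasSum.tendsto_sum_nat

/-- Decay of the characteristic function of an increment. -/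
theorem exists_norm_integral_increment_le (hm : ∀ n, Measurable (θ n)) (hi : iIndepFun θ P)
    (hu : ∀ n, pdf.IsUniform (θ n) (Icc 0 1) P volume) (hφ : BoundedLocallyBiLipschitz φ)
    (ha : Summable fun n => ‖a n‖) (hq : 1 < q) (hτ' : 0 < τ') (hτ : tau a lam q < τ') :
    ∃ C r : ℝ, 0 < C ∧ 0 < r ∧ ∀ x y : ℝ, |x - y| ≤ r → ∀ ξ : ℂ,
      ‖∫ ω, Complex.exp ((inner ℝ (series a φ lam (fun n => θ n ω) x -
        series a φ lam (fun n => θ n ω) y) ξ : ℝ) * Complex.I) ∂P‖ *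
        (1 + ‖ξ‖ * |x - y| ^ τ') ^ 6 ≤ C := by
  -- Each block contributes v² to a bound on the fourth power of `J`, so 12 blocks give v²⁴, that is
  -- v⁶ for `J` itself. The exponent 6 leaves room beyond the 4 needed later for interior points.
  obtain ⟨c, r, hc, hr, hB⟩ := exists_finset_prod_ge hφ hq hτ' hτ 12
  refine ⟨32 * (1 + (c ^ 3)⁻¹), r, by positivity, hr, fun x y hxy ξ => ?_⟩
  set J := ‖∫ ω, Complex.exp ((inner ℝ (series a φ lam (fun n => θ n ω) x -
        series a φ lam (fun n => θ n ω) y) ξ : ℝ) * Complex.I) ∂P‖ with hJ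
  have hJ1 : J ≤ 1 := by
    refine (norm_integral_le_of_norm_le_const (C := 1) (ae_of_all _ fun ω =>
      (Complex.norm_exp_ofReal_mul_I _).le)).trans ?_
    simp
  have hJ0 : 0 ≤ J := norm_nonneg _
  set v := ‖ξ‖ * |x - y| ^ τ' with hv
  have hv0 : 0 ≤ v := by positivity
  have hJv : J * v ^ 6 ≤ (c ^ 3)⁻¹ := by
    rcases eq_or_ne x y with rfl | hne
    · have : v = 0 := by rw [hv, sub_self, abs_zero, Real.zero_rpow hτ'.ne', mul_zero]
      rw [this]; simp; positivity
    obtain ⟨B, hBle⟩ := hB x y hne hxy ‖ξ‖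
    have h1 := norm_integral_tsum_pow_four_mul_le hm hi hu (summable_norm_increment (lam := lam) hφ ha x y) ξ B
    simp_rw [← series_sub_series hφ ha (fun n => θ n _)] at h1
    rw [← hJ] at h1
    have h2 : J ^ 4 * (c * v ^ 2) ^ 12 ≤ 1 := (mul_le_mul_of_nonneg_left hBle (by positivity)).trans h1
    have h3 : (J * (c ^ 3 * v ^ 6)) ^ 4 ≤ 1 := by
      refine le_trans (le_of_eq ?_) h2; ring
    have h4 : J * (c ^ 3 * v ^ 6) ≤ 1 := by
      by_contra! h
      exact absurd h3 (not_le.2 (one_lt_pow₀ h (by norm_num)))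
    rw [← mul_one (c ^ 3)⁻¹, le_inv_mul_iff₀ (by positivity)]
    linarith
  have h6 : (1 + v) ^ 6 ≤ 32 * (1 + v ^ 6) := by
    have := add_pow_le zero_le_one hv0 6
    norm_num at this ⊢
    linarith
  calc J * (1 + v) ^ 6 ≤ J * (32 * (1 + v ^ 6)) := by gcongr
    _ = 32 * (J + J * v ^ 6) := by ring
    _ ≤ 32 * (1 + (c ^ 3)⁻¹) := by gcongr

end Increments

/-! ### Measures with small balls -/

lemma measurable_measure_closedBall (μ : Measure ℂ) [SFinite μ] (r : ℝ) :
    Measurable fun z => μ (Metric.closedBall z r) := by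
  have h : MeasurableSet {p : ℂ × ℂ | dist p.2 p.1 ≤ r} :=
    measurableSet_le (measurable_snd.dist measurable_fst) measurable_const
  exact measurable_measure_prodMk_left h

/-- A lower bound for the dimension of a set that carries a measure with small balls. -/
lemma le_dimH_of_lintegral_tsum_closedBall_lt_top {μ : Measure ℂ} [IsFiniteMeasure μ] (hμ : μ ≠ 0)
    {F : Set ℂ} (hF : μ Fᶜ = 0) {s : ℝ≥0} (hs : 0 < s)
    (hint : ∫⁻ z, ∑' j : ℕ, ((2⁻¹ : ℝ≥0∞) ^ j) ^ (-(s : ℝ)) * μ (Metric.closedBall z (2 ^ j)⁻¹) ∂μ < ⊤) :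
    (s : ℝ≥0∞) ≤ dimH F := by
  set g : ℂ → ℝ≥0∞ := fun z =>
    ∑' j : ℕ, ((2⁻¹ : ℝ≥0∞) ^ j) ^ (-(s : ℝ)) * μ (Metric.closedBall z (2 ^ j)⁻¹) with hg
  have hgm : Measurable g := Measurable.tsum fun j =>
    (measurable_measure_closedBall μ _).const_mul _
  have hgfin : ∀ᵐ z ∂μ, g z < ⊤ := ae_lt_top hgm hint.ne
  have hs' : (0 : ℝ) < s := hs
  -- The series is finite almost everywhere, hence bounded on a set of positive mass. There each
  -- dyadic ball of radius r has mass at most R rˢ, and the mass distribution principle applies.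
  obtain ⟨R, hR⟩ : ∃ R : ℕ, μ {z | g z ≤ R} ≠ 0 := by
    by_contra! hcon
    have hU : μ (⋃ R : ℕ, {z | g z ≤ R}) = 0 := measure_iUnion_null hcon
    have hU2 : ∀ᵐ z ∂μ, z ∉ ⋃ R : ℕ, {z | g z ≤ R} := compl_mem_ae_iff.2 hU
    have : ∀ᵐ _z ∂μ, False := by
      filter_upwards [hgfin, hU2] with z hz hz2
      obtain ⟨R, hR⟩ := ENNReal.exists_nat_gt hz.ne
      exact hz2 (mem_iUnion.2 ⟨R, hR.le⟩)
    exact hμ (by simpa using this)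
  set G := {z | g z ≤ R} with hG
  have hGm : MeasurableSet G := measurableSet_le hgm measurable_const
  have hball : ∀ z ∈ G, ∀ j : ℕ, μ (Metric.closedBall z (2 ^ j)⁻¹) ≤ R * ((2⁻¹ : ℝ≥0∞) ^ j) ^ (s : ℝ) := by
    intro z hz j
    have h1 : ((2⁻¹ : ℝ≥0∞) ^ j) ^ (-(s : ℝ)) * μ (Metric.closedBall z (2 ^ j)⁻¹) ≤ R :=
      (ENNReal.le_tsum j).trans hz
    have hp0 : ((2⁻¹ : ℝ≥0∞) ^ j) ≠ 0 := (ENNReal.pow_pos (by simp) j).ne'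
    have hpt : ((2⁻¹ : ℝ≥0∞) ^ j) ≠ ⊤ := ENNReal.pow_ne_top (by simp)
    have hq0 : ((2⁻¹ : ℝ≥0∞) ^ j) ^ (s : ℝ) ≠ 0 := (ENNReal.rpow_pos hp0.bot_lt hpt).ne'
    have hqt : ((2⁻¹ : ℝ≥0∞) ^ j) ^ (s : ℝ) ≠ ⊤ := ENNReal.rpow_ne_top_of_nonneg hs'.le hpt
    rw [ENNReal.rpow_neg, mul_comm, ← div_eq_mul_inv, ENNReal.div_le_iff hq0 hqt] at h1
    exact h1
  -- 2ˢ pays for rounding a diameter up to a power of 1/2; the added 1 keeps `c` nonzero.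
  set c : ℝ≥0∞ := R * (2 : ℝ≥0∞) ^ (s : ℝ) + 1 with hc
  have hctop : c ≠ ⊤ := ENNReal.add_ne_top.2
    ⟨ENNReal.mul_ne_top (by simp) (ENNReal.rpow_ne_top_of_nonneg hs'.le (by simp)), by simp⟩
  have hc0 : c ≠ 0 := by simp [hc]
  have hle : c⁻¹ • μ.restrict G ≤ Measure.hausdorffMeasure (s : ℝ) := by
    refine Measure.le_hausdorffMeasure _ _ 1 one_pos fun U hU => ?_
    rw [Measure.smul_apply, Measure.restrict_apply' hGm, smul_eq_mul]
    rcases (U ∩ G).eq_empty_or_nonempty with h | ⟨z, hzU, hzG⟩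
    · simp [h]
    have hsub : ∀ j : ℕ, Metric.ediam U ≤ (2⁻¹ : ℝ≥0∞) ^ j → μ (U ∩ G) ≤ R * ((2⁻¹ : ℝ≥0∞) ^ j) ^ (s : ℝ) := by
      intro j hj
      refine (measure_mono fun w hw => ?_).trans (hball z hzG j)
      have h1 := (Metric.edist_le_ediam_of_mem hw.1 hzU).trans hj
      rw [edist_dist, ← ofReal_two_pow_inv] at h1
      exact (ENNReal.ofReal_le_ofReal_iff (by positivity)).1 h1
    rcases eq_or_ne (Metric.ediam U) 0 with h0 | h0
    · have hlim : Tendsto (fun j : ℕ => R * ((2⁻¹ : ℝ≥0∞) ^ j) ^ (s : ℝ)) atTop (𝓝 0) := by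
        have h2 : Tendsto (fun k : ℕ => (2⁻¹ : ℝ≥0∞) ^ k) atTop (𝓝 0) :=
          ENNReal.tendsto_pow_atTop_nhds_zero_of_lt_one (by simp)
        have h3 := (ENNReal.continuous_rpow_const (y := (s : ℝ))).tendsto 0 |>.comp h2
        rw [ENNReal.zero_rpow_of_pos hs'] at h3
        simpa using ENNReal.Tendsto.const_mul h3 (Or.inr (by simp : (R : ℝ≥0∞) ≠ ⊤))
      have : μ (U ∩ G) ≤ 0 := ge_of_tendsto' hlim fun j => hsub j (by simp [h0])
      rw [le_antisymm this zero_le, mul_zero]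
      exact zero_le
    · have hdt : Metric.ediam U ≠ ⊤ := (hU.trans_lt ENNReal.one_lt_top).ne
      set d := (Metric.ediam U).toReal with hd
      have hdE : Metric.ediam U = ENNReal.ofReal d := (ENNReal.ofReal_toReal hdt).symm
      have hd0 : 0 < d := ENNReal.toReal_pos h0 hdt
      have hd1 : d ≤ 1 := ENNReal.toReal_le_of_le_ofReal zero_le_one (by simpa using hU)
      obtain ⟨j, hj1, hj2⟩ := exists_nat_pow_near_of_lt_one hd0 hd1 (y := 2⁻¹) (by norm_num) (by norm_num)
      have hj3 : Metric.ediam U ≤ (2⁻¹ : ℝ≥0∞) ^ j := by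
        rw [hdE, ← ofReal_two_pow_inv]
        exact ENNReal.ofReal_le_ofReal (by rwa [inv_pow] at hj2)
      have hj4 : (2⁻¹ : ℝ≥0∞) ^ j ≤ 2 * Metric.ediam U := by
        have : (2⁻¹ : ℝ≥0∞) ^ (j + 1) ≤ Metric.ediam U := by
          rw [hdE, ← ofReal_two_pow_inv]
          exact ENNReal.ofReal_le_ofReal (by rw [inv_pow] at hj1; exact hj1.le)
        calc (2⁻¹ : ℝ≥0∞) ^ j = 2 * (2⁻¹ : ℝ≥0∞) ^ (j + 1) := by
              rw [pow_succ, mul_left_comm, ENNReal.mul_inv_cancel (by simp) (by simp), mul_one]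
          _ ≤ _ := by gcongr
      rw [← ENNReal.mul_le_mul_iff_right hc0 hctop, ← mul_assoc, ENNReal.mul_inv_cancel hc0 hctop, one_mul]
      calc μ (U ∩ G) ≤ R * ((2⁻¹ : ℝ≥0∞) ^ j) ^ (s : ℝ) := hsub j hj3
        _ ≤ R * (2 * Metric.ediam U) ^ (s : ℝ) := by gcongr
        _ = R * (2 : ℝ≥0∞) ^ (s : ℝ) * Metric.ediam U ^ (s : ℝ) := by
          rw [ENNReal.mul_rpow_of_nonneg _ _ hs'.le, mul_assoc]
        _ ≤ c * Metric.ediam U ^ (s : ℝ) := by gcongr; exact le_self_add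
  refine le_dimH_of_hausdorffMeasure_ne_zero fun h0 => ?_
  have h1 := hle F
  rw [h0, Measure.smul_apply, smul_eq_mul, Measure.restrict_apply' hGm] at h1
  have h2 : μ (F ∩ G) = 0 := by
    have := le_antisymm h1 zero_le
    rcases mul_eq_zero.1 this with h | h
    · exact absurd h (ENNReal.inv_ne_zero.2 hctop)
    · exact h
  refine hR (le_antisymm ?_ zero_le)
  calc μ G ≤ μ (F ∩ G) + μ Fᶜ := (measure_mono fun z hz => by
        by_cases h : z ∈ F
        · exact Or.inl ⟨h, hz⟩
        · exact Or.inr h).trans (measure_union_le _ _)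
    _ = 0 := by rw [h2, hF, add_zero]

/-- A set that carries a measure of finite lower density has positive area. -/
lemma volume_pos_of_lintegral_liminf_closedBall_lt_top {μ : Measure ℂ} [IsFiniteMeasure μ]
    (hμ : μ ≠ 0) {F : Set ℂ} (hF : μ Fᶜ = 0)
    (hint : ∫⁻ z, liminf (fun j : ℕ => ((2⁻¹ : ℝ≥0∞) ^ j) ^ (-(2 : ℝ)) *
      μ (Metric.closedBall z (2 ^ j)⁻¹)) atTop ∂μ < ⊤) : 0 < volume F := by
  set g : ℂ → ℝ≥0∞ := fun z => liminf (fun j : ℕ => ((2⁻¹ : ℝ≥0∞) ^ j) ^ (-(2 : ℝ)) *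
      μ (Metric.closedBall z (2 ^ j)⁻¹)) atTop with hg
  have hgm : Measurable g := Measurable.liminf fun j =>
    (measurable_measure_closedBall μ _).const_mul _
  have hgfin : ∀ᵐ z ∂μ, g z < ⊤ := ae_lt_top hgm hint.ne
  rw [pos_iff_ne_zero]
  intro hvol
  have hnull : ∀ R : ℕ, μ {z ∈ F | g z < R} = 0 := by
    intro R
    -- Around each point of this set there are arbitrarily small balls whose mass is at most R times
    -- their area. The Besicovitch covering theorem turns this into a comparison of the two measures
    -- on the set, although the balls occur only along a subsequence of radii.
    have key : μ {z ∈ F | g z < R} ≤ ((R : ℝ≥0) • (volume : Measure ℂ)) {z ∈ F | g z < R} := by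
      refine (Besicovitch.vitaliFamily μ).measure_le_of_frequently_le _ Measure.AbsolutelyContinuous.rfl _ ?_
      rintro z ⟨-, hz⟩
      have hfr := frequently_lt_of_liminf_lt (by isBoundedDefault) hz
      have htend : Tendsto (fun j : ℕ => Metric.closedBall z ((2 : ℝ) ^ j)⁻¹) atTop
          ((Besicovitch.vitaliFamily μ).filterAt z) := by
        refine (Besicovitch.tendsto_filterAt μ z).comp ?_
        refine tendsto_nhdsWithin_iff.2 ⟨?_, Eventually.of_forall fun j => ?_⟩
        · have := tendsto_pow_atTop_nhds_zero_of_lt_one (r := (2⁻¹ : ℝ)) (by norm_num) (by norm_num)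
          simpa only [inv_pow] using this
        · exact mem_Ioi.2 (by positivity)
      refine htend.frequently (hfr.mono fun j hj => ?_)
      have hp0 : ((2⁻¹ : ℝ≥0∞) ^ j) ≠ 0 := (ENNReal.pow_pos (by simp) j).ne'
      have hpt : ((2⁻¹ : ℝ≥0∞) ^ j) ≠ ⊤ := ENNReal.pow_ne_top (by simp)
      rw [ENNReal.rpow_neg, ENNReal.rpow_two, mul_comm, ← div_eq_mul_inv] at hj
      have h1 := (ENNReal.div_lt_iff (Or.inl (pow_ne_zero 2 hp0))
        (Or.inl (ENNReal.pow_ne_top hpt))).1 hj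
      rw [Measure.smul_apply, Complex.volume_closedBall, ofReal_two_pow_inv]
      refine h1.le.trans ?_
      rw [ENNReal.smul_def, smul_eq_mul]
      push_cast
      gcongr
      refine le_mul_of_one_le_right zero_le ?_
      have : (1 : ℝ≥0) ≤ NNReal.pi := by
        rw [← NNReal.coe_le_coe]
        simpa using (by linarith [Real.pi_gt_three] : (1 : ℝ) ≤ Real.pi)
      exact_mod_cast this
    refine le_antisymm (key.trans ?_) zero_le
    rw [Measure.smul_apply, measure_mono_null (fun z hz => hz.1) hvol, smul_zero]
  have hU : μ (⋃ R : ℕ, {z ∈ F | g z < R}) = 0 := measure_iUnion_null hnull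
  have hU2 : ∀ᵐ z ∂μ, z ∉ ⋃ R : ℕ, {z ∈ F | g z < R} := compl_mem_ae_iff.2 hU
  have hF2 : ∀ᵐ z ∂μ, z ∈ F := by rwa [ae_iff]
  have : ∀ᵐ _z ∂μ, False := by
    filter_upwards [hgfin, hU2, hF2] with z hz hz2 hzF
    obtain ⟨R, hR⟩ := ENNReal.exists_nat_gt hz.ne
    exact hz2 (mem_iUnion.2 ⟨R, hzF, hR⟩)
  exact hμ (by simpa using this)

/-! ### Small ball probabilities -/

section SmallBall

variable {Ω : Type*} [MeasurableSpace Ω] {P : Measure Ω} [IsProbabilityMeasure P]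

/-- Fourier inversion for the Gaussian of variance `ρ²` on the plane. -/
lemma integral_gaussian_mul_exp_inner {ρ : ℝ} (hρ : 0 < ρ) (z : ℂ) :
    ∫ v : ℂ, Complex.exp (-((ρ ^ 2 / 2 : ℝ) : ℂ) * ‖v‖ ^ 2 + Complex.I * (inner ℝ z v : ℝ)) =
      ((2 * Real.pi / ρ ^ 2 * Real.exp (-(‖z‖ ^ 2 / (2 * ρ ^ 2))) : ℝ) : ℂ) := by
  have hb : 0 < (((ρ ^ 2 / 2 : ℝ) : ℂ)).re := by rw [Complex.ofReal_re]; positivity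
  rw [GaussianFourier.integral_cexp_neg_mul_sq_norm_add hb, Complex.finrank_real_complex]
  have hρ' : (ρ : ℂ) ≠ 0 := by exact_mod_cast hρ.ne'
  push_cast
  rw [div_self (by norm_num : (2 : ℂ) ≠ 0), Complex.cpow_one, Complex.I_sq]
  congr 1
  · field_simp
  · congr 1
    field_simp
    norm_num

/-- The integral of `(1 + ‖v‖)⁻⁶` over the plane. -/
noncomputable def bracketIntegral : ℝ := ∫ v : ℂ, (1 + ‖v‖) ^ (-(6 : ℝ))

lemma integrable_bracket : Integrable fun v : ℂ => (1 + ‖v‖) ^ (-(6 : ℝ)) :=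
  integrable_one_add_norm (by rw [Complex.finrank_real_complex]; norm_num)

lemma integrable_bracket_mul {D : ℝ} (hD : 0 < D) :
    Integrable fun v : ℂ => (1 + ‖v‖ * D) ^ (-(6 : ℝ)) := by
  have := integrable_bracket.comp_smul hD.ne'
  refine this.congr (ae_of_all _ fun v => ?_)
  simp only [norm_smul, Real.norm_of_nonneg hD.le, mul_comm]

lemma integral_bracket_mul {D : ℝ} (hD : 0 < D) :
    ∫ v : ℂ, (1 + ‖v‖ * D) ^ (-(6 : ℝ)) = (D ^ 2)⁻¹ * bracketIntegral := by
  have := Measure.integral_comp_smul (volume : Measure ℂ) (fun v : ℂ => (1 + ‖v‖) ^ (-(6 : ℝ))) D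
  rw [Complex.finrank_real_complex, abs_of_pos (by positivity), smul_eq_mul] at this
  rw [bracketIntegral, ← this]
  simp only [norm_smul, Real.norm_of_nonneg hD.le, mul_comm]

/-- Markov's inequality for exp(−|Z|²/(2ρ²)), which is at least exp(−1/2) on the event. By Fourier
inversion its mean is ρ²/(2π) times a Gaussian integral of the characteristic function, and that
integral is at most C ∫ (1 + |v| D)⁻⁶ dv, a multiple of D⁻². -/
lemma measureReal_norm_le_le {Z : Ω → ℂ} (hZ : Measurable Z) {C D : ℝ} (hD : 0 < D)
    (hC : ∀ ξ : ℂ, ‖∫ ω, Complex.exp ((inner ℝ (Z ω) ξ : ℝ) * Complex.I) ∂P‖ *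
      (1 + ‖ξ‖ * D) ^ 6 ≤ C) {ρ : ℝ} (hρ : 0 < ρ) :
    P.real {ω | ‖Z ω‖ ≤ ρ} ≤
      Real.exp (1 / 2) * (2 * Real.pi)⁻¹ * bracketIntegral * C * (ρ / D) ^ 2 := by
  set f : Ω → ℂ → ℂ := fun ω v =>
    Complex.exp (-((ρ ^ 2 / 2 : ℝ) : ℂ) * ‖v‖ ^ 2 + Complex.I * (inner ℝ (Z ω) v : ℝ)) with hf
  have hfnorm : ∀ ω v, ‖f ω v‖ = Real.exp (-(ρ ^ 2 / 2) * ‖v‖ ^ 2) := by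
    intro ω v
    rw [hf, Complex.norm_exp]
    congr 1
    rw [Complex.add_re, mul_comm Complex.I, Complex.re_ofReal_mul, Complex.I_re, mul_zero,
      add_zero, ← Complex.ofReal_neg, ← Complex.ofReal_pow, ← Complex.ofReal_mul, Complex.ofReal_re]
  have hgauss : Integrable fun v : ℂ => Real.exp (-(ρ ^ 2 / 2) * ‖v‖ ^ 2) := by
    have hb : 0 < (((ρ ^ 2 / 2 : ℝ) : ℂ)).re := by rw [Complex.ofReal_re]; positivity
    have := (GaussianFourier.integrable_cexp_neg_mul_sq_norm_add hb 0 (0 : ℂ)).norm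
    refine this.congr (ae_of_all _ fun v => ?_)
    simp only [zero_mul, add_zero]
    rw [Complex.norm_exp]
    congr 1
    rw [← Complex.ofReal_neg, ← Complex.ofReal_pow, ← Complex.ofReal_mul, Complex.ofReal_re]
  have hfint : Integrable (Function.uncurry f) (P.prod volume) := by
    refine (hgauss.comp_snd P).mono' (Measurable.aestronglyMeasurable ?_)
      (ae_of_all _ fun p => (hfnorm p.1 p.2).le)
    simp only [hf, Function.uncurry_def]
    have : Measurable fun p : Ω × ℂ => Z p.1 := hZ.comp measurable_fst
    fun_prop
  have hswap := integral_integral_swap hfint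
  have hleft : ∫ ω, (∫ v, f ω v) ∂P = ((2 * Real.pi / ρ ^ 2 *
      ∫ ω, Real.exp (-(‖Z ω‖ ^ 2 / (2 * ρ ^ 2))) ∂P : ℝ) : ℂ) := by
    simp_rw [hf, integral_gaussian_mul_exp_inner hρ]
    rw [integral_complex_ofReal, integral_const_mul]
  set E := ∫ ω, Real.exp (-(‖Z ω‖ ^ 2 / (2 * ρ ^ 2))) ∂P with hE
  have hE0 : 0 ≤ E := integral_nonneg fun ω => (Real.exp_pos _).le
  have hright : ‖∫ v, (∫ ω, f ω v ∂P)‖ ≤ ∫ v : ℂ, C * (1 + ‖v‖ * D) ^ (-(6 : ℝ)) := by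
    refine norm_integral_le_of_norm_le ((integrable_bracket_mul hD).const_mul C)
      (ae_of_all _ fun v => ?_)
    have h1 : ∫ ω, f ω v ∂P = Complex.exp (-((ρ ^ 2 / 2 : ℝ) : ℂ) * ‖v‖ ^ 2) *
        ∫ ω, Complex.exp ((inner ℝ (Z ω) v : ℝ) * Complex.I) ∂P := by
      rw [← integral_const_mul]
      refine integral_congr_ae (ae_of_all _ fun ω => ?_)
      simp only [hf]
      rw [Complex.exp_add, mul_comm Complex.I]
    have h2 : ‖Complex.exp (-((ρ ^ 2 / 2 : ℝ) : ℂ) * ‖v‖ ^ 2)‖ ≤ 1 := by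
      rw [Complex.norm_exp, ← Complex.ofReal_neg, ← Complex.ofReal_pow, ← Complex.ofReal_mul,
        Complex.ofReal_re, Real.exp_le_one_iff]
      have : 0 ≤ ρ ^ 2 / 2 * ‖v‖ ^ 2 := by positivity
      linarith
    have h3 : 0 < 1 + ‖v‖ * D := by positivity
    rw [h1, norm_mul, Real.rpow_neg h3.le, ← div_eq_mul_inv, le_div_iff₀ (by positivity)]
    refine le_trans ?_ (hC v)
    rw [show (6 : ℝ) = ((6 : ℕ) : ℝ) by norm_num, Real.rpow_natCast]
    gcongr
    exact mul_le_of_le_one_left (norm_nonneg _) h2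
  rw [← hswap, hleft, Complex.norm_real, Real.norm_of_nonneg (by positivity), integral_const_mul,
    integral_bracket_mul hD] at hright
  have hEle : E ≤ (2 * Real.pi)⁻¹ * bracketIntegral * C * (ρ / D) ^ 2 := by
    have := mul_le_mul_of_nonneg_left hright (by positivity : 0 ≤ ρ ^ 2 / (2 * Real.pi))
    refine le_trans (le_of_eq ?_) (this.trans (le_of_eq ?_))
    · field_simp
    · field_simp
  have hmarkov : Real.exp (-(1 / 2)) * P.real {ω | ‖Z ω‖ ≤ ρ} ≤ E := by
    have hint : Integrable (fun ω => Real.exp (-(‖Z ω‖ ^ 2 / (2 * ρ ^ 2)))) P := by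
      refine Integrable.of_bound (C := 1) (Measurable.aestronglyMeasurable (by fun_prop)) (ae_of_all _ fun ω => ?_)
      rw [Real.norm_of_nonneg (Real.exp_pos _).le, Real.exp_le_one_iff]
      have : 0 ≤ ‖Z ω‖ ^ 2 / (2 * ρ ^ 2) := by positivity
      linarith
    refine le_trans ?_ (mul_meas_ge_le_integral_of_nonneg
      (ae_of_all _ fun ω => (Real.exp_pos _).le) hint (Real.exp (-(1 / 2))))
    refine mul_le_mul_of_nonneg_left (measureReal_mono fun ω hω => ?_) (Real.exp_pos _).le
    have hω : ‖Z ω‖ ≤ ρ := hω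
    refine Real.exp_le_exp.2 ?_
    rw [neg_le_neg_iff, div_le_div_iff₀ (by positivity) (by norm_num)]
    nlinarith [pow_le_pow_left₀ (norm_nonneg _) hω 2]
  calc P.real {ω | ‖Z ω‖ ≤ ρ}
      = Real.exp (1 / 2) * (Real.exp (-(1 / 2)) * P.real {ω | ‖Z ω‖ ≤ ρ}) := by
        rw [← mul_assoc, ← Real.exp_add]; simp
    _ ≤ Real.exp (1 / 2) * ((2 * Real.pi)⁻¹ * bracketIntegral * C * (ρ / D) ^ 2) := by
        exact mul_le_mul_of_nonneg_left (hmarkov.trans hEle) (Real.exp_pos _).le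
    _ = _ := by ring

end SmallBall

section Energy

variable {Ω : Type*} [MeasurableSpace Ω] {P : Measure Ω} [IsProbabilityMeasure P] {θ : ℕ → Ω → ℝ}
  {φ : ℕ → ℝ → ℂ} {a : ℕ → ℂ} {lam : ℕ → ℝ} {q τ' : ℝ}

lemma measurable_series_apply {Ω : Type*} [MeasurableSpace Ω] {θ : ℕ → Ω → ℝ} {φ : ℕ → ℝ → ℂ}
    {a : ℕ → ℂ} {lam : ℕ → ℝ} (hφ : BoundedLocallyBiLipschitz φ) (ha : Summable fun n => ‖a n‖)
    (hm : ∀ n, Measurable (θ n)) (x : ℝ) :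
    Measurable fun ω => series a φ lam (fun n => θ n ω) x :=
  Measurable.comp (g := fun p : ℝ × Ω => series a φ lam (fun n => θ n p.2) p.1)
    (f := fun ω => (x, ω)) (measurable_series hφ ha hm) measurable_prodMk_left

/-- Small ball estimate for the increments of the series. -/
theorem exists_measure_increment_le (hm : ∀ n, Measurable (θ n)) (hi : iIndepFun θ P)
    (hu : ∀ n, pdf.IsUniform (θ n) (Icc 0 1) P volume) (hφ : BoundedLocallyBiLipschitz φ)
    (ha : Summable fun n => ‖a n‖) (hq : 1 < q) (hτ' : 0 < τ') (hτ : tau a lam q < τ') :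
    ∃ C r : ℝ, 0 < C ∧ 0 < r ∧ ∀ s : ℝ, 0 < s → s ≤ 2 → ∀ x y : ℝ, |x - y| ≤ r → ∀ ρ : ℝ, 0 < ρ →
      P {ω | ‖series a φ lam (fun n => θ n ω) x - series a φ lam (fun n => θ n ω) y‖ ≤ ρ} ≤
        ENNReal.ofReal C * ENNReal.ofReal ρ ^ s * edist x y ^ (-(s * τ')) := by
  obtain ⟨C, r, hC, hr, h⟩ := exists_norm_integral_increment_le hm hi hu hφ ha hq hτ' hτ
  set C' := max 1 (Real.exp (1 / 2) * (2 * Real.pi)⁻¹ * bracketIntegral * C) with hC'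
  have hC'1 : 1 ≤ C' := le_max_left _ _
  refine ⟨C', r, by linarith, hr, fun s hs hs2 x y hxy ρ hρ => ?_⟩
  rcases eq_or_ne x y with rfl | hne
  · rw [edist_self, ENNReal.zero_rpow_of_neg (by nlinarith), ENNReal.mul_top]
    · exact le_top
    · exact mul_ne_zero (ENNReal.ofReal_pos.2 (by linarith)).ne'
        (ENNReal.rpow_pos (ENNReal.ofReal_pos.2 hρ) ENNReal.ofReal_ne_top).ne'
  have hd : 0 < |x - y| := abs_pos.2 (sub_ne_zero.2 hne)
  have hD : 0 < |x - y| ^ τ' := Real.rpow_pos_of_pos hd _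
  set Z : Ω → ℂ := fun ω => series a φ lam (fun n => θ n ω) x - series a φ lam (fun n => θ n ω) y
  have hZ : Measurable Z :=
    (measurable_series_apply hφ ha hm x).sub (measurable_series_apply hφ ha hm y)
  have h1 := measureReal_norm_le_le hZ hD (h x y hxy) hρ
  set u := ρ / |x - y| ^ τ' with hu
  have hu0 : 0 < u := by positivity
  have h2 : P.real {ω | ‖Z ω‖ ≤ ρ} ≤ C' * u ^ s := by
    -- For 0 < s ≤ 2 both u² with u ≤ 1 and the trivial bound 1 with u ≥ 1 are at most uˢ; the
    -- second case is why `C'` is at least 1.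
    rcases le_total u 1 with hu1 | hu1
    · calc _ ≤ _ := h1
        _ ≤ C' * u ^ 2 := by gcongr; exact le_max_right _ _
        _ ≤ C' * u ^ s := by
          gcongr
          rw [← Real.rpow_two]
          exact Real.rpow_le_rpow_of_exponent_ge hu0 hu1 hs2
    · calc _ ≤ (1 : ℝ) := measureReal_le_one
        _ ≤ C' * u ^ s := one_le_mul_of_one_le_of_one_le hC'1 (Real.one_le_rpow hu1 hs.le)
  rw [← ofReal_measureReal]
  refine (ENNReal.ofReal_le_ofReal h2).trans (le_of_eq ?_)
  rw [ENNReal.ofReal_mul (by linarith), mul_assoc, edist_dist, Real.dist_eq, hu,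
    Real.div_rpow hρ.le hD.le, ← Real.rpow_mul hd.le, ENNReal.ofReal_rpow_of_pos hρ,
    ENNReal.ofReal_rpow_of_pos hd, Real.rpow_neg hd.le,
    mul_comm τ', div_eq_mul_inv, ENNReal.ofReal_mul (by positivity)]

end Energy

/-! ### Images: lower bound for the dimension, and positive area -/

section Images

variable {Ω : Type*} [MeasurableSpace Ω] {P : Measure Ω} [IsProbabilityMeasure P] {θ : ℕ → Ω → ℝ}
  {φ : ℕ → ℝ → ℂ} {a : ℕ → ℂ} {lam : ℕ → ℝ} {q τ' : ℝ}

lemma measurable_series_swap {Ω : Type*} [MeasurableSpace Ω] {θ : ℕ → Ω → ℝ} {φ : ℕ → ℝ → ℂ}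
    {a : ℕ → ℂ} {lam : ℕ → ℝ} (hφ : BoundedLocallyBiLipschitz φ) (ha : Summable fun n => ‖a n‖)
    (hm : ∀ n, Measurable (θ n)) :
    Measurable fun p : Ω × ℝ => series a φ lam (fun n => θ n p.1) p.2 :=
  Measurable.comp (g := fun p : ℝ × Ω => series a φ lam (fun n => θ n p.2) p.1)
    (f := Prod.swap) (measurable_series hφ ha hm) measurable_swap

lemma measurableSet_norm_sub_le {Ω : Type*} [MeasurableSpace Ω] {S : Ω → ℝ → ℂ}
    (hS : Measurable fun p : Ω × ℝ => S p.1 p.2) (ρ : ℝ) :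
    MeasurableSet {p : (Ω × ℝ) × ℝ | ‖S p.1.1 p.1.2 - S p.1.1 p.2‖ ≤ ρ} := by
  have h1 : Measurable fun p : (Ω × ℝ) × ℝ => S p.1.1 p.1.2 := hS.comp measurable_fst
  have h2 : Measurable fun p : (Ω × ℝ) × ℝ => S p.1.1 p.2 :=
    hS.comp (measurable_fst.fst.prodMk measurable_snd)
  exact measurableSet_le (h1.sub h2).norm measurable_const

lemma measurable_measure_norm_sub_le {Ω : Type*} [MeasurableSpace Ω] {S : Ω → ℝ → ℂ}
    (hS : Measurable fun p : Ω × ℝ => S p.1 p.2) (ν : Measure ℝ) [SFinite ν] (ρ : ℝ) :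
    Measurable fun p : Ω × ℝ => ν {y | ‖S p.1 p.2 - S p.1 y‖ ≤ ρ} :=
  measurable_measure_prodMk_left (measurableSet_norm_sub_le hS ρ)

lemma lintegral_measure_norm_sub_le_eq {Ω : Type*} [MeasurableSpace Ω] {P : Measure Ω} [SFinite P]
    {S : Ω → ℝ → ℂ} (hS : Measurable fun p : Ω × ℝ => S p.1 p.2) (ν : Measure ℝ) [SFinite ν] (ρ : ℝ) :
    ∫⁻ ω, ∫⁻ x, ν {y | ‖S ω x - S ω y‖ ≤ ρ} ∂ν ∂P = ∫⁻ x, ∫⁻ y, P {ω | ‖S ω x - S ω y‖ ≤ ρ} ∂ν ∂ν := by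
  rw [lintegral_lintegral_swap (measurable_measure_norm_sub_le hS ν ρ).aemeasurable]
  refine lintegral_congr fun x => ?_
  have hE : MeasurableSet {p : Ω × ℝ | ‖S p.1 x - S p.1 p.2‖ ≤ ρ} :=
    (measurableSet_norm_sub_le hS ρ).preimage
      (f := fun p : Ω × ℝ => (((p.1, x), p.2) : (Ω × ℝ) × ℝ)) (by fun_prop)
  exact (Measure.prod_apply hE).symm.trans (Measure.prod_apply_symm hE)

/-- By Tonelli the expected ν × ν mass of the pairs with ρ-close images is the average of the small
ball probabilities, and hence an energy of ν. -/
lemma lintegral_measure_norm_sub_le_le {ν : Measure ℝ} [IsProbabilityMeasure ν] {K : Set ℝ}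
    (hK : ν Kᶜ = 0) {S : Ω → ℝ → ℂ} (hS : Measurable fun p : Ω × ℝ => S p.1 p.2) {s ρ : ℝ} {C : ℝ≥0∞}
    (hC : ∀ x ∈ K, ∀ y ∈ K, P {ω | ‖S ω x - S ω y‖ ≤ ρ} ≤
      C * ENNReal.ofReal ρ ^ s * edist x y ^ (-(s * τ'))) :
    ∫⁻ ω, ∫⁻ x, ν {y | ‖S ω x - S ω y‖ ≤ ρ} ∂ν ∂P ≤
      C * ENNReal.ofReal ρ ^ s * ∫⁻ x, ∫⁻ y, edist x y ^ (-(s * τ')) ∂ν ∂ν := by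
  have hae : ∀ᵐ x ∂ν, x ∈ K := by rwa [ae_iff]
  rw [lintegral_measure_norm_sub_le_eq hS]
  have hmeas : Measurable fun p : ℝ × ℝ => edist p.1 p.2 ^ (-(s * τ')) :=
    (measurable_fst.edist measurable_snd).pow_const _
  rw [← lintegral_const_mul _ (Measurable.lintegral_prod_right' hmeas)]
  refine lintegral_mono_ae (hae.mono fun x hx => ?_)
  refine le_trans ?_ (lintegral_const_mul _ (hmeas.comp (measurable_prodMk_left (x := x)))).le
  exact lintegral_mono_ae (hae.mono fun y hy => hC x hx y hy)

lemma map_closedBall {f : ℝ → ℂ} (hf : Measurable f) (ν : Measure ℝ) (x ρ : ℝ) :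
    ν.map f (Metric.closedBall (f x) ρ) = ν {y | ‖f x - f y‖ ≤ ρ} := by
  rw [Measure.map_apply hf measurableSet_closedBall]
  congr 1
  ext y
  rw [mem_preimage, Metric.mem_closedBall, dist_comm, dist_eq_norm]
  rfl

lemma map_compl_image_eq_zero {f : ℝ → ℂ} (hf : Continuous f) {ν : Measure ℝ} {K : Set ℝ}
    (hK : IsCompact K) (hν : ν Kᶜ = 0) : ν.map f (f '' K)ᶜ = 0 := by
  rw [Measure.map_apply hf.measurable (hK.image hf).measurableSet.compl]
  exact measure_mono_null (fun x hx hxK => hx (mem_image_of_mem f hxK)) hν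

/-- At s = 2 the normalized ball masses have expectations bounded uniformly in the scale by an
energy of ν. Fatou's lemma, in `x` and then in `ω`, makes the lower area density of the image
measure almost surely integrable. -/
lemma ae_volume_image_pos_of_increment {S : Ω → ℝ → ℂ}
    (hS : Measurable fun p : Ω × ℝ => S p.1 p.2) (hSc : ∀ ω, Continuous (S ω)) {C r : ℝ} (hr : 0 < r)
    (hP : ∀ s : ℝ, 0 < s → s ≤ 2 → ∀ x y : ℝ, |x - y| ≤ r → ∀ ρ : ℝ, 0 < ρ →
      P {ω | ‖S ω x - S ω y‖ ≤ ρ} ≤ ENNReal.ofReal C * ENNReal.ofReal ρ ^ s * edist x y ^ (-(s * τ')))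
    (hτ' : 0 < τ') {A : Set ℝ} (hA : MeasurableSet A) (hdim : ENNReal.ofReal (2 * τ') < dimH A) :
    ∀ᵐ ω ∂P, 0 < volume (S ω '' A) := by
  obtain ⟨K, ν, hKA, hK, hKr, hν, hνK, hen⟩ :=
    exists_measure_energy_lt_top hA (by positivity : 0 < 2 * τ') hdim hr
  have hbound : ∀ j : ℕ, ∫⁻ ω, ∫⁻ x, ((2⁻¹ : ℝ≥0∞) ^ j) ^ (-(2 : ℝ)) *
      ν {y | ‖S ω x - S ω y‖ ≤ (2 ^ j)⁻¹} ∂ν ∂P ≤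
      ENNReal.ofReal C * ∫⁻ x, ∫⁻ y, edist x y ^ (-(2 * τ')) ∂ν ∂ν := by
    intro j
    have h1 := lintegral_measure_norm_sub_le_le (P := P) (τ' := τ') (s := 2) (ρ := ((2 : ℝ) ^ j)⁻¹)
      (C := ENNReal.ofReal C) hνK hS fun x hx y hy =>
        hP 2 two_pos le_rfl x y (hKr x hx y hy) _ (by positivity)
    have hmeas := measurable_measure_norm_sub_le hS ν (((2 : ℝ) ^ j)⁻¹)
    rw [ofReal_two_pow_inv] at h1
    have hp0 : ((2⁻¹ : ℝ≥0∞) ^ j) ≠ 0 := (ENNReal.pow_pos (by simp) j).ne'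
    have hpt : ((2⁻¹ : ℝ≥0∞) ^ j) ≠ ⊤ := ENNReal.pow_ne_top (by simp)
    calc _ = ((2⁻¹ : ℝ≥0∞) ^ j) ^ (-(2 : ℝ)) * ∫⁻ ω, ∫⁻ x, ν {y | ‖S ω x - S ω y‖ ≤ (2 ^ j)⁻¹} ∂ν ∂P := by
          rw [← lintegral_const_mul _ hmeas.lintegral_prod_right']
          refine lintegral_congr fun ω => ?_
          exact lintegral_const_mul _ (hmeas.comp (measurable_prodMk_left (x := ω)))
      _ ≤ ((2⁻¹ : ℝ≥0∞) ^ j) ^ (-(2 : ℝ)) * (ENNReal.ofReal C * ((2⁻¹ : ℝ≥0∞) ^ j) ^ (2 : ℝ) *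
          ∫⁻ x, ∫⁻ y, edist x y ^ (-(2 * τ')) ∂ν ∂ν) := by gcongr
      _ = (((2⁻¹ : ℝ≥0∞) ^ j) ^ (-(2 : ℝ)) * ((2⁻¹ : ℝ≥0∞) ^ j) ^ (2 : ℝ)) * (ENNReal.ofReal C *
          ∫⁻ x, ∫⁻ y, edist x y ^ (-(2 * τ')) ∂ν ∂ν) := by ring
      _ = _ := by rw [← ENNReal.rpow_add _ _ hp0 hpt]; simp
  have hmeasj : ∀ j : ℕ, Measurable fun p : Ω × ℝ => ((2⁻¹ : ℝ≥0∞) ^ j) ^ (-(2 : ℝ)) *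
      ν {y | ‖S p.1 p.2 - S p.1 y‖ ≤ (2 ^ j)⁻¹} := fun j =>
    (measurable_measure_norm_sub_le hS ν _).const_mul _
  have hmeasL : Measurable fun p : Ω × ℝ => liminf (fun j : ℕ => ((2⁻¹ : ℝ≥0∞) ^ j) ^ (-(2 : ℝ)) *
      ν {y | ‖S p.1 p.2 - S p.1 y‖ ≤ (2 ^ j)⁻¹}) atTop := Measurable.liminf hmeasj
  have hfin : ∫⁻ ω, ∫⁻ x, liminf (fun j : ℕ => ((2⁻¹ : ℝ≥0∞) ^ j) ^ (-(2 : ℝ)) *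
      ν {y | ‖S ω x - S ω y‖ ≤ (2 ^ j)⁻¹}) atTop ∂ν ∂P < ⊤ := by
    refine lt_of_le_of_lt ?_ (ENNReal.mul_lt_top (ENNReal.ofReal_lt_top (r := C)) hen)
    calc _ ≤ ∫⁻ ω, liminf (fun j : ℕ => ∫⁻ x, ((2⁻¹ : ℝ≥0∞) ^ j) ^ (-(2 : ℝ)) *
          ν {y | ‖S ω x - S ω y‖ ≤ (2 ^ j)⁻¹} ∂ν) atTop ∂P :=
          lintegral_mono fun ω => lintegral_liminf_le fun j => (hmeasj j).comp measurable_prodMk_left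
      _ ≤ liminf (fun j : ℕ => ∫⁻ ω, ∫⁻ x, ((2⁻¹ : ℝ≥0∞) ^ j) ^ (-(2 : ℝ)) *
          ν {y | ‖S ω x - S ω y‖ ≤ (2 ^ j)⁻¹} ∂ν ∂P) atTop :=
          lintegral_liminf_le fun j => (hmeasj j).lintegral_prod_right'
      _ ≤ _ := liminf_le_of_le (by isBoundedDefault) fun b hb =>
          hb.exists.elim fun j hj => hj.trans (hbound j)
  filter_upwards [ae_lt_top hmeasL.lintegral_prod_right' hfin.ne] with ω hω
  have hSm := (hSc ω).measurable
  have : IsProbabilityMeasure (ν.map (S ω)) := Measure.isProbabilityMeasure_map hSm.aemeasurable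
  refine lt_of_lt_of_le (volume_pos_of_lintegral_liminf_closedBall_lt_top (μ := ν.map (S ω))
    (IsProbabilityMeasure.ne_zero _) (map_compl_image_eq_zero (hSc ω) hK hνK) ?_)
    (measure_mono (image_mono hKA))
  rw [lintegral_map (Measurable.liminf fun j => (measurable_measure_closedBall _ _).const_mul _) hSm]
  simp_rw [map_closedBall hSm]
  exact hω

/-- The small ball bound at the larger exponent `s'` leaves a factor 2^(−(s'−s)j) at scale 2⁻ʲ, so
the expected sum over the scales converges. -/
lemma ae_le_dimH_image_of_increment {S : Ω → ℝ → ℂ}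
    (hS : Measurable fun p : Ω × ℝ => S p.1 p.2) (hSc : ∀ ω, Continuous (S ω)) {C r : ℝ} (hr : 0 < r)
    (hP : ∀ s : ℝ, 0 < s → s ≤ 2 → ∀ x y : ℝ, |x - y| ≤ r → ∀ ρ : ℝ, 0 < ρ →
      P {ω | ‖S ω x - S ω y‖ ≤ ρ} ≤ ENNReal.ofReal C * ENNReal.ofReal ρ ^ s * edist x y ^ (-(s * τ')))
    (hτ' : 0 < τ') {A : Set ℝ} (hA : MeasurableSet A) {s : ℝ≥0} {s' : ℝ} (hs : 0 < s) (hss' : s < s')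
    (hs' : s' ≤ 2) (hdim : ENNReal.ofReal (s' * τ') < dimH A) :
    ∀ᵐ ω ∂P, (s : ℝ≥0∞) ≤ dimH (S ω '' A) := by
  have hs0 : (0 : ℝ) < s := hs
  have hs'0 : 0 < s' := hs0.trans hss'
  obtain ⟨K, ν, hKA, hK, hKr, hν, hνK, hen⟩ :=
    exists_measure_energy_lt_top hA (by positivity : 0 < s' * τ') hdim hr
  set I := ∫⁻ x, ∫⁻ y, edist x y ^ (-(s' * τ')) ∂ν ∂ν with hI
  set b : ℝ≥0∞ := (2⁻¹ : ℝ≥0∞) ^ (s' - s) with hb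
  have hb1 : b < 1 := ENNReal.rpow_lt_one (by simp) (sub_pos.2 hss')
  have hmeasj : ∀ j : ℕ, Measurable fun p : Ω × ℝ => ((2⁻¹ : ℝ≥0∞) ^ j) ^ (-(s : ℝ)) *
      ν {y | ‖S p.1 p.2 - S p.1 y‖ ≤ (2 ^ j)⁻¹} := fun j =>
    (measurable_measure_norm_sub_le hS ν _).const_mul _
  have hbound : ∀ j : ℕ, ∫⁻ ω, ∫⁻ x, ((2⁻¹ : ℝ≥0∞) ^ j) ^ (-(s : ℝ)) *
      ν {y | ‖S ω x - S ω y‖ ≤ (2 ^ j)⁻¹} ∂ν ∂P ≤ ENNReal.ofReal C * I * b ^ j := by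
    intro j
    have h1 := lintegral_measure_norm_sub_le_le (P := P) (τ' := τ') (s := s') (ρ := ((2 : ℝ) ^ j)⁻¹)
      (C := ENNReal.ofReal C) hνK hS fun x hx y hy =>
        hP s' hs'0 hs' x y (hKr x hx y hy) _ (by positivity)
    have hmeas := measurable_measure_norm_sub_le hS ν (((2 : ℝ) ^ j)⁻¹)
    rw [ofReal_two_pow_inv, ← hI] at h1
    have h2 : (2⁻¹ : ℝ≥0∞) ≠ 0 := by simp
    have h2' : (2⁻¹ : ℝ≥0∞) ≠ ⊤ := by simp
    calc _ = ((2⁻¹ : ℝ≥0∞) ^ j) ^ (-(s : ℝ)) * ∫⁻ ω, ∫⁻ x, ν {y | ‖S ω x - S ω y‖ ≤ (2 ^ j)⁻¹} ∂ν ∂P := by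
          rw [← lintegral_const_mul _ hmeas.lintegral_prod_right']
          refine lintegral_congr fun ω => ?_
          exact lintegral_const_mul _ (hmeas.comp (measurable_prodMk_left (x := ω)))
      _ ≤ ((2⁻¹ : ℝ≥0∞) ^ j) ^ (-(s : ℝ)) * (ENNReal.ofReal C * ((2⁻¹ : ℝ≥0∞) ^ j) ^ s' * I) := by gcongr
      _ = (ENNReal.ofReal C * I) * (((2⁻¹ : ℝ≥0∞) ^ j) ^ (-(s : ℝ)) * ((2⁻¹ : ℝ≥0∞) ^ j) ^ s') := by ring
      _ = _ := by
        rw [hb, ← ENNReal.rpow_natCast, ← ENNReal.rpow_natCast, ← ENNReal.rpow_mul, ← ENNReal.rpow_mul,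
          ← ENNReal.rpow_mul, ← ENNReal.rpow_add _ _ h2 h2']
        congr 2
        ring
  have hfin : ∫⁻ ω, ∫⁻ x, ∑' j : ℕ, ((2⁻¹ : ℝ≥0∞) ^ j) ^ (-(s : ℝ)) *
      ν {y | ‖S ω x - S ω y‖ ≤ (2 ^ j)⁻¹} ∂ν ∂P < ⊤ := by
    calc _ = ∑' j : ℕ, ∫⁻ ω, ∫⁻ x, ((2⁻¹ : ℝ≥0∞) ^ j) ^ (-(s : ℝ)) *
          ν {y | ‖S ω x - S ω y‖ ≤ (2 ^ j)⁻¹} ∂ν ∂P := by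
          rw [← lintegral_tsum fun j => (hmeasj j).lintegral_prod_right'.aemeasurable]
          refine lintegral_congr fun ω => ?_
          exact lintegral_tsum fun j => ((hmeasj j).comp (measurable_prodMk_left (x := ω))).aemeasurable
      _ ≤ ∑' j : ℕ, ENNReal.ofReal C * I * b ^ j := ENNReal.tsum_le_tsum hbound
      _ = ENNReal.ofReal C * I * (1 - b)⁻¹ := by rw [ENNReal.tsum_mul_left, ENNReal.tsum_geometric]
      _ < ⊤ := by
        refine ENNReal.mul_lt_top (ENNReal.mul_lt_top ENNReal.ofReal_lt_top hen) ?_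
        rw [ENNReal.inv_lt_top]
        exact tsub_pos_of_lt hb1
  have hmeasT : Measurable fun p : Ω × ℝ => ∑' j : ℕ, ((2⁻¹ : ℝ≥0∞) ^ j) ^ (-(s : ℝ)) *
      ν {y | ‖S p.1 p.2 - S p.1 y‖ ≤ (2 ^ j)⁻¹} := Measurable.tsum hmeasj
  filter_upwards [ae_lt_top hmeasT.lintegral_prod_right' hfin.ne] with ω hω
  have hSm := (hSc ω).measurable
  have : IsProbabilityMeasure (ν.map (S ω)) := Measure.isProbabilityMeasure_map hSm.aemeasurable
  refine (le_dimH_of_lintegral_tsum_closedBall_lt_top (μ := ν.map (S ω))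
    (IsProbabilityMeasure.ne_zero _) (map_compl_image_eq_zero (hSc ω) hK hνK) hs ?_).trans
    (dimH_mono (image_mono hKA))
  rw [lintegral_map (Measurable.tsum fun j => (measurable_measure_closedBall _ _).const_mul _) hSm]
  simp_rw [map_closedBall hSm]
  exact hω

/-- Almost surely the image has positive area as soon as `2τ < dim A`. -/
theorem ae_volume_image_pos (hm : ∀ n, Measurable (θ n)) (hi : iIndepFun θ P)
    (hu : ∀ n, pdf.IsUniform (θ n) (Icc 0 1) P volume) (hφ : BoundedLocallyBiLipschitz φ)
    (ha : Summable fun n => ‖a n‖) (hq : 1 < q) (hτ' : 0 < τ') (hτ : tau a lam q < τ')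
    {A : Set ℝ} (hA : MeasurableSet A) (hdim : ENNReal.ofReal (2 * τ') < dimH A) :
    ∀ᵐ ω ∂P, 0 < volume (series a φ lam (fun n => θ n ω) '' A) := by
  obtain ⟨C, r, -, hr, hP⟩ := exists_measure_increment_le hm hi hu hφ ha hq hτ' hτ
  exact ae_volume_image_pos_of_increment (measurable_series_swap hφ ha hm)
    (fun ω => continuous_series hφ ha _) hr hP hτ' hA hdim

/-- Almost surely `s ≤ dim S(A)` as soon as `s < 2` and `sτ < dim A`. -/
theorem ae_le_dimH_image (hm : ∀ n, Measurable (θ n)) (hi : iIndepFun θ P)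
    (hu : ∀ n, pdf.IsUniform (θ n) (Icc 0 1) P volume) (hφ : BoundedLocallyBiLipschitz φ)
    (ha : Summable fun n => ‖a n‖) (hq : 1 < q) (hτ' : 0 < τ') (hτ : tau a lam q < τ')
    {A : Set ℝ} (hA : MeasurableSet A) {s : ℝ≥0} {s' : ℝ} (hs : 0 < s) (hss' : s < s') (hs' : s' ≤ 2)
    (hdim : ENNReal.ofReal (s' * τ') < dimH A) :
    ∀ᵐ ω ∂P, (s : ℝ≥0∞) ≤ dimH (series a φ lam (fun n => θ n ω) '' A) := by
  obtain ⟨C, r, -, hr, hP⟩ := exists_measure_increment_le hm hi hu hφ ha hq hτ' hτ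
  exact ae_le_dimH_image_of_increment (measurable_series_swap hφ ha hm)
    (fun ω => continuous_series hφ ha _) hr hP hτ' hA hs hss' hs' hdim

end Images

/-! ### Measures on the plane with integrable characteristic function -/

section CharFun

open scoped FourierTransform

/-- Gaussian damping makes Fubini legitimate: the damped inversion integral at `z` is an average of
the measure over a ρ-neighbourhood of `z`. -/
lemma integral_gaussian_mul_charFun {μ : Measure ℂ} [IsProbabilityMeasure μ] {ρ : ℝ} (hρ : 0 < ρ)
    (z : ℂ) :
    ∫ v : ℂ, Complex.exp (-((ρ ^ 2 / 2 : ℝ) : ℂ) * ‖v‖ ^ 2) *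
        (Complex.exp (-(inner ℝ z v : ℝ) * Complex.I) * charFun μ v) =
      ∫ w, ((2 * Real.pi / ρ ^ 2 * Real.exp (-(‖w - z‖ ^ 2 / (2 * ρ ^ 2))) : ℝ) : ℂ) ∂μ := by
  set f : ℂ → ℂ → ℂ := fun w v =>
    Complex.exp (-((ρ ^ 2 / 2 : ℝ) : ℂ) * ‖v‖ ^ 2 + Complex.I * (inner ℝ (w - z) v : ℝ)) with hf
  have hfnorm : ∀ w v, ‖f w v‖ = ‖Complex.exp (-((ρ ^ 2 / 2 : ℝ) : ℂ) * ‖v‖ ^ 2)‖ := by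
    intro w v
    simp only [hf]
    rw [Complex.exp_add, norm_mul, mul_comm Complex.I, Complex.norm_exp_ofReal_mul_I, mul_one]
  have hgauss : Integrable fun v : ℂ => Complex.exp (-((ρ ^ 2 / 2 : ℝ) : ℂ) * ‖v‖ ^ 2) := by
    have hb : 0 < (((ρ ^ 2 / 2 : ℝ) : ℂ)).re := by rw [Complex.ofReal_re]; positivity
    have := GaussianFourier.integrable_cexp_neg_mul_sq_norm_add hb 0 (0 : ℂ)
    simpa using this
  have hfint : Integrable (Function.uncurry f) (μ.prod volume) := by
    refine (hgauss.norm.comp_snd μ).mono' (Measurable.aestronglyMeasurable ?_)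
      (ae_of_all _ fun p => (hfnorm p.1 p.2).le)
    simp only [hf, Function.uncurry_def]
    fun_prop
  have hswap := integral_integral_swap hfint
  have hleft : ∀ w, ∫ v, f w v =
      ((2 * Real.pi / ρ ^ 2 * Real.exp (-(‖w - z‖ ^ 2 / (2 * ρ ^ 2))) : ℝ) : ℂ) := fun w =>
    integral_gaussian_mul_exp_inner hρ (w - z)
  simp_rw [hleft] at hswap
  rw [hswap]
  refine integral_congr_ae (ae_of_all _ fun v => ?_)
  simp only [hf]
  rw [charFun_apply, ← integral_const_mul, ← integral_const_mul]
  refine integral_congr_ae (ae_of_all _ fun w => ?_)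
  simp only
  rw [← Complex.exp_add, ← Complex.exp_add, inner_sub_left]
  congr 1
  push_cast
  ring

/-- As ρ → 0 the damped integrals converge to the inversion integral. The measure does not charge a
ball of some radius d about `z`, so they are also at most 2πρ⁻² exp(−d²/(2ρ²)), which tends to 0. -/
lemma integral_exp_mul_charFun_eq_zero {μ : Measure ℂ} [IsProbabilityMeasure μ] {F : Set ℂ}
    (hF : IsClosed F) (hμ : μ Fᶜ = 0) (hint : Integrable (charFun μ)) {z : ℂ} (hz : z ∉ F) :
    ∫ v : ℂ, Complex.exp (-(inner ℝ z v : ℝ) * Complex.I) * charFun μ v = 0 := by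
  obtain ⟨d, hd, hdF⟩ := Metric.isOpen_iff.1 hF.isOpen_compl z hz
  set ρ : ℕ → ℝ := fun n => 1 / ((n : ℝ) + 1) with hρ
  have hρ0 : ∀ n, 0 < ρ n := fun n => by positivity
  have hρlim : Tendsto ρ atTop (𝓝 0) := tendsto_one_div_add_atTop_nhds_zero_nat
  have hnorm : ∀ v : ℂ, ‖Complex.exp (-(inner ℝ z v : ℝ) * Complex.I) * charFun μ v‖ =
      ‖charFun μ v‖ := fun v => by
    rw [norm_mul, ← Complex.ofReal_neg, Complex.norm_exp_ofReal_mul_I, one_mul]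
  have hmeas : AEStronglyMeasurable
      (fun v : ℂ => Complex.exp (-(inner ℝ z v : ℝ) * Complex.I) * charFun μ v) volume :=
    (Measurable.aestronglyMeasurable (by fun_prop)).mul hint.aestronglyMeasurable
  have hlim1 : Tendsto (fun n => ∫ v : ℂ, Complex.exp (-(((ρ n) ^ 2 / 2 : ℝ) : ℂ) * ‖v‖ ^ 2) *
        (Complex.exp (-(inner ℝ z v : ℝ) * Complex.I) * charFun μ v)) atTop
      (𝓝 (∫ v : ℂ, Complex.exp (-(inner ℝ z v : ℝ) * Complex.I) * charFun μ v)) := by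
    refine tendsto_integral_of_dominated_convergence (fun v => ‖charFun μ v‖) (fun n => ?_)
      hint.norm (fun n => ae_of_all _ fun v => ?_) (ae_of_all _ fun v => ?_)
    · exact (Measurable.aestronglyMeasurable (by fun_prop)).mul hmeas
    · rw [norm_mul, hnorm]
      refine mul_le_of_le_one_left (norm_nonneg _) ?_
      rw [Complex.norm_exp, ← Complex.ofReal_neg, ← Complex.ofReal_pow, ← Complex.ofReal_mul,
        Complex.ofReal_re, Real.exp_le_one_iff]
      have : 0 ≤ (ρ n) ^ 2 / 2 * ‖v‖ ^ 2 := by positivity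
      linarith
    · have h : Tendsto (fun x : ℝ => Complex.exp (-((x ^ 2 / 2 : ℝ) : ℂ) * ‖v‖ ^ 2) *
          (Complex.exp (-(inner ℝ z v : ℝ) * Complex.I) * charFun μ v)) (𝓝 0)
          (𝓝 (Complex.exp (-((0 ^ 2 / 2 : ℝ) : ℂ) * ‖v‖ ^ 2) *
          (Complex.exp (-(inner ℝ z v : ℝ) * Complex.I) * charFun μ v))) :=
        Continuous.tendsto (by fun_prop) 0
      have h' := h.comp hρlim
      simpa [Function.comp_def] using h'
  have hbd : ∀ n, ‖∫ v : ℂ, Complex.exp (-(((ρ n) ^ 2 / 2 : ℝ) : ℂ) * ‖v‖ ^ 2) *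
        (Complex.exp (-(inner ℝ z v : ℝ) * Complex.I) * charFun μ v)‖ ≤
      2 * Real.pi / ρ n ^ 2 * Real.exp (-(d ^ 2 / (2 * ρ n ^ 2))) := by
    intro n
    have hae : ∀ᵐ w ∂μ, w ∈ F := by rwa [ae_iff]
    have hρn := hρ0 n
    rw [integral_gaussian_mul_charFun hρn]
    refine (norm_integral_le_of_norm_le_const (hae.mono fun w hw => ?_)).trans_eq
      (by rw [probReal_univ, mul_one])
    have hwd : d ≤ ‖w - z‖ := by
      by_contra! h
      exact hdF (by rwa [Metric.mem_ball, dist_eq_norm]) hw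
    rw [Complex.norm_real, Real.norm_of_nonneg (by positivity)]
    gcongr
  have hlim2 : Tendsto (fun n => 2 * Real.pi / ρ n ^ 2 * Real.exp (-(d ^ 2 / (2 * ρ n ^ 2)))) atTop
      (𝓝 0) := by
    have h1 : Tendsto (fun n : ℕ => d ^ 2 / 2 * ((n : ℝ) + 1) ^ 2) atTop atTop := by
      refine Tendsto.const_mul_atTop (by positivity) ?_
      exact (tendsto_pow_atTop two_ne_zero).comp (tendsto_natCast_atTop_atTop.atTop_add tendsto_const_nhds)
    have h2 := ((Real.tendsto_pow_mul_exp_neg_atTop_nhds_zero 1).comp h1).const_mul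
      (2 * Real.pi * (2 / d ^ 2))
    rw [mul_zero] at h2
    refine h2.congr fun n => ?_
    simp only [Function.comp_apply, hρ, pow_one]
    rw [show d ^ 2 / (2 * (1 / ((n : ℝ) + 1)) ^ 2) = d ^ 2 / 2 * ((n : ℝ) + 1) ^ 2 by field_simp]
    field_simp
  exact tendsto_nhds_unique hlim1 (squeeze_zero_norm hbd hlim2)

/-- A closed set of full measure for a probability measure on the plane whose characteristic
function is integrable has interior points. -/
theorem interior_nonempty_of_integrable_charFun {μ : Measure ℂ} [IsProbabilityMeasure μ] {F : Set ℂ}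
    (hF : IsClosed F) (hμ : μ Fᶜ = 0) (hint : Integrable (charFun μ)) : (interior F).Nonempty := by
  by_contra hne
  rw [not_nonempty_iff_eq_empty, interior_eq_empty_iff_dense_compl] at hne
  -- Up to a constant, `G` is the density of the measure. It is continuous and vanishes off `F`; if
  -- `F` had no interior, it would vanish identically, and Fourier inversion would give
  -- characteristic function 0, against its value 1 at 0.
  set G : ℂ → ℂ := fun z => ∫ v : ℂ, Complex.exp (-(inner ℝ z v : ℝ) * Complex.I) * charFun μ v with hG
  have hGc : Continuous G := by
    refine continuous_of_dominated (bound := fun v => ‖charFun μ v‖) (fun z => ?_)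
      (fun z => ae_of_all _ fun v => ?_) hint.norm (ae_of_all _ fun v => ?_)
    · exact (Measurable.aestronglyMeasurable (by fun_prop)).mul hint.aestronglyMeasurable
    · rw [norm_mul, ← Complex.ofReal_neg, Complex.norm_exp_ofReal_mul_I, one_mul]
    · fun_prop
  have hG0 : G = 0 := hGc.ext_on hne continuous_const fun z hz =>
    integral_exp_mul_charFun_eq_zero hF hμ hint hz
  have hfour : 𝓕 (charFun μ) = 0 := by
    ext w
    rw [Real.fourier_eq']
    refine Eq.trans ?_ (congrFun hG0 ((2 * Real.pi) • w))
    refine integral_congr_ae (ae_of_all _ fun v => ?_)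
    simp only [smul_eq_mul]
    congr 3
    rw [real_inner_comm, inner_smul_left]
    simp
  have hcont : Continuous (charFun μ) := continuous_charFun
  have hinv := hcont.fourierInv_fourier_eq hint (by rw [hfour]; exact integrable_zero _ _ _)
  have h0 := congrFun hinv 0
  rw [charFun_zero, hfour, Real.fourierInv_eq'] at h0
  simp at h0

end CharFun

/-! ### Interior points of the image -/

section Interior

variable {Ω : Type*} [MeasurableSpace Ω] {P : Measure Ω} [IsProbabilityMeasure P] {θ : ℕ → Ω → ℝ}
  {φ : ℕ → ℝ → ℂ} {a : ℕ → ℂ} {lam : ℕ → ℝ} {q τ' : ℝ}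

/-- The mean square of the characteristic function of a random image of `ν`. -/
lemma lintegral_enorm_integral_sq_le {S : Ω → ℝ → ℂ} (hS : Measurable fun p : Ω × ℝ => S p.1 p.2)
    (ν : Measure ℝ) [IsProbabilityMeasure ν] (ξ : ℂ) :
    ∫⁻ ω, ‖∫ x, Complex.exp ((inner ℝ (S ω x) ξ : ℝ) * Complex.I) ∂ν‖ₑ ^ 2 ∂P ≤
      ∫⁻ x, ∫⁻ y, ‖∫ ω, Complex.exp ((inner ℝ (S ω x - S ω y) ξ : ℝ) * Complex.I) ∂P‖ₑ ∂ν ∂ν := by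
  set e : Ω → ℝ → ℂ := fun ω x => Complex.exp ((inner ℝ (S ω x) ξ : ℝ) * Complex.I) with he
  have hem : Measurable fun p : Ω × ℝ => e p.1 p.2 := by
    simp only [he]
    have : Measurable fun p : Ω × ℝ => (inner ℝ (S p.1 p.2) ξ : ℝ) := hS.inner measurable_const
    fun_prop
  have he1 : ∀ ω x, ‖e ω x‖ = 1 := fun ω x => Complex.norm_exp_ofReal_mul_I _
  set k : Ω → ℝ × ℝ → ℂ := fun ω p => e ω p.1 * (starRingEnd ℂ) (e ω p.2) with hk
  have hkm : Measurable fun p : Ω × (ℝ × ℝ) => k p.1 p.2 := by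
    have h1 : Measurable fun p : Ω × (ℝ × ℝ) => e p.1 p.2.1 :=
      hem.comp (f := fun p : Ω × (ℝ × ℝ) => (p.1, p.2.1)) (by fun_prop)
    have h2 : Measurable fun p : Ω × (ℝ × ℝ) => e p.1 p.2.2 :=
      hem.comp (f := fun p : Ω × (ℝ × ℝ) => (p.1, p.2.2)) (by fun_prop)
    exact h1.mul (Complex.continuous_conj.measurable.comp h2)
  have hk1 : ∀ ω p, ‖k ω p‖ ≤ 1 := fun ω p => by
    simp only [hk, norm_mul, RCLike.norm_conj, he1, mul_one, le_refl]
  have hkint : Integrable (Function.uncurry k) (P.prod (ν.prod ν)) :=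
    Integrable.of_bound hkm.aestronglyMeasurable 1 (ae_of_all _ fun p => hk1 p.1 p.2)
  -- Written as a double integral over ν × ν, the square lets the expectation move inside to the
  -- increments.
  have hsq : ∀ ω, ((‖∫ x, e ω x ∂ν‖ ^ 2 : ℝ) : ℂ) = ∫ p, k ω p ∂(ν.prod ν) := by
    intro ω
    rw [hk, integral_prod_mul (e ω) (fun y => (starRingEnd ℂ) (e ω y)), integral_conj,
      Complex.mul_conj, Complex.normSq_eq_norm_sq]
  have hswap := integral_integral_swap hkint
  simp_rw [← hsq] at hswap
  rw [integral_complex_ofReal] at hswap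
  have hm1 : Measurable fun ω => ‖∫ x, e ω x ∂ν‖ ^ 2 :=
    (hem.stronglyMeasurable.integral_prod_right').measurable.norm.pow_const 2
  have hi1 : Integrable (fun ω => ‖∫ x, e ω x ∂ν‖ ^ 2) P := by
    refine Integrable.of_bound hm1.aestronglyMeasurable 1 (ae_of_all _ fun ω => ?_)
    rw [Real.norm_of_nonneg (by positivity)]
    refine pow_le_one₀ (norm_nonneg _) ?_
    exact (norm_integral_le_of_norm_le_const (ae_of_all _ fun x => (he1 ω x).le)).trans_eq (by simp)
  calc ∫⁻ ω, ‖∫ x, e ω x ∂ν‖ₑ ^ 2 ∂P = ENNReal.ofReal (∫ ω, ‖∫ x, e ω x ∂ν‖ ^ 2 ∂P) := by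
        rw [ofReal_integral_eq_lintegral_ofReal hi1 (ae_of_all _ fun ω => by positivity)]
        refine lintegral_congr fun ω => ?_
        rw [ENNReal.ofReal_pow (norm_nonneg _), ofReal_norm]
    _ ≤ ‖((∫ ω, ‖∫ x, e ω x ∂ν‖ ^ 2 ∂P : ℝ) : ℂ)‖ₑ := by
        rw [← ofReal_norm, Complex.norm_real]
        exact ENNReal.ofReal_le_ofReal (Real.le_norm_self _)
    _ = ‖∫ p, (∫ ω, k ω p ∂P) ∂(ν.prod ν)‖ₑ := by rw [hswap]
    _ ≤ ∫⁻ p, ‖∫ ω, k ω p ∂P‖ₑ ∂(ν.prod ν) := enorm_integral_le_lintegral_enorm _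
    _ = ∫⁻ x, ∫⁻ y, ‖∫ ω, k ω (x, y) ∂P‖ₑ ∂ν ∂ν :=
        lintegral_prod _ (((hkm.comp measurable_swap).stronglyMeasurable.integral_prod_right').measurable.enorm.aemeasurable)
    _ = _ := by
        refine lintegral_congr fun x => lintegral_congr fun y => ?_
        congr 2
        ext ω
        simp only [hk, he]
        rw [← Complex.exp_conj, ← Complex.exp_add, inner_sub_left]
        congr 1
        simp
        ring

/-- With b the modulus of the random characteristic function and u = (1 + |ξ|)^(s/2), one has b ≤
u⁻¹ + u b². The first term is integrable on the plane for s > 4. The second has expectation at most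
a constant times u⁻¹, by the decay of the increments and the finite energy, so b is almost surely
integrable. -/
lemma ae_interior_image_nonempty_of_charFun {S : Ω → ℝ → ℂ}
    (hS : Measurable fun p : Ω × ℝ => S p.1 p.2) (hSc : ∀ ω, Continuous (S ω)) {C r : ℝ} (hC : 0 < C)
    (hr : 0 < r)
    (hP : ∀ x y : ℝ, |x - y| ≤ r → ∀ ξ : ℂ,
      ‖∫ ω, Complex.exp ((inner ℝ (S ω x - S ω y) ξ : ℝ) * Complex.I) ∂P‖ *
        (1 + ‖ξ‖ * |x - y| ^ τ') ^ 6 ≤ C)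
    (hτ' : 0 < τ') {A : Set ℝ} (hA : MeasurableSet A) (hdim : ENNReal.ofReal (4 * τ') < dimH A) :
    ∀ᵐ ω ∂P, (interior (S ω '' A)).Nonempty := by
  -- Above 4 for integrability of (1 + |ξ|)^(−s/2) on the plane; at most 6, the decay exponent
  -- available for the increments.
  obtain ⟨s, hs4, hs6, hsdim⟩ : ∃ s : ℝ, 4 < s ∧ s ≤ 6 ∧ ENNReal.ofReal (s * τ') < dimH A := by
    obtain ⟨t, h1, h2⟩ := ENNReal.lt_iff_exists_nnreal_btwn.1 hdim
    rw [← ENNReal.ofReal_coe_nnreal, ENNReal.ofReal_lt_ofReal_iff_of_nonneg (by positivity)] at h1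
    refine ⟨min 6 (t / τ'), lt_min (by norm_num) ((lt_div_iff₀ hτ').2 h1), min_le_left _ _,
      lt_of_le_of_lt ?_ h2⟩
    rw [← ENNReal.ofReal_coe_nnreal]
    refine ENNReal.ofReal_le_ofReal ?_
    rw [← le_div_iff₀ hτ']
    exact min_le_right _ _
  have hs0 : 0 < s := by linarith
  -- Diameter at most 1 gives D ≤ 1 below, so that (1 + |ξ|) D ≤ 1 + |ξ| D separates the frequency
  -- from the distance.
  obtain ⟨K, ν, hKA, hK, hKr, hν, hνK, hen⟩ :=
    exists_measure_energy_lt_top hA (by positivity : 0 < s * τ') hsdim (lt_min hr one_pos)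
  have hae : ∀ᵐ x ∂ν, x ∈ K := by rwa [ae_iff]
  set I := ∫⁻ x, ∫⁻ y, edist x y ^ (-(s * τ')) ∂ν ∂ν with hI
  have hJ : ∀ ξ : ℂ, ∀ x ∈ K, ∀ y ∈ K,
      ‖∫ ω, Complex.exp ((inner ℝ (S ω x - S ω y) ξ : ℝ) * Complex.I) ∂P‖ₑ ≤
        ENNReal.ofReal (C * (1 + ‖ξ‖) ^ (-s)) * edist x y ^ (-(s * τ')) := by
    intro ξ x hx y hy
    have hξ : 0 < 1 + ‖ξ‖ := by positivity
    rcases eq_or_ne x y with rfl | hne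
    · rw [edist_self, ENNReal.zero_rpow_of_neg (by nlinarith [mul_pos hs0 hτ']), ENNReal.mul_top]
      · exact le_top
      · exact (ENNReal.ofReal_pos.2 (by positivity)).ne'
    have hxy := le_min_iff.1 (hKr x hx y hy)
    have hd : 0 < |x - y| := abs_pos.2 (sub_ne_zero.2 hne)
    set D := |x - y| ^ τ' with hD
    have hD0 : 0 < D := Real.rpow_pos_of_pos hd _
    have hD1 : D ≤ 1 := Real.rpow_le_one hd.le hxy.2 hτ'.le
    have h1 := hP x y hxy.1 ξ
    rw [← hD] at h1
    have h2 : ((1 + ‖ξ‖) * D) ^ s ≤ (1 + ‖ξ‖ * D) ^ 6 := by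
      calc ((1 + ‖ξ‖) * D) ^ s ≤ (1 + ‖ξ‖ * D) ^ s := by
            refine Real.rpow_le_rpow (by positivity) ?_ hs0.le
            nlinarith
        _ ≤ (1 + ‖ξ‖ * D) ^ (6 : ℝ) := by
            refine Real.rpow_le_rpow_of_exponent_le ?_ hs6
            have : 0 ≤ ‖ξ‖ * D := by positivity
            linarith
        _ = _ := by rw [show (6 : ℝ) = ((6 : ℕ) : ℝ) by norm_num, Real.rpow_natCast]
    have h3 := (mul_le_mul_of_nonneg_left h2 (norm_nonneg _)).trans h1
    rw [← le_div_iff₀ (by positivity), Real.mul_rpow hξ.le hD0.le] at h3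
    rw [← ofReal_norm]
    refine (ENNReal.ofReal_le_ofReal h3).trans (le_of_eq ?_)
    rw [edist_dist, Real.dist_eq, ENNReal.ofReal_rpow_of_pos hd, ← ENNReal.ofReal_mul (by positivity),
      Real.rpow_neg hd.le, Real.rpow_neg hξ.le, hD, ← Real.rpow_mul hd.le, mul_comm τ' s]
    congr 1
    field_simp
  set h : Ω → ℂ → ℂ := fun ω ξ => ∫ x, Complex.exp ((inner ℝ (S ω x) ξ : ℝ) * Complex.I) ∂ν with hh
  have hE : ∀ ξ : ℂ, ∫⁻ ω, ‖h ω ξ‖ₑ ^ 2 ∂P ≤ ENNReal.ofReal (C * (1 + ‖ξ‖) ^ (-s)) * I := by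
    intro ξ
    refine (lintegral_enorm_integral_sq_le hS ν ξ).trans ?_
    have hmeas : Measurable fun p : ℝ × ℝ => edist p.1 p.2 ^ (-(s * τ')) :=
      (measurable_fst.edist measurable_snd).pow_const _
    rw [hI, ← lintegral_const_mul _ (Measurable.lintegral_prod_right' hmeas)]
    refine lintegral_mono_ae (hae.mono fun x hx => ?_)
    refine le_trans ?_ (lintegral_const_mul _ (hmeas.comp (measurable_prodMk_left (x := x)))).le
    exact lintegral_mono_ae (hae.mono fun y hy => hJ ξ x hx y hy)
  have hhm : Measurable fun p : Ω × ℂ => h p.1 p.2 := by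
    have hm : Measurable fun p : (Ω × ℂ) × ℝ =>
        Complex.exp ((inner ℝ (S p.1.1 p.2) p.1.2 : ℝ) * Complex.I) := by
      have h1 : Measurable fun p : (Ω × ℂ) × ℝ => S p.1.1 p.2 :=
        hS.comp (measurable_fst.fst.prodMk measurable_snd)
      have h2 : Measurable fun p : (Ω × ℂ) × ℝ => (inner ℝ (S p.1.1 p.2) p.1.2 : ℝ) :=
        h1.inner measurable_fst.snd
      fun_prop
    exact hm.stronglyMeasurable.integral_prod_right'.measurable
  have hwm : Measurable fun ξ : ℂ => ENNReal.ofReal ((1 + ‖ξ‖) ^ (s / 2)) := by fun_prop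
  have hint : Integrable fun ξ : ℂ => (1 + ‖ξ‖) ^ (-(s / 2)) :=
    integrable_one_add_norm (by rw [Complex.finrank_real_complex]; push_cast; linarith)
  have hgm : Measurable fun p : Ω × ℂ => ENNReal.ofReal ((1 + ‖p.2‖) ^ (s / 2)) * ‖h p.1 p.2‖ₑ ^ 2 :=
    (hwm.comp measurable_snd).mul (hhm.enorm.pow_const 2)
  have hfin : ∫⁻ ω, (∫⁻ ξ : ℂ, ENNReal.ofReal ((1 + ‖ξ‖) ^ (s / 2)) * ‖h ω ξ‖ₑ ^ 2) ∂P < ⊤ := by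
    rw [lintegral_lintegral_swap hgm.aemeasurable]
    calc _ ≤ ∫⁻ ξ : ℂ, ENNReal.ofReal C * I * ENNReal.ofReal ((1 + ‖ξ‖) ^ (-(s / 2))) := by
          refine lintegral_mono fun ξ => ?_
          have hξ : 0 < 1 + ‖ξ‖ := by positivity
          have hm1 : Measurable fun ω => ‖h ω ξ‖ₑ ^ 2 :=
            (hhm.enorm.pow_const 2).comp (f := fun ω => (ω, ξ)) (by fun_prop)
          refine (lintegral_const_mul _ hm1).le.trans ((mul_le_mul_right (hE ξ) _).trans (le_of_eq ?_))
          rw [ENNReal.ofReal_mul hC.le]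
          calc _ = ENNReal.ofReal C * I * (ENNReal.ofReal ((1 + ‖ξ‖) ^ (s / 2)) *
                ENNReal.ofReal ((1 + ‖ξ‖) ^ (-s))) := by ring
            _ = _ := by
              rw [← ENNReal.ofReal_mul (by positivity), ← Real.rpow_add hξ]
              congr 3
              ring
      _ = ENNReal.ofReal C * I * ∫⁻ ξ : ℂ, ENNReal.ofReal ((1 + ‖ξ‖) ^ (-(s / 2))) :=
          lintegral_const_mul _ (by fun_prop)
      _ < ⊤ := ENNReal.mul_lt_top (ENNReal.mul_lt_top ENNReal.ofReal_lt_top hen)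
          hint.lintegral_lt_top
  filter_upwards [ae_lt_top hgm.lintegral_prod_right' hfin.ne] with ω hω
  have hSm := (hSc ω).measurable
  have : IsProbabilityMeasure (ν.map (S ω)) := Measure.isProbabilityMeasure_map hSm.aemeasurable
  have hchar : charFun (ν.map (S ω)) = h ω := by
    ext ξ
    rw [charFun_apply, integral_map hSm.aemeasurable (Measurable.aestronglyMeasurable (by fun_prop))]
  refine (interior_nonempty_of_integrable_charFun (hK.image (hSc ω)).isClosed
    (map_compl_image_eq_zero (hSc ω) hK hνK) ?_).mono (interior_mono (image_mono hKA))
  rw [hchar]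
  have hhω : Measurable (h ω) := hhm.comp measurable_prodMk_left
  refine ⟨hhω.aestronglyMeasurable, ?_⟩
  have hpt : ∀ ξ, ‖h ω ξ‖ₑ ≤ ENNReal.ofReal ((1 + ‖ξ‖) ^ (-(s / 2))) +
      ENNReal.ofReal ((1 + ‖ξ‖) ^ (s / 2)) * ‖h ω ξ‖ₑ ^ 2 := by
    intro ξ
    have hξ : 0 < 1 + ‖ξ‖ := by positivity
    rw [← ofReal_norm, ← ENNReal.ofReal_pow (norm_nonneg _), ← ENNReal.ofReal_mul (by positivity),
      ← ENNReal.ofReal_add (by positivity) (by positivity)]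
    refine ENNReal.ofReal_le_ofReal ?_
    rw [Real.rpow_neg hξ.le]
    set u := (1 + ‖ξ‖) ^ (s / 2) with hu
    have hu0 : 0 < u := Real.rpow_pos_of_pos hξ _
    set b := ‖h ω ξ‖
    have hb : 0 ≤ b := norm_nonneg _
    have : u⁻¹ + u * b ^ 2 - b = u⁻¹ * ((u * b - 1 / 2) ^ 2 + 3 / 4) := by field_simp; ring
    have h2 : 0 ≤ u⁻¹ * ((u * b - 1 / 2) ^ 2 + 3 / 4) := by positivity
    linarith
  refine lt_of_le_of_lt (lintegral_mono hpt) ?_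
  rw [lintegral_add_left (by fun_prop)]
  exact ENNReal.add_lt_top.2 ⟨hint.lintegral_lt_top, hω⟩

/-- Almost surely the image has interior points as soon as `4τ < dim A`. -/
theorem ae_interior_image_nonempty (hm : ∀ n, Measurable (θ n)) (hi : iIndepFun θ P)
    (hu : ∀ n, pdf.IsUniform (θ n) (Icc 0 1) P volume) (hφ : BoundedLocallyBiLipschitz φ)
    (ha : Summable fun n => ‖a n‖) (hq : 1 < q) (hτ' : 0 < τ') (hτ : tau a lam q < τ')
    {A : Set ℝ} (hA : MeasurableSet A) (hdim : ENNReal.ofReal (4 * τ') < dimH A) :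
    ∀ᵐ ω ∂P, (interior (series a φ lam (fun n => θ n ω) '' A)).Nonempty := by
  obtain ⟨C, r, hC, hr, hP⟩ := exists_norm_integral_increment_le hm hi hu hφ ha hq hτ' hτ
  exact ae_interior_image_nonempty_of_charFun (measurable_series_swap hφ ha hm)
    (fun ω => continuous_series hφ ha _) hC hr hP hτ' hA hdim

end Interior

/-! ### Upper bound for the dimension of the image -/

section Variance

variable {φ : ℕ → ℝ → ℂ} {a : ℕ → ℂ} {lam : ℕ → ℝ} {q g γ : ℝ}

lemma eventually_blockSize_le (hq : 1 < q) (hγ : (γ : EReal) < sigma a lam q) :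
    ∀ᶠ k : ℕ in atTop, blockSize a lam q k ≤ (q ^ k) ^ (-γ) := by
  have hq0 : 0 < q := by linarith
  filter_upwards [eventually_lt_of_lt_liminf hγ, eventually_ge_atTop 1] with k hk hk1
  have hlog : 0 < k * Real.log q := mul_pos (by exact_mod_cast hk1) (Real.log_pos hq)
  rw [blockExponent, EReal.lt_div_iff (by exact_mod_cast hlog) (EReal.coe_ne_top _),
    ← EReal.coe_mul, EReal.lt_neg_comm, ← EReal.coe_neg, ENNReal.log_ofReal] at hk
  split_ifs at hk with h0
  · exact h0.trans (Real.rpow_nonneg (pow_pos hq0 k).le _)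
  rw [EReal.coe_lt_coe_iff, Real.log_lt_iff_lt_exp (not_le.1 h0)] at hk
  refine hk.le.trans (le_of_eq ?_)
  rw [Real.rpow_def_of_pos (pow_pos hq0 k), Real.log_pow]
  congr 1
  ring

/-- Summation by blocks: since λ_n ≥ 1 every index lies in a block, and block k contributes at most
q^(2g(k+1)) s_k², eventually dominated by a geometric sequence of ratio q^(2g−2γ) < 1. -/
lemma summable_norm_sq_mul_rpow (hq : 1 < q) (ha : Summable fun n => ‖a n‖) (hlam : ∀ n, 1 ≤ lam n)
    (hg : 0 < g) (hgγ : g < γ) (hγ : (γ : EReal) < sigma a lam q) :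
    Summable fun n => ‖a n‖ ^ 2 * lam n ^ (2 * g) := by
  have hq0 : 0 < q := by linarith
  have ha2 : Summable fun n => ‖a n‖ ^ 2 := by
    refine Summable.of_nonneg_of_le (fun _ => by positivity) (fun n => ?_)
      (ha.mul_left (∑' n, ‖a n‖))
    rw [pow_two]
    exact mul_le_mul_of_nonneg_right (ha.le_tsum n fun _ _ => norm_nonneg _) (norm_nonneg _)
  set B : ℕ → Set ℕ := fun k => {n | q ^ k ≤ lam n ∧ lam n < q ^ (k + 1)} with hB
  have hBmem : ∀ k n, n ∈ B k ↔ q ^ k ≤ lam n ∧ lam n < q ^ (k + 1) := fun _ _ => Iff.rfl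
  have hsq : ∀ k, ∑' n : B k, ‖a n‖ ^ 2 = blockSize a lam q k ^ 2 := fun k =>
    (Real.sq_sqrt (tsum_nonneg fun _ => by positivity)).symm
  have hsum : Summable fun k : ℕ => (q ^ (k + 1)) ^ (2 * g) * blockSize a lam q k ^ 2 := by
    have hr : q ^ (2 * g - 2 * γ) < 1 := Real.rpow_lt_one_of_one_lt_of_neg hq (by linarith)
    refine Summable.of_norm_bounded_eventually_nat (g := fun k : ℕ => q ^ (2 * g) * (q ^ (2 * g - 2 * γ)) ^ k)
      ((summable_geometric_of_lt_one (Real.rpow_nonneg hq0.le _) hr).mul_left _) ?_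
    filter_upwards [eventually_blockSize_le hq hγ] with k hk
    rw [Real.norm_of_nonneg (by positivity)]
    have h0 : 0 ≤ blockSize a lam q k := Real.sqrt_nonneg _
    calc (q ^ (k + 1)) ^ (2 * g) * blockSize a lam q k ^ 2
        ≤ (q ^ (k + 1)) ^ (2 * g) * ((q ^ k) ^ (-γ)) ^ 2 := by gcongr
      _ = q ^ (2 * g) * (q ^ (2 * g - 2 * γ)) ^ k := by
        rw [← Real.rpow_natCast q (k + 1), ← Real.rpow_natCast q k, ← Real.rpow_mul hq0.le,
          ← Real.rpow_mul hq0.le, ← Real.rpow_natCast _ 2, ← Real.rpow_mul hq0.le,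
          ← Real.rpow_natCast _ k, ← Real.rpow_mul hq0.le, ← Real.rpow_add hq0, ← Real.rpow_add hq0]
        congr 1
        push_cast
        ring
  have hle : ∑' n, ENNReal.ofReal (‖a n‖ ^ 2 * lam n ^ (2 * g)) ≤
      ∑' k : ℕ, ENNReal.ofReal ((q ^ (k + 1)) ^ (2 * g) * blockSize a lam q k ^ 2) := by
    calc _ ≤ ∑' n, ∑' k, (B k).indicator (fun n => ENNReal.ofReal (‖a n‖ ^ 2 * lam n ^ (2 * g))) n := by
          refine ENNReal.tsum_le_tsum fun n => ?_
          obtain ⟨k, hk⟩ := exists_nat_pow_near (hlam n) hq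
          refine le_trans ?_ (ENNReal.le_tsum k)
          rw [indicator_of_mem ((hBmem k n).2 hk)]
      _ = ∑' k, ∑' n : B k, ENNReal.ofReal (‖a n‖ ^ 2 * lam n ^ (2 * g)) := by
          rw [ENNReal.tsum_comm]
          exact tsum_congr fun k => (tsum_subtype _ _).symm
      _ ≤ ∑' k, ∑' n : B k, ENNReal.ofReal ((q ^ (k + 1)) ^ (2 * g)) * ENNReal.ofReal (‖a n‖ ^ 2) := by
          refine ENNReal.tsum_le_tsum fun k => ENNReal.tsum_le_tsum fun n => ?_
          rw [← ENNReal.ofReal_mul (by positivity), mul_comm]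
          refine ENNReal.ofReal_le_ofReal ?_
          have h1 := ((hBmem k n).1 n.2).2.le
          have h2 : 0 ≤ lam n := zero_le_one.trans (hlam n)
          gcongr
      _ = _ := by
          refine tsum_congr fun k => ?_
          rw [ENNReal.tsum_mul_left, ENNReal.ofReal_mul (by positivity), ← hsq,
            ENNReal.ofReal_tsum_of_nonneg (f := fun n : B k => ‖a n‖ ^ 2) (fun _ => by positivity)
              (ha2.subtype _)]
  have hfin := (lt_of_le_of_lt hle hsum.tsum_ofReal_lt_top).ne
  refine (ENNReal.summable_toReal hfin).congr fun n => ?_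
  have := zero_le_one.trans (hlam n)
  exact ENNReal.toReal_ofReal (by positivity)

/-- Lipschitz continuity below the scale δ and boundedness above it interpolate to a global Hölder
bound for exponents up to 1. The restriction `g ≤ 1` is the source of min(σ, 1) in the upper bound.
-/
lemma BoundedLocallyBiLipschitz.exists_norm_sub_le_rpow (hφ : BoundedLocallyBiLipschitz φ)
    (hg : 0 < g) (hg1 : g ≤ 1) :
    ∃ C : ℝ, 0 < C ∧ ∀ n x y, ‖φ n x - φ n y‖ ≤ C * |x - y| ^ g := by
  obtain ⟨⟨M, hM⟩, L, δ, hL, hδ, hbi⟩ := hφ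
  have hM0 : 0 ≤ M := (norm_nonneg _).trans (hM 0 0)
  refine ⟨(L * δ + 2 * M) * (δ ^ g)⁻¹, by positivity, fun n x y => ?_⟩
  rw [mul_assoc, inv_mul_eq_div, ← Real.div_rpow (abs_nonneg _) hδ.le]
  set u := |x - y| / δ with hu
  have hu0 : 0 ≤ u := by positivity
  have hug : 0 ≤ u ^ g := Real.rpow_nonneg hu0 _
  rcases le_total |x - y| δ with h | h
  · have hu1 : u ≤ 1 := (div_le_one hδ).2 h
    calc ‖φ n x - φ n y‖ ≤ L * |x - y| := (hbi n x y h).2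
      _ = L * δ * u := by rw [hu]; field_simp
      _ ≤ L * δ * u ^ g := by
        gcongr
        rcases hu0.eq_or_lt with h0 | h0
        · rw [← h0]
          exact Real.rpow_nonneg le_rfl _
        · simpa using Real.rpow_le_rpow_of_exponent_ge h0 hu1 hg1
      _ ≤ (L * δ + 2 * M) * u ^ g := by gcongr; linarith
  · have hu1 : 1 ≤ u ^ g := Real.one_le_rpow ((one_le_div hδ).2 h) hg.le
    calc ‖φ n x - φ n y‖ ≤ M + M := (norm_sub_le _ _).trans (add_le_add (hM n x) (hM n y))
      _ ≤ (L * δ + 2 * M) * 1 := by nlinarith [mul_pos (by linarith : 0 < L) hδ]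
      _ ≤ _ := by gcongr

/-- The variance of an increment of S: the Hölder bound gives each term a factor (λ_n |x − y|)^(2g),
and the weighted sum of |a_n|² λ_n^(2g) converges. -/
lemma exists_sum_norm_sq_increment_le (hφ : BoundedLocallyBiLipschitz φ) (hq : 1 < q)
    (ha : Summable fun n => ‖a n‖) (hlam : ∀ n, 1 ≤ lam n) (hg : 0 < g) (hg1 : g ≤ 1)
    (hgγ : g < γ) (hγ : (γ : EReal) < sigma a lam q) :
    ∃ C : ℝ, 0 < C ∧ ∀ x y (s : Finset ℕ),
      ∑ n ∈ s, ‖a n * (φ n (lam n * x) - φ n (lam n * y))‖ ^ 2 ≤ C * |x - y| ^ (2 * g) := by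
  have hsum := summable_norm_sq_mul_rpow hq ha hlam hg hgγ hγ
  obtain ⟨C, hC, hb⟩ := hφ.exists_norm_sub_le_rpow hg hg1
  have hnn : ∀ n, 0 ≤ ‖a n‖ ^ 2 * lam n ^ (2 * g) := fun n => by
    have := zero_le_one.trans (hlam n)
    positivity
  have hT : 0 ≤ ∑' n, ‖a n‖ ^ 2 * lam n ^ (2 * g) := tsum_nonneg hnn
  refine ⟨C ^ 2 * (∑' n, ‖a n‖ ^ 2 * lam n ^ (2 * g) + 1), mul_pos (by positivity) (by linarith), fun x y s => ?_⟩
  have hpt : ∀ n, ‖a n * (φ n (lam n * x) - φ n (lam n * y))‖ ^ 2 ≤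
      C ^ 2 * |x - y| ^ (2 * g) * (‖a n‖ ^ 2 * lam n ^ (2 * g)) := by
    intro n
    have hl := zero_le_one.trans (hlam n)
    have h1 := hb n (lam n * x) (lam n * y)
    rw [← mul_sub, abs_mul, abs_of_nonneg hl] at h1
    have h2 : ((lam n * |x - y|) ^ g) ^ 2 = lam n ^ (2 * g) * |x - y| ^ (2 * g) := by
      rw [← Real.rpow_natCast _ 2, ← Real.rpow_mul (by positivity), Real.mul_rpow hl (abs_nonneg _)]
      congr 2 <;> push_cast <;> ring
    calc _ = ‖a n‖ ^ 2 * ‖φ n (lam n * x) - φ n (lam n * y)‖ ^ 2 := by rw [norm_mul, mul_pow]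
      _ ≤ ‖a n‖ ^ 2 * (C * (lam n * |x - y|) ^ g) ^ 2 := by gcongr
      _ = _ := by rw [mul_pow, h2]; ring
  calc _ ≤ ∑ n ∈ s, C ^ 2 * |x - y| ^ (2 * g) * (‖a n‖ ^ 2 * lam n ^ (2 * g)) :=
        Finset.sum_le_sum fun n _ => hpt n
    _ = C ^ 2 * |x - y| ^ (2 * g) * ∑ n ∈ s, ‖a n‖ ^ 2 * lam n ^ (2 * g) := by rw [Finset.mul_sum]
    _ ≤ C ^ 2 * |x - y| ^ (2 * g) * (∑' n, ‖a n‖ ^ 2 * lam n ^ (2 * g) + 1) := by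
        gcongr
        linarith [hsum.sum_le_tsum s fun n _ => hnn n]
    _ = _ := by ring

end Variance

/-! ### Subgaussian tails of the increments -/

section Tail

variable {Ω : Type*} [MeasurableSpace Ω] {P : Measure Ω} [IsProbabilityMeasure P] {θ : ℕ → Ω → ℝ}

lemma integral_circlePoint : ∫ u in (0 : ℝ)..1, circlePoint u = 0 := by
  have h : (2 * Real.pi * Complex.I : ℂ) ≠ 0 := Complex.two_pi_I_ne_zero
  simp only [circlePoint]
  rw [integral_exp_mul_complex h]
  simp [Complex.exp_two_pi_mul_I]

/-- Hoeffding's lemma: the variable is centred, since the circle has mean 0, and takes values in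
[−|b|, |b|]. -/
lemma hasSubgaussianMGF_re_mul_circlePoint {X : Ω → ℝ} (hX : Measurable X)
    (hu : pdf.IsUniform X (Icc 0 1) P volume) (b : ℂ) :
    HasSubgaussianMGF (fun ω => (b * circlePoint (X ω)).re) (‖b‖₊ ^ 2) P := by
  have hc : Measurable fun ω => b * circlePoint (X ω) :=
    (continuous_circlePoint.measurable.comp hX).const_mul b
  have hn : ∀ ω, ‖b * circlePoint (X ω)‖ ≤ ‖b‖ := fun ω => by rw [norm_mul, norm_circlePoint, mul_one]
  have hint : Integrable (fun ω => b * circlePoint (X ω)) P :=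
    Integrable.of_bound hc.aestronglyMeasurable _ (ae_of_all _ hn)
  have h0 : ∫ ω, b * circlePoint (X ω) ∂P = 0 := by
    rw [integral_const_mul, integral_comp_of_isUniform hX hu continuous_circlePoint,
      integral_circlePoint, mul_zero]
  have hre : ∫ ω, (b * circlePoint (X ω)).re ∂P = 0 := by
    have := integral_re (𝕜 := ℂ) hint
    rw [h0] at this
    simpa using this
  have h := hasSubgaussianMGF_of_mem_Icc_of_integral_eq_zero (a := -‖b‖) (b := ‖b‖)
    (Complex.measurable_re.comp hc).aemeasurable
    (ae_of_all P fun ω => abs_le.1 ((Complex.abs_re_le_norm _).trans (hn ω))) hre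
  have hc : (‖‖b‖ - -‖b‖‖₊ / 2) ^ 2 = ‖b‖₊ ^ 2 := by
    rw [← NNReal.coe_inj]
    push_cast
    rw [Real.norm_of_nonneg (by linarith [norm_nonneg b])]
    ring
  rwa [hc] at h

lemma measureReal_le_re_tsum_le (hm : ∀ n, Measurable (θ n)) (hi : iIndepFun θ P)
    (hu : ∀ n, pdf.IsUniform (θ n) (Icc 0 1) P volume) {b : ℕ → ℂ} (hb : Summable fun n => ‖b n‖)
    {V : ℝ} (hV : ∀ s : Finset ℕ, ∑ n ∈ s, ‖b n‖ ^ 2 ≤ V) {η : ℝ} (hη : 0 < η) :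
    P.real {ω | η ≤ (∑' n, b n * circlePoint (θ n ω)).re} ≤ Real.exp (-η ^ 2 / (8 * V)) := by
  have hV0 : 0 ≤ V := by simpa using hV ∅
  -- Absolute summability bounds the tail of the series by η/2 for every `ω`. The finite part must
  -- then reach η/2, which turns the exponent η²/(2V) into η²/(8V).
  obtain ⟨s, hs⟩ : ∃ s : Finset ℕ, ∑' n, ‖b n‖ - ∑ n ∈ s, ‖b n‖ < η / 2 := by
    have h := hb.hasSum.eventually (lt_mem_nhds (sub_lt_self (∑' n, ‖b n‖) (half_pos hη)))
    obtain ⟨s, hs⟩ := h.exists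
    exact ⟨s, by linarith⟩
  have hsub : ∀ ω, (∑' n, b n * circlePoint (θ n ω)).re - ∑ n ∈ s, (b n * circlePoint (θ n ω)).re ≤ η / 2 := by
    intro ω
    have hn : (fun n => ‖b n * circlePoint (θ n ω)‖) = fun n => ‖b n‖ := by
      ext n
      rw [norm_mul, norm_circlePoint, mul_one]
    have hsum : Summable fun n => ‖b n * circlePoint (θ n ω)‖ := by rwa [hn]
    have hsplit := hsum.of_norm.sum_add_tsum_compl (s := s)
    have hsplit' := hb.sum_add_tsum_compl (s := s)
    have h1 : ‖∑' n : ↑(↑s : Set ℕ)ᶜ, b n * circlePoint (θ n ω)‖ ≤ ∑' n : ↑(↑s : Set ℕ)ᶜ, ‖b n‖ := by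
      refine (norm_tsum_le_tsum_norm (hsum.subtype _)).trans_eq (tsum_congr fun n => ?_)
      exact congrFun hn n
    rw [← hsplit, ← Complex.re_sum, Complex.add_re, add_sub_cancel_left]
    refine (Complex.re_le_norm _).trans (h1.trans ?_)
    linarith
  have hind : iIndepFun (fun n ω => (b n * circlePoint (θ n ω)).re) P :=
    hi.comp (fun n u => (b n * circlePoint u).re) fun n =>
      Complex.measurable_re.comp (continuous_circlePoint.measurable.const_mul (b n))
  have hsg := HasSubgaussianMGF.sum_of_iIndepFun hind (s := s) fun n _ =>
    hasSubgaussianMGF_re_mul_circlePoint (hm n) (hu n) (b n)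
  have hsgV : HasSubgaussianMGF (fun ω => ∑ n ∈ s, (b n * circlePoint (θ n ω)).re) V.toNNReal P := by
    refine ⟨hsg.integrable_exp_mul, fun t => (hsg.mgf_le t).trans (Real.exp_le_exp.2 ?_)⟩
    have := hV s
    rw [Real.coe_toNNReal _ hV0]
    push_cast
    gcongr
  have h := hsgV.measure_ge_le (half_pos hη).le
  refine (measureReal_mono fun ω hω => ?_).trans (h.trans (le_of_eq ?_))
  · have hω : η ≤ (∑' n, b n * circlePoint (θ n ω)).re := hω
    change η / 2 ≤ _
    linarith [hsub ω]
  · congr 1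
    rw [Real.coe_toNNReal _ hV0]
    -- For `V = 0` division by zero makes both exponents 0, and the bound is the trivial 1.
    rcases eq_or_ne V 0 with h0 | h0
    · simp [h0]
    · field_simp
      norm_num

/-- Subgaussian tails of a Steinhaus sum. -/
lemma measure_le_norm_tsum_le (hm : ∀ n, Measurable (θ n)) (hi : iIndepFun θ P)
    (hu : ∀ n, pdf.IsUniform (θ n) (Icc 0 1) P volume) {b : ℕ → ℂ} (hb : Summable fun n => ‖b n‖)
    {V : ℝ} (hV : ∀ s : Finset ℕ, ∑ n ∈ s, ‖b n‖ ^ 2 ≤ V) {η : ℝ} (hη : 0 < η) :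
    P {ω | η ≤ ‖∑' n, b n * circlePoint (θ n ω)‖} ≤
      ENNReal.ofReal (4 * Real.exp (-η ^ 2 / (32 * V))) := by
  set Z : Ω → ℂ := fun ω => ∑' n, b n * circlePoint (θ n ω) with hZ
  have key : ∀ w : ℂ, ‖w‖ = 1 → P {ω | η / 2 ≤ (w * Z ω).re} ≤
      ENNReal.ofReal (Real.exp (-η ^ 2 / (32 * V))) := by
    intro w hw
    have hn : ∀ n, ‖w * b n‖ = ‖b n‖ := fun n => by rw [norm_mul, hw, one_mul]
    have h := measureReal_le_re_tsum_le hm hi hu (b := fun n => w * b n) (V := V)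
      (by simpa only [hn] using hb) (by simpa only [hn] using hV) (half_pos hη)
    rw [← ofReal_measureReal]
    refine ENNReal.ofReal_le_ofReal (le_trans (le_of_eq ?_) (h.trans (le_of_eq ?_)))
    · simp only [hZ, ← tsum_mul_left, mul_assoc]
    · congr 1
      rcases eq_or_ne V 0 with h0 | h0
      · simp [h0]
      · field_simp
        norm_num
  -- If |Z| ≥ η, then the real or the imaginary part has modulus at least η/2. The four directions
  -- give the factor 4, and the second halving of η turns 8 into 32.
  have hsub : {ω | η ≤ ‖Z ω‖} ⊆ ({ω | η / 2 ≤ (1 * Z ω).re} ∪ {ω | η / 2 ≤ (-1 * Z ω).re}) ∪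
      ({ω | η / 2 ≤ (Complex.I * Z ω).re} ∪ {ω | η / 2 ≤ (-Complex.I * Z ω).re}) := by
    intro ω hω
    have hω : η ≤ ‖Z ω‖ := hω
    simp only [mem_union, mem_ofPred_eq]
    by_contra! h
    obtain ⟨⟨h1, h2⟩, h3, h4⟩ := h
    have hre : |(Z ω).re| < η / 2 := abs_lt.2 ⟨by simp at h2; linarith, by simpa using h1⟩
    have him : |(Z ω).im| < η / 2 := abs_lt.2 ⟨by simp at h3; linarith, by simpa using h4⟩
    linarith [Complex.norm_le_abs_re_add_abs_im (Z ω)]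
  set E := Real.exp (-η ^ 2 / (32 * V)) with hE
  have hE0 : 0 ≤ E := (Real.exp_pos _).le
  calc P {ω | η ≤ ‖Z ω‖} ≤ _ := measure_mono hsub
    _ ≤ (ENNReal.ofReal E + ENNReal.ofReal E) + (ENNReal.ofReal E + ENNReal.ofReal E) :=
      (measure_union_le _ _).trans (add_le_add
        ((measure_union_le _ _).trans (add_le_add (key _ (by simp)) (key _ (by simp))))
        ((measure_union_le _ _).trans (add_le_add (key _ (by simp)) (key _ (by simp)))))
    _ = ENNReal.ofReal (4 * E) := by
      rw [← ENNReal.ofReal_add hE0 hE0, ← ENNReal.ofReal_add (by positivity) (by positivity)]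
      congr 1
      ring

end Tail

/-! ### Chaining along dyadic points -/

section Chaining

lemma abs_floor_mul_le {x R : ℝ} {c : ℝ} (hc : 0 < c) (hR : ∃ m : ℤ, (m : ℝ) = R * c) (hx : |x| ≤ R) :
    |(⌊x * c⌋ : ℝ)| ≤ R * c := by
  obtain ⟨m, hm⟩ := hR
  have hx' := abs_le.1 hx
  rw [abs_le, ← hm]
  constructor
  · have : -m ≤ ⌊x * c⌋ := Int.le_floor.2 (by push_cast; rw [hm]; nlinarith)
    exact_mod_cast this
  · refine (Int.floor_le _).trans ?_
    rw [hm]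
    nlinarith

/-- Telescoping along the dyadic approximations of `x` from below: consecutive ones coincide or are
neighbours on the finer grid, so the steps are dominated by a geometric series. -/
lemma norm_sub_floor_le {f : ℝ → ℂ} (hf : Continuous f) {α : ℝ} (hα : 0 < α) {R N₀ : ℕ}
    (h : ∀ N, N₀ ≤ N → ∀ j : ℤ, |(j : ℝ)| ≤ R * 2 ^ N →
      ‖f ((j + 1) / 2 ^ N) - f (j / 2 ^ N)‖ ≤ ((2 : ℝ) ^ (-α)) ^ N)
    {x : ℝ} (hx : |x| ≤ R) {n : ℕ} (hn : N₀ ≤ n) :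
    ‖f (⌊x * 2 ^ n⌋ / 2 ^ n) - f x‖ ≤ ((2 : ℝ) ^ (-α)) ^ n / (1 - 2 ^ (-α)) := by
  set b : ℝ := 2 ^ (-α) with hb
  have hb0 : 0 < b := by positivity
  have hb1 : b < 1 := Real.rpow_lt_one_of_one_lt_of_neg one_lt_two (by linarith)
  have hRm : ∀ m : ℕ, ∃ k : ℤ, (k : ℝ) = R * 2 ^ m := fun m => ⟨R * 2 ^ m, by push_cast; ring⟩
  have hstep : ∀ m, N₀ ≤ m →
      dist (f (⌊x * 2 ^ m⌋ / 2 ^ m)) (f (⌊x * 2 ^ (m + 1)⌋ / 2 ^ (m + 1))) ≤ b ^ (m + 1) := by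
    intro m hm
    set j := ⌊x * 2 ^ m⌋ with hj
    have h1 : (j : ℝ) / 2 ^ m = ((2 * j : ℤ) : ℝ) / 2 ^ (m + 1) := by
      push_cast
      rw [pow_succ]
      field_simp
    have h2 : ⌊x * 2 ^ (m + 1)⌋ = 2 * j ∨ ⌊x * 2 ^ (m + 1)⌋ = 2 * j + 1 := by
      have hl : 2 * j ≤ ⌊x * 2 ^ (m + 1)⌋ := Int.le_floor.2 (by
        push_cast
        rw [pow_succ]
        linarith [Int.floor_le (x * 2 ^ m)])
      have hu : ⌊x * 2 ^ (m + 1)⌋ < 2 * j + 2 := Int.floor_lt.2 (by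
        push_cast
        rw [pow_succ]
        linarith [Int.lt_floor_add_one (x * 2 ^ m)])
      omega
    rw [h1]
    rcases h2 with h2 | h2
    · rw [h2, dist_self]
      positivity
    · rw [h2, dist_comm, dist_eq_norm]
      have := h (m + 1) (by omega) (2 * j) (by
        have := abs_floor_mul_le (c := 2 ^ m) (by positivity) (hRm m) hx
        push_cast
        rw [abs_mul, abs_two, pow_succ]
        linarith)
      push_cast at this ⊢
      exact this
  have hlim : Tendsto (fun m : ℕ => f (⌊x * 2 ^ (n + m)⌋ / 2 ^ (n + m))) atTop (𝓝 (f x)) := by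
    refine (hf.tendsto x).comp (tendsto_iff_dist_tendsto_zero.2 ?_)
    have h0 : Tendsto (fun m : ℕ => (2⁻¹ : ℝ) ^ m) atTop (𝓝 0) :=
      tendsto_pow_atTop_nhds_zero_of_lt_one (by norm_num) (by norm_num)
    refine squeeze_zero (fun _ => dist_nonneg) (fun m => ?_) h0
    have hp : (0 : ℝ) < 2 ^ (n + m) := by positivity
    have h1 := Int.floor_le (x * 2 ^ (n + m))
    have h2 := Int.lt_floor_add_one (x * 2 ^ (n + m))
    have h3 : (1 : ℝ) / 2 ^ (n + m) ≤ 2⁻¹ ^ m := by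
      rw [one_div, inv_pow]
      exact inv_anti₀ (by positivity) (pow_le_pow_right₀ one_le_two (by omega))
    refine le_trans ?_ h3
    rw [Real.dist_eq, le_div_iff₀ hp, ← abs_of_pos hp, ← abs_mul, abs_of_pos hp, sub_mul,
      div_mul_cancel₀ _ hp.ne', abs_le]
    constructor <;> linarith
  have := dist_le_of_le_geometric_of_tendsto₀ b (b ^ n) hb1 (fun m => ?_) hlim
  · simpa [dist_eq_norm] using this
  · refine (hstep (n + m) (by omega)).trans ?_
    rw [← pow_add]
    exact pow_le_pow_of_le_one hb0.le hb1.le (by omega)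

/-- At the level n with 2^(−n−1) < |x − y| ≤ 2⁻ⁿ the left endpoints for `x` and `y` coincide or are
adjacent. The path from `x` to its endpoint, across, and on to `y` has length of order 2^(−αn),
comparable with |x − y|^α. -/
lemma norm_sub_le_of_dyadic {f : ℝ → ℂ} (hf : Continuous f) {α : ℝ} (hα : 0 < α) {R N₀ : ℕ}
    (h : ∀ N, N₀ ≤ N → ∀ j : ℤ, |(j : ℝ)| ≤ R * 2 ^ N →
      ‖f ((j + 1) / 2 ^ N) - f (j / 2 ^ N)‖ ≤ ((2 : ℝ) ^ (-α)) ^ N)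
    {x y : ℝ} (hx : |x| ≤ R) (hy : |y| ≤ R) (hxy : |x - y| ≤ (2⁻¹ : ℝ) ^ N₀) :
    ‖f x - f y‖ ≤ (2 / (1 - 2 ^ (-α)) + 1) * 2 ^ α * |x - y| ^ α := by
  wlog hlt : x < y generalizing x y
  · rcases (not_lt.1 hlt).eq_or_lt with rfl | hlt
    · rw [sub_self, norm_zero]
      have : (2 : ℝ) ^ (-α) < 1 := Real.rpow_lt_one_of_one_lt_of_neg one_lt_two (by linarith)
      have : 0 < 1 - (2 : ℝ) ^ (-α) := by linarith
      positivity
    · rw [norm_sub_rev, abs_sub_comm]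
      exact this hy hx (by rwa [abs_sub_comm]) hlt
  set b : ℝ := 2 ^ (-α) with hb
  have hb0 : 0 < b := by positivity
  have hb1 : b < 1 := Real.rpow_lt_one_of_one_lt_of_neg one_lt_two (by linarith)
  rw [abs_sub_comm, abs_of_pos (sub_pos.2 hlt)] at hxy ⊢
  set d := y - x with hd
  have hd0 : 0 < d := sub_pos.2 hlt
  have hd1 : d ≤ 1 := hxy.trans (pow_le_one₀ (by norm_num) (by norm_num))
  obtain ⟨n, hn1, hn2⟩ := exists_nat_pow_near_of_lt_one hd0 hd1 (by norm_num : (0 : ℝ) < 2⁻¹)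
    (by norm_num)
  have hn : N₀ ≤ n := by
    by_contra! hlt'
    have : (2⁻¹ : ℝ) ^ N₀ ≤ 2⁻¹ ^ (n + 1) := pow_le_pow_of_le_one (by norm_num) (by norm_num) hlt'
    linarith
  have hp : (0 : ℝ) < 2 ^ n := by positivity
  have hdn : d * 2 ^ n ≤ 1 := by
    have := mul_le_mul_of_nonneg_right hn2 hp.le
    rwa [← mul_pow, inv_mul_cancel₀ two_ne_zero, one_pow] at this
  set j := ⌊x * 2 ^ n⌋ with hj
  have hfl : ⌊y * 2 ^ n⌋ = j ∨ ⌊y * 2 ^ n⌋ = j + 1 := by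
    have hl : j ≤ ⌊y * 2 ^ n⌋ := Int.floor_mono (by gcongr)
    have hu : ⌊y * 2 ^ n⌋ < j + 2 := Int.floor_lt.2 (by
      push_cast
      have := Int.lt_floor_add_one (x * 2 ^ n)
      have h2 : y * 2 ^ n = x * 2 ^ n + d * 2 ^ n := by rw [hd]; ring
      rw [h2]
      linarith)
    omega
  have hRm : ∃ k : ℤ, (k : ℝ) = R * 2 ^ n := ⟨R * 2 ^ n, by push_cast; ring⟩
  have hmid : ‖f (⌊x * 2 ^ n⌋ / 2 ^ n) - f (⌊y * 2 ^ n⌋ / 2 ^ n)‖ ≤ b ^ n := by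
    rcases hfl with h2 | h2
    · rw [h2, sub_self, norm_zero]
      positivity
    · rw [h2, norm_sub_rev]
      have := h n hn j (abs_floor_mul_le hp hRm hx)
      push_cast
      exact this
  have h1 := norm_sub_floor_le hf hα h hx hn
  have h2 := norm_sub_floor_le hf hα h hy hn
  have hbn : b ^ n ≤ 2 ^ α * d ^ α := by
    rw [← Real.mul_rpow two_pos.le hd0.le]
    have h3 : b ^ n = ((2⁻¹ : ℝ) ^ n) ^ α := by
      rw [hb, Real.rpow_neg two_pos.le, ← Real.inv_rpow two_pos.le, ← Real.rpow_natCast,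
        ← Real.rpow_natCast, ← Real.rpow_mul (by norm_num), ← Real.rpow_mul (by norm_num), mul_comm]
    rw [h3]
    refine Real.rpow_le_rpow (by positivity) ?_ hα.le
    rw [pow_succ] at hn1
    linarith
  have h1b : 0 < 1 - b := by linarith
  calc ‖f x - f y‖ ≤ ‖f (⌊x * 2 ^ n⌋ / 2 ^ n) - f x‖ + ‖f (⌊x * 2 ^ n⌋ / 2 ^ n) - f (⌊y * 2 ^ n⌋ / 2 ^ n)‖
        + ‖f (⌊y * 2 ^ n⌋ / 2 ^ n) - f y‖ := by
        have : f x - f y = -(f (⌊x * 2 ^ n⌋ / 2 ^ n) - f x) +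
          (f (⌊x * 2 ^ n⌋ / 2 ^ n) - f (⌊y * 2 ^ n⌋ / 2 ^ n)) + (f (⌊y * 2 ^ n⌋ / 2 ^ n) - f y) := by ring
        rw [this]
        refine (norm_add₃_le).trans ?_
        rw [norm_neg]
    _ ≤ b ^ n / (1 - b) + b ^ n + b ^ n / (1 - b) := by gcongr
    _ = (2 / (1 - b) + 1) * b ^ n := by field_simp; ring
    _ ≤ (2 / (1 - b) + 1) * (2 ^ α * d ^ α) := by gcongr
    _ = _ := by ring

/-- From e^(−y) ≤ m!/yᵐ with m so large that βᵐ > 4, the terms are at most a constant times 2ᴺ 4⁻ᴺ.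
-/
lemma summable_two_pow_mul_exp_neg {c β : ℝ} (hc : 0 < c) (hβ : 1 < β) :
    Summable fun N : ℕ => (2 : ℝ) ^ N * Real.exp (-(c * β ^ N)) := by
  obtain ⟨m, hm⟩ := pow_unbounded_of_one_lt 4 hβ
  have hβ0 : 0 < β := by linarith
  refine Summable.of_nonneg_of_le (fun N => by positivity) (fun N => ?_)
    ((summable_geometric_of_lt_one (by norm_num) (by norm_num : (2⁻¹ : ℝ) < 1)).mul_left
      (m.factorial / c ^ m))
  have h1 := Real.pow_div_factorial_le_exp (c * β ^ N) (by positivity) m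
  have hy : 0 < (c * β ^ N) ^ m := by positivity
  have hf : (0 : ℝ) < m.factorial := by exact_mod_cast m.factorial_pos
  have h2 : Real.exp (-(c * β ^ N)) ≤ m.factorial / (c * β ^ N) ^ m := by
    rw [Real.exp_neg, ← inv_div]
    exact inv_anti₀ (by positivity) h1
  have h3 : (4 : ℝ) ^ N ≤ (β ^ N) ^ m := by
    rw [← pow_mul, mul_comm, pow_mul]
    exact pow_le_pow_left₀ (by norm_num) hm.le N
  calc (2 : ℝ) ^ N * Real.exp (-(c * β ^ N)) ≤ 2 ^ N * (m.factorial / (c ^ m * 4 ^ N)) := by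
        refine mul_le_mul_of_nonneg_left (h2.trans ?_) (by positivity)
        rw [mul_pow]
        gcongr
    _ = _ := by
      rw [show (4 : ℝ) = 2 * 2 by norm_num, mul_pow, inv_pow]
      field_simp

end Chaining

/-! ### Hölder paths and the dimension of their images -/

section Upper

variable {Ω : Type*} [MeasurableSpace Ω] {P : Measure Ω} [IsProbabilityMeasure P] {θ : ℕ → Ω → ℝ}
  {φ : ℕ → ℝ → ℂ} {a : ℕ → ℂ} {lam : ℕ → ℝ} {q g γ : ℝ}

/-- Borel–Cantelli. Level N has O(2ᴺ) increments of standard deviation of order 2^(−gN) at most, and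
exceeding 2^(−αN) has probability at most 4 exp(−cβᴺ) with β = 2^(2(g−α)) > 1. -/
lemma ae_eventually_dyadic_le {Ω : Type*} [MeasurableSpace Ω] {P : Measure Ω} {S : Ω → ℝ → ℂ} {C α : ℝ} (hC : 0 < C) (hαg : α < g)
    (hP : ∀ x y η : ℝ, 0 < η → P {ω | η ≤ ‖S ω x - S ω y‖} ≤
      ENNReal.ofReal (4 * Real.exp (-η ^ 2 / (32 * (C * |x - y| ^ (2 * g)))))) (R : ℕ) :
    ∀ᵐ ω ∂P, ∃ N₀ : ℕ, ∀ N, N₀ ≤ N → ∀ j : ℤ, |(j : ℝ)| ≤ R * 2 ^ N →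
      ‖S ω ((j + 1) / 2 ^ N) - S ω (j / 2 ^ N)‖ ≤ ((2 : ℝ) ^ (-α)) ^ N := by
  set b : ℝ := 2 ^ (-α) with hb
  have hb0 : 0 < b := by positivity
  set J : ℕ → Finset ℤ := fun N => Finset.Icc (-(R * 2 ^ N)) (R * 2 ^ N) with hJ
  set E : ℕ → Set Ω := fun N => ⋃ j ∈ J N, {ω | b ^ N ≤ ‖S ω ((j + 1) / 2 ^ N) - S ω (j / 2 ^ N)‖} with hE
  set β : ℝ := 2 ^ (2 * (g - α)) with hβ
  have hβ1 : 1 < β := Real.one_lt_rpow one_lt_two (by linarith)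
  have hcard : ∀ N, ((J N).card : ℝ) ≤ (2 * R + 1) * 2 ^ N := by
    intro N
    rw [hJ, Int.card_Icc]
    have h1 : ((R * 2 ^ N + 1 - -(R * 2 ^ N) : ℤ).toNat : ℝ) = 2 * R * 2 ^ N + 1 := by
      rw [show (R * 2 ^ N + 1 - -(R * 2 ^ N) : ℤ) = ((2 * R * 2 ^ N + 1 : ℕ) : ℤ) by push_cast; ring,
        Int.toNat_natCast]
      push_cast; ring
    rw [h1]
    have : (1 : ℝ) ≤ 2 ^ N := one_le_pow₀ one_le_two
    linarith
  have hEle : ∀ N, P (E N) ≤ ENNReal.ofReal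
      ((2 * R + 1) * 4 * (2 ^ N * Real.exp (-((32 * C)⁻¹ * β ^ N)))) := by
    intro N
    calc P (E N) ≤ ∑ j ∈ J N, P {ω | b ^ N ≤ ‖S ω ((j + 1) / 2 ^ N) - S ω (j / 2 ^ N)‖} :=
          measure_biUnion_finset_le _ _
      _ ≤ ∑ j ∈ J N, ENNReal.ofReal (4 * Real.exp (-((32 * C)⁻¹ * β ^ N))) := by
          refine Finset.sum_le_sum fun j _ => (hP _ _ _ (by positivity)).trans (le_of_eq ?_)
          congr 3
          rw [← sub_div, add_sub_cancel_left, abs_of_pos (by positivity)]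
          have h2 : ((2 : ℝ)) ≠ 0 := two_ne_zero
          have hA : (b ^ N) ^ 2 = (2 : ℝ) ^ (-(2 * α * N)) := by
            rw [hb, ← pow_mul, ← Real.rpow_natCast, ← Real.rpow_mul two_pos.le]
            congr 1; push_cast; ring
          have hB : ((1 : ℝ) / 2 ^ N) ^ (2 * g) = 2 ^ (-(2 * g * N)) := by
            rw [one_div, ← Real.rpow_natCast, ← Real.rpow_neg two_pos.le, ← Real.rpow_mul two_pos.le]
            congr 1; ring
          have hD : β ^ N = (2 : ℝ) ^ (-(2 * α * N)) / 2 ^ (-(2 * g * N)) := by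
            rw [hβ, ← Real.rpow_natCast, ← Real.rpow_mul two_pos.le, ← Real.rpow_sub two_pos]
            congr 1; ring
          rw [hA, hB, hD]
          have : (2 : ℝ) ^ (-(2 * g * N)) ≠ 0 := (Real.rpow_pos_of_pos two_pos _).ne'
          field_simp
      _ = ENNReal.ofReal ((J N).card * (4 * Real.exp (-((32 * C)⁻¹ * β ^ N)))) := by
          rw [Finset.sum_const, nsmul_eq_mul, ENNReal.ofReal_mul (p := ((J N).card : ℝ)) (by positivity),
            ENNReal.ofReal_natCast]
      _ ≤ _ := by
          refine ENNReal.ofReal_le_ofReal ?_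
          calc _ ≤ ((2 * R + 1) * 2 ^ N) * (4 * Real.exp (-((32 * C)⁻¹ * β ^ N))) := by
                gcongr
                exact hcard N
            _ = _ := by ring
  have hsum : ∑' N, P (E N) ≠ ⊤ := by
    refine (lt_of_le_of_lt (ENNReal.tsum_le_tsum hEle) (Summable.tsum_ofReal_lt_top ?_)).ne
    exact (summable_two_pow_mul_exp_neg (by positivity) hβ1).mul_left _
  filter_upwards [ae_eventually_notMem hsum] with ω hω
  obtain ⟨N₀, hN₀⟩ := eventually_atTop.1 hω
  refine ⟨N₀, fun N hN j hj => ?_⟩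
  by_contra! hlt
  refine hN₀ N hN (mem_iUnion₂.2 ⟨j, ?_, hlt.le⟩)
  have hj' : |j| ≤ R * 2 ^ N := by exact_mod_cast hj
  exact Finset.mem_Icc.2 (abs_le.1 hj')

lemma dimH_image_le_of_dyadic {f : ℝ → ℂ} (hf : Continuous f) {α : ℝ≥0} (hα : 0 < α)
    (h : ∀ R : ℕ, ∃ N₀ : ℕ, ∀ N, N₀ ≤ N → ∀ j : ℤ, |(j : ℝ)| ≤ R * 2 ^ N →
      ‖f ((j + 1) / 2 ^ N) - f (j / 2 ^ N)‖ ≤ ((2 : ℝ) ^ (-(α : ℝ))) ^ N) (A : Set ℝ) :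
    dimH (f '' A) ≤ dimH A / α := by
  have hα' : (0 : ℝ) < α := hα
  refine dimH_image_le_of_locally_holder_on hα fun x _ => ?_
  obtain ⟨R, hR⟩ := exists_nat_gt (|x| + 1)
  obtain ⟨N₀, hN₀⟩ := h R
  set C : ℝ := (2 / (1 - 2 ^ (-(α : ℝ))) + 1) * 2 ^ (α : ℝ) with hC
  set ρ : ℝ := (2⁻¹ : ℝ) ^ N₀ / 2 with hρ
  have hρ0 : 0 < ρ := by positivity
  have hρ1 : ρ ≤ 1 := by
    have : (2⁻¹ : ℝ) ^ N₀ ≤ 1 := pow_le_one₀ (by norm_num) (by norm_num)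
    rw [hρ]; linarith
  refine ⟨C.toNNReal, Metric.ball x ρ, mem_nhdsWithin_of_mem_nhds (Metric.ball_mem_nhds x hρ0),
    fun y hy z hz => ?_⟩
  rw [Metric.mem_ball, Real.dist_eq] at hy hz
  have hyR : ∀ y, |y - x| < ρ → |y| ≤ R := fun y hy => by
    have := abs_sub_abs_le_abs_sub y x
    linarith
  have hyz : |y - z| ≤ (2⁻¹ : ℝ) ^ N₀ := by
    have := abs_sub_le y x z
    rw [abs_sub_comm x z] at this
    rw [hρ] at hy hz
    linarith
  have := norm_sub_le_of_dyadic hf hα' hN₀ (hyR y hy) (hyR z hz) hyz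
  rw [edist_dist, edist_dist, dist_eq_norm, Real.dist_eq, ENNReal.ofReal_rpow_of_nonneg (abs_nonneg _) hα'.le]
  refine (ENNReal.ofReal_le_ofReal this).trans_eq ?_
  rw [← hC, ENNReal.ofReal_mul' (Real.rpow_nonneg (abs_nonneg _) _)]
  rfl

/-- Almost surely `dim S(A) ≤ dim A / α` as soon as `α < min(σ, 1)`. -/
theorem ae_dimH_image_le (hm : ∀ n, Measurable (θ n)) (hi : iIndepFun θ P)
    (hu : ∀ n, pdf.IsUniform (θ n) (Icc 0 1) P volume) (hφ : BoundedLocallyBiLipschitz φ)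
    (ha : Summable fun n => ‖a n‖) (hq : 1 < q) (hlam : ∀ n, 1 ≤ lam n) {α : ℝ≥0} (hα : 0 < α)
    (hα1 : α < 1) (hασ : ((α : ℝ) : EReal) < sigma a lam q) (A : Set ℝ) :
    ∀ᵐ ω ∂P, dimH (series a φ lam (fun n => θ n ω) '' A) ≤ dimH A / α := by
  have hα0 : (0 : ℝ) < α := hα
  have hα1' : (α : ℝ) < 1 := hα1
  obtain ⟨γ, hαγ, hγ⟩ := EReal.lt_iff_exists_real_btwn.1 hασ
  have hαγ : (α : ℝ) < γ := by exact_mod_cast hαγ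
  -- The chain α < g < γ < σ leaves one margin for each step: α < g for Borel–Cantelli, g < γ for
  -- the weighted sum, γ < σ for the block sizes.
  obtain ⟨g, hg1, hg2⟩ := exists_between (lt_min hαγ hα1')
  obtain ⟨C, hC, hV⟩ := exists_sum_norm_sq_increment_le hφ hq ha hlam (hα0.trans hg1)
    (hg2.le.trans (min_le_right _ _)) (hg2.trans_le (min_le_left _ _)) hγ
  have hP : ∀ x y η : ℝ, 0 < η →
      P {ω | η ≤ ‖series a φ lam (fun n => θ n ω) x - series a φ lam (fun n => θ n ω) y‖} ≤
        ENNReal.ofReal (4 * Real.exp (-η ^ 2 / (32 * (C * |x - y| ^ (2 * g))))) := by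
    intro x y η hη
    simp only [series_sub_series hφ ha]
    exact measure_le_norm_tsum_le hm hi hu (summable_norm_increment hφ ha x y) (hV x y) hη
  have h := ae_all_iff.2 fun R : ℕ => ae_eventually_dyadic_le
    (S := fun ω => series a φ lam (fun n => θ n ω)) hC hg1 hP R
  filter_upwards [h] with ω hω
  exact dimH_image_le_of_dyadic (continuous_series hφ ha _) hα hω A

end Upper

/-! ### The theorem in terms of extended real exponents -/

section Assembly

variable {Ω : Type*} [MeasurableSpace Ω] {P : Measure Ω} [IsProbabilityMeasure P] {θ : ℕ → Ω → ℝ}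
  {φ : ℕ → ℝ → ℂ} {a : ℕ → ℂ} {lam : ℕ → ℝ} {q : ℝ}

lemma exists_dimH_eq_ofReal (A : Set ℝ) : ∃ d : ℝ, 0 ≤ d ∧ dimH A = ENNReal.ofReal d := by
  exact ⟨(dimH A).toReal, ENNReal.toReal_nonneg, (ENNReal.ofReal_toReal (Real.dimH_ne_top A)).symm⟩

lemma dimH_le_two (E : Set ℂ) : dimH E ≤ 2 := by
  refine (dimH_mono (subset_univ E)).trans_eq ?_
  rw [Real.dimH_univ_eq_finrank, Complex.finrank_real_complex]
  rfl

lemma coe_dimH_eq {A : Set ℝ} {d : ℝ} (hd : 0 ≤ d) (h : dimH A = ENNReal.ofReal d) :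
    (dimH A : EReal) = (d : EReal) := by
  rw [h, EReal.coe_ennreal_ofReal, max_eq_left hd]

lemma ae_min_le_dimH_image (hm : ∀ n, Measurable (θ n)) (hi : iIndepFun θ P)
    (hu : ∀ n, pdf.IsUniform (θ n) (Icc 0 1) P volume) (hφ : BoundedLocallyBiLipschitz φ)
    (ha : Summable fun n => ‖a n‖) (hq : 1 < q) {A : Set ℝ} (hA : MeasurableSet A)
    (hτ0 : 0 < tau a lam q) (hτ : tau a lam q < ⊤) :
    ∀ᵐ ω ∂P, min 2 ((dimH A : EReal) / tau a lam q) ≤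
      (dimH (series a φ lam (fun n => θ n ω) '' A) : EReal) := by
  obtain ⟨d, hd0, hd⟩ := exists_dimH_eq_ofReal A
  rw [coe_dimH_eq hd0 hd]
  obtain ⟨t, ht⟩ : ∃ t : ℝ, tau a lam q = t :=
    ⟨_, (EReal.coe_toReal hτ.ne (hτ0.trans_le' bot_le).ne').symm⟩
  rw [ht, EReal.coe_pos] at hτ0
  -- Rational targets r leave a countable union of null sets. For each r, an s' with r < s' < min(2,
  -- d/t) and then a τ' with t < τ' < d/s' give s'τ' < d, as the dimension bound requires.
  have key : ∀ r : ℚ, ((r : ℝ) : EReal) < min 2 ((d : EReal) / tau a lam q) → 0 < r →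
      ∀ᵐ ω ∂P, ((r : ℝ).toNNReal : ℝ≥0∞) ≤ dimH (series a φ lam (fun n => θ n ω) '' A) := by
    intro r hr hr0
    have hr0' : (0 : ℝ) < r := by exact_mod_cast hr0
    rw [lt_min_iff, ht, ← EReal.coe_div, EReal.coe_lt_coe_iff] at hr
    have hr2 : (r : ℝ) < 2 := EReal.coe_lt_coe_iff.1 hr.1
    obtain ⟨s', hs1, hs2⟩ := exists_between (lt_min hr2 hr.2)
    have hs0 : 0 < s' := hr0'.trans hs1
    have hst : t < d / s' := by
      rw [lt_div_iff₀ hs0, mul_comm, ← lt_div_iff₀ hτ0]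
      exact hs2.trans_le (min_le_right _ _)
    obtain ⟨τ', h1, h2⟩ := exists_between hst
    refine ae_le_dimH_image hm hi hu hφ ha hq (hτ0.trans h1) (by rw [ht]; exact_mod_cast h1) hA
      (Real.toNNReal_pos.2 hr0') (s' := s') ?_ (hs2.le.trans (min_le_left _ _)) ?_
    · rwa [Real.coe_toNNReal _ hr0'.le]
    · rw [lt_div_iff₀ hs0, mul_comm] at h2
      rw [hd]
      exact (ENNReal.ofReal_lt_ofReal_iff_of_nonneg (mul_pos hs0 (hτ0.trans h1)).le).2 h2
  have hall : ∀ᵐ ω ∂P, ∀ r : ℚ, ((r : ℝ) : EReal) < min 2 ((d : EReal) / tau a lam q) → 0 < r →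
      ((r : ℝ).toNNReal : ℝ≥0∞) ≤ dimH (series a φ lam (fun n => θ n ω) '' A) := by
    refine ae_all_iff.2 fun r => ?_
    by_cases h : ((r : ℝ) : EReal) < min 2 ((d : EReal) / tau a lam q) ∧ 0 < r
    · exact (key r h.1 h.2).mono fun ω hω _ _ => hω
    · exact ae_of_all _ fun ω h1 h2 => absurd ⟨h1, h2⟩ h
  filter_upwards [hall] with ω hω
  by_contra! hlt
  obtain ⟨r, hr1, hr2⟩ := EReal.lt_iff_exists_rat_btwn.1 hlt
  have hr0 : (0 : ℝ) < r := by
    have := (EReal.coe_ennreal_nonneg _).trans_lt hr1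
    exact_mod_cast this
  have h := hω r hr2 (by exact_mod_cast hr0)
  have h' : (((r : ℝ).toNNReal : ℝ≥0∞) : EReal) = ((r : ℝ) : EReal) := by
    rw [← ENNReal.ofReal, EReal.coe_ennreal_ofReal, max_eq_left hr0.le]
  rw [← EReal.coe_ennreal_le_coe_ennreal_iff, h'] at h
  exact absurd hr1 (not_lt.2 h)

lemma ae_dimH_image_le_min (hm : ∀ n, Measurable (θ n)) (hi : iIndepFun θ P)
    (hu : ∀ n, pdf.IsUniform (θ n) (Icc 0 1) P volume) (hφ : BoundedLocallyBiLipschitz φ)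
    (ha : Summable fun n => ‖a n‖) (hq : 1 < q) (hlam : ∀ n, 1 ≤ lam n) (A : Set ℝ)
    (hσ : 0 < sigma a lam q) :
    ∀ᵐ ω ∂P, (dimH (series a φ lam (fun n => θ n ω) '' A) : EReal) ≤
      min 2 ((dimH A : EReal) / min (sigma a lam q) 1) := by
  obtain ⟨d, hd0, hd⟩ := exists_dimH_eq_ofReal A
  rw [coe_dimH_eq hd0 hd]
  have hm0 : 0 < min (sigma a lam q) 1 := lt_min hσ zero_lt_one
  have hm1 : min (sigma a lam q) 1 ≤ ((1 : ℝ) : EReal) := min_le_right _ _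
  obtain ⟨t, ht⟩ : ∃ t : ℝ, min (sigma a lam q) 1 = t :=
    ⟨_, (EReal.coe_toReal (hm1.trans_lt (EReal.coe_lt_top _)).ne (hm0.trans_le' bot_le).ne').symm⟩
  have htσ : (t : EReal) ≤ sigma a lam q := ht ▸ min_le_left _ _
  rw [ht, EReal.coe_le_coe_iff] at hm1
  rw [ht, EReal.coe_pos] at hm0
  rw [ht, ← EReal.coe_div]
  have hall : ∀ᵐ ω ∂P, ∀ r : ℚ, 0 < r → (r : ℝ) < t →
      dimH (series a φ lam (fun n => θ n ω) '' A) ≤ dimH A / (r : ℝ).toNNReal := by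
    refine ae_all_iff.2 fun r => ?_
    by_cases h : 0 < r ∧ (r : ℝ) < t
    · have hr0 : (0 : ℝ) < r := by exact_mod_cast h.1
      have hr := ae_dimH_image_le hm hi hu hφ ha hq hlam (Real.toNNReal_pos.2 hr0)
        (by rw [← NNReal.coe_lt_coe, Real.coe_toNNReal _ hr0.le]; exact h.2.trans_le hm1)
        (by rw [Real.coe_toNNReal _ hr0.le]; exact (EReal.coe_lt_coe_iff.2 h.2).trans_le htσ) A
      exact hr.mono fun ω hω _ _ => hω
    · exact ae_of_all _ fun ω h1 h2 => absurd ⟨h1, h2⟩ h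
  filter_upwards [hall] with ω hω
  have hD2 := dimH_le_two (series a φ lam (fun n => θ n ω) '' A)
  set D := dimH (series a φ lam (fun n => θ n ω) '' A) with hD
  have hDtop : D ≠ ⊤ := Real.dimH_ne_top _
  refine le_min ?_ ?_
  · exact EReal.coe_ennreal_le_coe_ennreal_iff.2 hD2
  rw [← ENNReal.ofReal_toReal hDtop, EReal.coe_ennreal_ofReal, max_eq_left ENNReal.toReal_nonneg,
    EReal.coe_le_coe_iff]
  -- If the image had dimension D > d/t, a rational r between d/D and t would have d/r < D, against
  -- the bound for this r.
  by_contra! hlt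
  have hDpos : 0 < D.toReal := (by positivity : 0 ≤ d / t).trans_lt hlt
  rw [div_lt_comm₀ hm0 hDpos] at hlt
  obtain ⟨r, hr1, hr2⟩ := exists_rat_btwn hlt
  have hr0 : (0 : ℝ) < r := (by positivity : 0 ≤ d / D.toReal).trans_lt hr1
  have h := hω r (by exact_mod_cast hr0) hr2
  rw [← ENNReal.ofReal_toReal hDtop, hd, ← ENNReal.ofReal, ← ENNReal.ofReal_div_of_pos hr0,
    ENNReal.ofReal_le_ofReal_iff (by positivity)] at h
  rw [div_lt_comm₀ hDpos hr0] at hr1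
  linarith

end Assembly

end SteinhausSeries

/-! ### The main theorem -/

theorem theorem1p1
    {Ω : Type*} [MeasurableSpace Ω] (P : MeasureTheory.Measure Ω)
    [MeasureTheory.IsProbabilityMeasure P]
    (θ : ℕ → Ω → ℝ) (hθ_meas : ∀ n, Measurable (θ n))
    (hθ_indep : ProbabilityTheory.iIndepFun θ P)
    (hθ_unif : ∀ n, MeasureTheory.pdf.IsUniform (θ n) (Set.Icc 0 1) P MeasureTheory.volume)
    (φ : ℕ → ℝ → ℂ) (hφ : SteinhausSeries.BoundedLocallyBiLipschitz φ)
    (a : ℕ → ℂ) (ha : ∀ n, a n ≠ 0) (ha_sum : Summable fun n => ‖a n‖)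
    (lam : ℕ → ℝ) (hlam : Monotone lam) (hlam_zero : lam 0 = 1)
    (q : ℝ) (hq : IsLUB (Set.range fun n => lam (n + 1) / lam n) q) (hq_one : 1 < q)
    (A : Set ℝ) (hA : MeasurableSet A) :
    (0 < SteinhausSeries.sigma a lam q → SteinhausSeries.tau a lam q < ⊤ →
      ∀ᵐ ω ∂P,
        min 2 ((dimH A : EReal) / SteinhausSeries.tau a lam q) ≤
            (dimH (SteinhausSeries.series a φ lam (fun n => θ n ω) '' A) : EReal) ∧
          (dimH (SteinhausSeries.series a φ lam (fun n => θ n ω) '' A) : EReal) ≤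
            min 2 ((dimH A : EReal) / min (SteinhausSeries.sigma a lam q) 1)) ∧
    (0 < SteinhausSeries.tau a lam q →
      SteinhausSeries.tau a lam q < (dimH A : EReal) / 2 →
      ∀ᵐ ω ∂P,
        0 < MeasureTheory.volume (SteinhausSeries.series a φ lam (fun n => θ n ω) '' A)) ∧
    (0 < SteinhausSeries.tau a lam q →
      SteinhausSeries.tau a lam q < (dimH A : EReal) / 4 →
      ∀ᵐ ω ∂P,
        (interior (SteinhausSeries.series a φ lam (fun n => θ n ω) '' A)).Nonempty) ∧
    (SteinhausSeries.tau a lam q = 0 → 0 < dimH A →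
      ∀ᵐ ω ∂P,
        (interior (SteinhausSeries.series a φ lam (fun n => θ n ω) '' A)).Nonempty) := by
  obtain ⟨d, hd0, hd⟩ := SteinhausSeries.exists_dimH_eq_ofReal A
  have hdE := SteinhausSeries.coe_dimH_eq hd0 hd
  -- A real exponent strictly above τ that keeps cτ' below the dimension; c = 2 serves area and c =
  -- 4 interior. It is positive even when τ = 0, which is how (iv) reduces to the argument for
  -- (iii).
  have hbetween : ∀ c : ℝ, 0 < c → 0 ≤ SteinhausSeries.tau a lam q →
      SteinhausSeries.tau a lam q < ((d / c : ℝ) : EReal) →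
      ∃ τ' : ℝ, 0 < τ' ∧ SteinhausSeries.tau a lam q < τ' ∧ ENNReal.ofReal (c * τ') < dimH A := by
    intro c hc h0 h
    obtain ⟨τ', h1, h2⟩ := EReal.lt_iff_exists_real_btwn.1 h
    have hτ' : 0 < τ' := by exact_mod_cast h0.trans_lt h1
    rw [EReal.coe_lt_coe_iff, lt_div_iff₀ hc, mul_comm] at h2
    refine ⟨τ', hτ', h1, ?_⟩
    rw [hd]
    exact (ENNReal.ofReal_lt_ofReal_iff_of_nonneg (by positivity)).2 h2
  refine ⟨fun hσ hτ => ?_, fun h0 h => ?_, fun h0 h => ?_, fun h0 h => ?_⟩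
  · have hτ0 : 0 < SteinhausSeries.tau a lam q := hσ.trans_le Filter.liminf_le_limsup
    filter_upwards [SteinhausSeries.ae_min_le_dimH_image hθ_meas hθ_indep hθ_unif hφ ha_sum hq_one hA
      hτ0 hτ, SteinhausSeries.ae_dimH_image_le_min hθ_meas hθ_indep hθ_unif hφ ha_sum hq_one
      (fun n => hlam_zero ▸ hlam (Nat.zero_le n)) A hσ] with ω h1 h2
    exact ⟨h1, h2⟩
  · rw [hdE] at h
    obtain ⟨τ', hτ', h1, h2⟩ := hbetween 2 two_pos h0.le h
    exact SteinhausSeries.ae_volume_image_pos hθ_meas hθ_indep hθ_unif hφ ha_sum hq_one hτ' h1 hA h2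
  · rw [hdE] at h
    obtain ⟨τ', hτ', h1, h2⟩ := hbetween 4 four_pos h0.le h
    exact SteinhausSeries.ae_interior_image_nonempty hθ_meas hθ_indep hθ_unif hφ ha_sum hq_one hτ' h1
      hA h2
  · have hd' : 0 < d := by rwa [hd, ENNReal.ofReal_pos] at h
    obtain ⟨τ', hτ', h1, h2⟩ := hbetween 4 four_pos h0.ge
      (by rw [h0]; exact_mod_cast (by positivity : 0 < d / 4))
    exact SteinhausSeries.ae_interior_image_nonempty hθ_meas hθ_indep hθ_unif hφ ha_sum hq_one hτ' h1
      hA h2
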